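/- **Setting.** Let $\mathcal D=\{|z|<1\}$, $\eta>1$, and let $\mathcal{FB}_\eta$ be the space of holomorphic functions on $\mathcal D$ that are square integrable for $\langle f_1|f_2\rangle=\frac{2\eta-1}{\pi}\int_{\mathcal D}\overline{f_1}f_2\,(1-|z|^2)^{2\eta-2}d^2z$, with orthonormal basis $e_n(z)=\sqrt{(2\eta)_n/n!}\,z^n$ ($n\ge 0$). For $a\in\mathcal D$ let $(U^\eta(p(a))f)(z)=(1-|a|^2)^\eta(1-z\bar a)^{-2\eta}f\big(\tfrac{z-a}{1-z\bar a}\big)$ (principal branch), and let $(\mathsf Pf)(z)=f(-z)$. Let $w$ be a (possibly complex-valued) function on $[0,1)$ such that $$\mathsf M=\mathsf M^{w;\eta}=2\int_{\mathcal D}\frac{d^2z}{(1-|z|^2)^2}\,w(|z|^2)\,U^\eta(p(z))\mathsf P ,$$ understood weakly (on the matrix elements in the basis $e_n$, with absolutely convergent integrals), is a bounded trace class operator with $\operatorname{tr}\mathsf M=\sum_k\mathsf M_{kk}=1$, where $\mathsf M_{kk}=\langle e_k|\mathsf M e_k\rangle$. Put $\mathsf M(p(z))=U^\eta(p(z))\,\mathsf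 M\,U^\eta(p(-z))$ and, for a function $f$ on $\mathcal D$, $$\mathsf A_f=\frac{2\eta-1}{\pi}\int_{\mathcal D}\frac{d^2z}{(1-|z|^2)^2}\,f(z)\,\mathsf M(p(z)),\qquad \tilde{\mathsf A}_f=\frac{2\eta-1}{\pi}\int_{\mathcal D}\frac{d^2z}{(1-|z|^2)^2}\,f(z)\,\mathsf M(p(\bar z)) .$$ The classical observables are $k_0=\frac{1+|z|^2}{1-|z|^2}$, $k_1=\frac1{\mathrm i}\frac{z-\bar z}{1-|z|^2}$, $k_2=\frac{z+\bar z}{1-|z|^2}$, $k_\pm=k_2\mp\mathrm i k_1$. The discrete-series generators are $K_0=z\frac{d}{dz}+\eta$, $K_1=-\frac{\mathrm i}{2}(1-z^2)\frac d{dz}+\mathrm i\eta z$, $K_2=\frac12(1+z^2)\frac d{dz}+\eta z$, $K_\pm=K_2\mp\mathrm iK_1$, all on the domain of $K_0$, that is, on $\{\psi\in\mathcal{FB}_\eta:\psi'\text{ is square integrable for the above measure}\}$. **Proposition.** Let $\mathcal S\in\mathbb C$ and $\gamma=\frac1{\eta-1}\big(1+\frac{\mathcal S}{\eta}\big)$.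 1. Suppose that $\sum_k k\,\mathsf M_{kk}$ converges absolutely, with sum $\mathcal S$. Then $$\mathsf A_{k_0}=\gamma K_0,\quad \mathsf A_{k_1}=-\gamma K_1,\quad \mathsf A_{k_2}=\gamma K_2,\quad\text{and}\quad \mathsf A_{k_\pm}=\gamma K_\mp ,$$ and, with the complex conjugate labelling of the displaced operators, $\tilde{\mathsf A}_{k_a}=\gamma K_a$ for $a=0,1,2$ and for $a=\pm$. Each identity $\mathsf A_f=A$ is meant weakly: for all $\varphi,\psi$ in the domain of $K_0$, the integral defining $\langle\varphi|\mathsf A_f\psi\rangle$ converges absolutely and equals $\langle\varphi|A\psi\rangle$. 2. More generally, suppose that $\sum_k k\,\mathsf M_{kk}=\mathcal S$ in the sense of a summation method by convergence factors. That is, along a filter in $i$ there are real numbers $c_i(k)$, bounded uniformly in $i$ and $k$, with $c_i(k)\to1$ for each $k$; eventually in $i$ the series $\sum_k c_i(k)\,k\,\mathsf M_{kk}$ converges absolutely; and its sum tends to $\mathcal S$. (Partial sums, Cesàro and Abel summation are examples.) Then the same ten identities hold when $\langle\varphi|\mathsf A_f\psi\rangle$ is understood as the series $$\frac{2\eta-1}{\pi}\sum_k\mathsf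 M_{kk}\int_{\mathcal D}\frac{d^2z}{(1-|z|^2)^2}\,f(z)\,\langle\varphi|U^\eta(p(z))e_k\rangle\langle U^\eta(p(z))e_k|\psi\rangle$$ summed by the same method, with absolutely convergent integrals (and likewise for $\tilde{\mathsf A}_f$, with $p(\bar z)$ in place of $p(z)$). -/

import Mathlib

open MeasureTheory Filter
open scoped Topology ComplexConjugate InnerProductSpace

noncomputable section

namespace SU11

/-! ### The Fock-Bargmann space -/

/-- The open unit disk. -/
def disc : Set ℂ := Metric.ball 0 1

/-- The density `(2η-1)/π (1-|z|²)^(2η-2)` with respect to the Lebesgue measure `d²z`. -/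
def density (η : ℝ) (z : ℂ) : ℝ :=
  (2 * η - 1) / Real.pi * (1 - ‖z‖ ^ 2) ^ (2 * η - 2)

/-- The measure `(2η-1)/π (1-|z|²)^(2η-2) d²z` on the disk. -/
def fbMeasure (η : ℝ) : Measure ℂ :=
  (volume.restrict disc).withDensity fun z => ENNReal.ofReal (density η z)

/-- Functions that are holomorphic on the disk and square integrable for `fbMeasure η`; a function
on the disk is extended by `0` to the plane. -/
def fbSubmodule (η : ℝ) : Submodule ℂ (ℂ → ℂ) where
  carrier := {f | DifferentiableOn ℂ f disc ∧ (∀ z, z ∉ disc → f z = 0) ∧ MemLp f 2 (fbMeasure η)}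
  add_mem' := by
    rintro f g ⟨hf, hf', hf''⟩ ⟨hg, hg', hg''⟩
    exact ⟨hf.add hg, fun z hz => by simp [hf' z hz, hg' z hz], hf''.add hg''⟩
  zero_mem' := ⟨differentiableOn_const 0, fun _ _ => rfl, MemLp.zero⟩
  smul_mem' := by
    rintro c f ⟨hf, hf', hf''⟩
    exact ⟨hf.const_smul c, fun z hz => by simp [hf' z hz], hf''.const_smul c⟩

/-- The Fock-Bargmann space of parameter `η`. -/
def FB (η : ℝ) : Type := fbSubmodule η

variable {η : ℝ}

instance : AddCommGroup (FB η) := inferInstanceAs (AddCommGroup (fbSubmodule η))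
instance : Module ℂ (FB η) := inferInstanceAs (Module ℂ (fbSubmodule η))

/-- The function on the disk (extended by `0`) underlying an element of `FB η`. -/
def FB.toFun (f : FB η) : ℂ → ℂ := Subtype.val (p := fun g => g ∈ fbSubmodule η) f

instance : CoeFun (FB η) (fun _ => ℂ → ℂ) := ⟨FB.toFun⟩

theorem FB.differentiableOn (f : FB η) : DifferentiableOn ℂ f disc := f.2.1

theorem FB.memLp (f : FB η) : MemLp f 2 (fbMeasure η) := f.2.2.2

theorem FB.ext {f g : FB η} (h : ∀ z ∈ disc, f z = g z) : f = g := by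
  refine Subtype.ext (funext fun z => ?_)
  by_cases hz : z ∈ disc
  · exact h z hz
  · rw [f.2.2.1 z hz, g.2.2.1 z hz]

theorem isOpen_disc : IsOpen disc := Metric.isOpen_ball

theorem measurableSet_disc : MeasurableSet disc := isOpen_disc.measurableSet

theorem mem_disc {z : ℂ} : z ∈ disc ↔ ‖z‖ < 1 := by simp [disc]

theorem one_sub_sq_pos {z : ℂ} (hz : z ∈ disc) : 0 < 1 - ‖z‖ ^ 2 := by
  have := mem_disc.1 hz
  nlinarith [norm_nonneg z]

theorem measurable_density : Measurable (density η) := by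
  unfold density; fun_prop

theorem density_pos (hη : 1 / 2 < η) {z : ℂ} (hz : z ∈ disc) : 0 < density η z :=
  mul_pos (div_pos (by linarith) Real.pi_pos) (Real.rpow_pos_of_pos (one_sub_sq_pos hz) _)

theorem lintegral_fbMeasure (g : ℂ → ENNReal) :
    ∫⁻ z, g z ∂fbMeasure η = ∫⁻ z in disc, ENNReal.ofReal (density η z) * g z := by
  rw [fbMeasure, lintegral_withDensity_eq_lintegral_mul_non_measurable]
  · rfl
  · exact measurable_density.ennreal_ofReal
  · exact ae_of_all _ fun _ => ENNReal.ofReal_lt_top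

theorem ac_fbMeasure : fbMeasure η ≪ volume.restrict disc := withDensity_absolutelyContinuous _ _

theorem ac_fbMeasure' (hη : 1 / 2 < η) : volume.restrict disc ≪ fbMeasure η := by
  refine withDensity_absolutelyContinuous' measurable_density.ennreal_ofReal.aemeasurable ?_
  filter_upwards [ae_restrict_mem measurableSet_disc] with z hz
  simpa using density_pos hη hz

theorem aesm_of_continuousOn {f : ℂ → ℂ} (hf : ContinuousOn f disc) :
    AEStronglyMeasurable f (fbMeasure η) :=
  (hf.aestronglyMeasurable measurableSet_disc).mono_ac ac_fbMeasure

theorem FB.ae_eq_zero (hη : 1 / 2 < η) {f : FB η} (h : ∀ᵐ z ∂fbMeasure η, f z = 0) : f = 0 := by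
  refine FB.ext fun z hz => ?_
  have h' : f.toFun =ᵐ[volume.restrict disc] fun _ => (0 : ℂ) := (ac_fbMeasure' hη).ae_le h
  exact Measure.eqOn_open_of_ae_eq h' isOpen_disc f.differentiableOn.continuousOn continuousOn_const hz

theorem FB.integrable (f g : FB η) : Integrable (fun z => conj (f z) * g z) (fbMeasure η) :=
  MemLp.integrable_mul (p := 2) (q := 2) f.memLp.star g.memLp

/-- The scalar product `⟨f|g⟩ = (2η-1)/π ∫_𝒟 conj (f z) (g z) (1-|z|²)^(2η-2) d²z`. -/
@[reducible] def fbCore (hη : 1 / 2 < η) : InnerProductSpace.Core ℂ (FB η) where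
  inner f g := ∫ z, conj (f z) * g z ∂fbMeasure η
  conj_inner_symm f g := by
    rw [← integral_conj]
    refine integral_congr_ae (ae_of_all _ fun z => ?_)
    simp [mul_comm]
  re_inner_nonneg f := by
    have : ∀ z, conj (f z) * f z = ((‖f z‖ ^ 2 : ℝ) : ℂ) := fun z => by
      rw [Complex.conj_mul']; push_cast; rfl
    simp only [this, integral_complex_ofReal]
    exact integral_nonneg fun z => by positivity
  add_left f g h := by
    rw [← integral_add (FB.integrable f h) (FB.integrable g h)]
    refine integral_congr_ae (ae_of_all _ fun z => ?_)
    change conj (f z + g z) * h z = _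
    simp [add_mul]
  smul_left f g r := by
    rw [← integral_const_mul]
    refine integral_congr_ae (ae_of_all _ fun z => ?_)
    change conj (r * f z) * g z = _
    simp [mul_assoc]
  definite f hf := by
    have h1 : ∀ z, conj (f z) * f z = ((‖f z‖ ^ 2 : ℝ) : ℂ) := fun z => by
      rw [Complex.conj_mul']; push_cast; rfl
    simp only [h1] at hf
    rw [integral_complex_ofReal, Complex.ofReal_eq_zero,
      integral_eq_zero_iff_of_nonneg (fun z => by positivity) (f.memLp.integrable_norm_pow two_ne_zero)] at hf
    refine FB.ae_eq_zero hη ?_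
    filter_upwards [hf] with z hz
    simpa using hz

instance [Fact (1 / 2 < η)] : NormedAddCommGroup (FB η) :=
  @InnerProductSpace.Core.toNormedAddCommGroup ℂ (FB η) _ _ _ (fbCore Fact.out)

instance [Fact (1 / 2 < η)] : InnerProductSpace ℂ (FB η) :=
  InnerProductSpace.ofCore (fbCore Fact.out).toCore

theorem inner_def [Fact (1 / 2 < η)] (f g : FB η) :
    ⟪f, g⟫_ℂ = ∫ z, conj (f z) * g z ∂fbMeasure η := rfl

theorem norm_sq_eq [Fact (1 / 2 < η)] (f : FB η) :
    ‖f‖ ^ 2 = (∫⁻ z, ‖f z‖ₑ ^ 2 ∂fbMeasure η).toReal := by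
  have h1 : ∀ z, conj (f z) * f z = ((‖f z‖ ^ 2 : ℝ) : ℂ) := fun z => by
    rw [Complex.conj_mul']; push_cast; rfl
  rw [← inner_self_eq_norm_sq (𝕜 := ℂ), inner_def]
  simp only [h1, integral_complex_ofReal]
  rw [integral_eq_lintegral_of_nonneg_ae (ae_of_all _ fun z => by positivity)]
  · simp only [RCLike.re_to_complex, Complex.ofReal_re]
    congr 1
    refine lintegral_congr fun z => ?_
    rw [ENNReal.ofReal_pow (norm_nonneg _), ofReal_norm]
  · exact (f.memLp.1.norm.pow 2)

theorem memLp_iff {f : ℂ → ℂ} (hf : ContinuousOn f disc) :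
    MemLp f 2 (fbMeasure η) ↔ ∫⁻ z, ‖f z‖ₑ ^ 2 ∂fbMeasure η < ⊤ := by
  rw [MemLp, and_iff_right (aesm_of_continuousOn hf), eLpNorm_lt_top_iff_lintegral_rpow_enorm_lt_top (by simp)
    (by simp)]
  simp

theorem isFiniteMeasure_fbMeasure (hη : 1 / 2 < η) : IsFiniteMeasure (fbMeasure η) := by
  refine isFiniteMeasure_withDensity_ofReal (Integrable.hasFiniteIntegral ?_)
  have h : Integrable (fun z : ℂ => (Set.Iio (1 : ℝ)).indicator (fun r => (2 * η - 1) / Real.pi *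
      (1 - r ^ 2) ^ (2 * η - 2)) ‖z‖) := by
    rw [integrable_fun_norm_addHaar volume (f := (Set.Iio (1 : ℝ)).indicator
      (fun r => (2 * η - 1) / Real.pi * (1 - r ^ 2) ^ (2 * η - 2)))]
    have h0 : IntegrableOn (fun r : ℝ => (1 - r) ^ (2 * η - 2)) (Set.Ioo 0 1) := by
      have h1 := (intervalIntegral.intervalIntegrable_rpow' (a := 0) (b := 1) (r := 2 * η - 2)
        (by linarith)).comp_sub_left 1
      simp only [sub_zero, sub_self] at h1
      have h2 := h1.symm
      rw [intervalIntegrable_iff_integrableOn_Ioo_of_le zero_le_one] at h2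
      exact h2
    have h3 : IntegrableOn (fun r : ℝ => (r * ((2 * η - 1) / Real.pi * (1 + r) ^ (2 * η - 2))) *
        (1 - r) ^ (2 * η - 2)) (Set.Ioo 0 1) := by
      refine IntegrableOn.continuousOn_mul_of_subset (K := Set.Icc 0 1) ?_ h0 isCompact_Icc
        measurableSet_Ioo Set.Ioo_subset_Icc_self
      refine continuousOn_id.mul (continuousOn_const.mul ?_)
      exact (continuousOn_const.add continuousOn_id).rpow_const
        fun x hx => Or.inl (by have := hx.1; exact (add_pos_of_pos_of_nonneg one_pos this).ne')
    have h4 : IntegrableOn ((Set.Iio (1 : ℝ)).indicator fun r : ℝ =>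
        (r * ((2 * η - 1) / Real.pi * (1 + r) ^ (2 * η - 2))) * (1 - r) ^ (2 * η - 2))
        (Set.Ioi 0) := by
      rw [IntegrableOn, integrable_indicator_iff measurableSet_Iio, IntegrableOn,
        Measure.restrict_restrict measurableSet_Iio, Set.inter_comm, Set.Ioi_inter_Iio]
      exact h3
    refine h4.congr_fun (fun r hr => ?_) measurableSet_Ioi
    simp only [Complex.finrank_real_complex, Set.indicator, Set.mem_Iio, smul_eq_mul]
    split_ifs with h5
    · have hr' : (0 : ℝ) < r := hr
      rw [show 1 - r ^ 2 = (1 + r) * (1 - r) by ring,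
        Real.mul_rpow (by positivity) (by linarith)]
      ring
    · simp
  refine (h.integrableOn (s := disc)).congr_fun (fun z hz => ?_) measurableSet_disc
  have hz' := mem_disc.1 hz
  simp [density, hz']

/-- A function that is continuous on the disk and bounded there is square integrable. -/
theorem memLp_of_bound (hη : 1 / 2 < η) {f : ℂ → ℂ} (hf : ContinuousOn f disc) (C : ℝ)
    (hC : ∀ z ∈ disc, ‖f z‖ ≤ C) : MemLp f 2 (fbMeasure η) := by
  have := isFiniteMeasure_fbMeasure hη
  exact MemLp.of_bound (aesm_of_continuousOn hf) C
    (ac_fbMeasure.ae_le ((ae_restrict_mem measurableSet_disc).mono hC))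

/-- Two functions which agree on the disk are square integrable simultaneously. -/
theorem memLp_congr {f g : ℂ → ℂ} (h : ∀ z ∈ disc, f z = g z) (hg : MemLp g 2 (fbMeasure η)) :
    MemLp f 2 (fbMeasure η) := by
  refine hg.ae_eq (ac_fbMeasure.ae_le ?_)
  filter_upwards [ae_restrict_mem measurableSet_disc] with z hz using (h z hz).symm

/-- The element of `FB η` given by a function that is holomorphic and square integrable on the
disk; its values outside the disk are discarded. -/
def FB.mk (f : ℂ → ℂ) (hf : DifferentiableOn ℂ f disc) (hf' : MemLp f 2 (fbMeasure η)) : FB η :=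
  ⟨disc.indicator f, hf.congr fun z hz => by simp [hz], fun z hz => by simp [hz],
    memLp_congr (fun z hz => by simp [hz]) hf'⟩

theorem FB.mk_apply {f : ℂ → ℂ} (hf : DifferentiableOn ℂ f disc) (hf' : MemLp f 2 (fbMeasure η))
    {z : ℂ} (hz : z ∈ disc) : FB.mk f hf hf' z = f z := by
  simp [FB.mk, FB.toFun, hz]

theorem FB.add_apply (f g : FB η) (z : ℂ) : (f + g) z = f z + g z := rfl

theorem FB.smul_apply (c : ℂ) (f : FB η) (z : ℂ) : (c • f) z = c * f z := rfl

/-- The orthonormal basis `e_n(z) = √((2η)_n / n!) zⁿ`, with `(2η)_n = Γ(2η+n)/Γ(2η)`. -/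
def e (n : ℕ) [hη : Fact (1 / 2 < η)] : FB η :=
  FB.mk (fun z => (√(Real.Gamma (2 * η + n) / Real.Gamma (2 * η) / n.factorial) : ℝ) * z ^ n)
    (by fun_prop)
    (memLp_of_bound hη.out (by fun_prop)
      |√(Real.Gamma (2 * η + n) / Real.Gamma (2 * η) / n.factorial)| fun z hz => by
        rw [norm_mul, norm_pow, Complex.norm_real, Real.norm_eq_abs]
        exact mul_le_of_le_one_right (abs_nonneg _)
          (pow_le_one₀ (norm_nonneg _) (mem_disc.1 hz).le))

/-! ### The parity operator and the displacement operators -/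

theorem neg_mem_disc {z : ℂ} (hz : z ∈ disc) : -z ∈ disc := by
  rw [mem_disc] at *; simpa using hz

theorem memLp_comp_neg {f : ℂ → ℂ} (hf : ContinuousOn f disc) (hf' : MemLp f 2 (fbMeasure η)) :
    MemLp (fun z => f (-z)) 2 (fbMeasure η) := by
  have hc : ContinuousOn (fun z => f (-z)) disc :=
    hf.comp continuousOn_neg fun z hz => neg_mem_disc hz
  rw [memLp_iff hc, lintegral_fbMeasure]
  rw [memLp_iff hf, lintegral_fbMeasure] at hf'
  have h := (Measure.measurePreserving_neg (volume : Measure ℂ)).setLIntegral_comp_preimage_emb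
    (MeasurableEquiv.neg ℂ).measurableEmbedding
    (fun z => ENNReal.ofReal (density η z) * ‖f z‖ₑ ^ 2) disc
  have hd : (Neg.neg : ℂ → ℂ) ⁻¹' disc = disc := by
    ext z; simp [mem_disc]
  rw [hd] at h
  simpa [density] using h.trans_lt hf'

/-- The parity operator `(P f)(z) = f(-z)`. -/
def parity : FB η →ₗ[ℂ] FB η where
  toFun f := FB.mk (fun z => f (-z))
    (f.differentiableOn.comp (differentiableOn_neg _) fun _ hz => neg_mem_disc hz)
    (memLp_comp_neg f.differentiableOn.continuousOn f.memLp)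
  map_add' f g := FB.ext fun z hz => by
    rw [FB.add_apply, FB.mk_apply _ _ hz, FB.mk_apply _ _ hz, FB.mk_apply _ _ hz, FB.add_apply]
  map_smul' c f := FB.ext fun z hz => by
    rw [RingHom.id_apply, FB.smul_apply, FB.mk_apply _ _ hz, FB.mk_apply _ _ hz, FB.smul_apply]

/-- In the basis `e_n` the parity operator is `∑ (-1)ⁿ |e_n⟩⟨e_n|`. -/
theorem parity_e (n : ℕ) [Fact (1 / 2 < η)] : parity (e n : FB η) = (-1 : ℂ) ^ n • e n := by
  refine FB.ext fun z hz => ?_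
  rw [FB.smul_apply, e, FB.mk_apply _ _ hz, parity, LinearMap.coe_mk, AddHom.coe_mk,
    FB.mk_apply _ _ hz, FB.mk_apply _ _ (neg_mem_disc hz), neg_pow]
  ring

/-- The Möbius map `p(-a)·z = (z - a)/(1 - z ā)`. -/
def mobius (a z : ℂ) : ℂ := (z - a) / (1 - z * conj a)

theorem one_sub_ne_zero {a z : ℂ} (ha : a ∈ disc) (hz : z ∈ disc) : 1 - z * conj a ≠ 0 := by
  intro h
  have h1 : ‖z * conj a‖ = 1 := by rw [← sub_eq_zero.1 h]; simp
  rw [norm_mul, RCLike.norm_conj] at h1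
  have := mem_disc.1 ha
  have := mem_disc.1 hz
  nlinarith [norm_nonneg z, norm_nonneg a]

theorem one_sub_mem_slitPlane {a z : ℂ} (ha : a ∈ disc) (hz : z ∈ disc) :
    1 - z * conj a ∈ Complex.slitPlane := by
  refine Or.inl ?_
  have h1 : (z * conj a).re ≤ ‖z * conj a‖ := Complex.re_le_norm _
  rw [norm_mul, RCLike.norm_conj] at h1
  have := mem_disc.1 ha
  have := mem_disc.1 hz
  simp only [Complex.sub_re, Complex.one_re]
  nlinarith [norm_nonneg z, norm_nonneg a]

theorem one_sub_norm_mobius {a z : ℂ} (ha : a ∈ disc) (hz : z ∈ disc) :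
    1 - ‖mobius a z‖ ^ 2 = (1 - ‖a‖ ^ 2) * (1 - ‖z‖ ^ 2) / ‖1 - z * conj a‖ ^ 2 := by
  have h := norm_ne_zero_iff.2 (one_sub_ne_zero ha hz)
  rw [mobius, norm_div, div_pow, eq_div_iff (pow_ne_zero 2 h), sub_mul,
    div_mul_cancel₀ _ (pow_ne_zero 2 h)]
  simp only [← Complex.normSq_eq_norm_sq, Complex.normSq_apply]
  simp
  ring

theorem mobius_mem {a z : ℂ} (ha : a ∈ disc) (hz : z ∈ disc) : mobius a z ∈ disc := by
  have h := one_sub_norm_mobius ha hz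
  have h1 : 0 < 1 - ‖mobius a z‖ ^ 2 := by
    rw [h]
    have := norm_pos_iff.2 (one_sub_ne_zero ha hz)
    have := one_sub_sq_pos ha
    have := one_sub_sq_pos hz
    positivity
  rw [mem_disc]
  nlinarith [norm_nonneg (mobius a z)]

theorem mobius_neg_mobius {a z : ℂ} (ha : a ∈ disc) (hz : z ∈ disc) :
    mobius (-a) (mobius a z) = z := by
  have h := one_sub_ne_zero ha hz
  have h' := one_sub_ne_zero ha ha
  have h2 : 1 + (z - a) / (1 - z * conj a) * conj a = (1 - a * conj a) / (1 - z * conj a) := by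
    field_simp; ring
  have h3 : (z - a) / (1 - z * conj a) + a = z * (1 - a * conj a) / (1 - z * conj a) := by
    field_simp; ring
  simp only [mobius, map_neg, mul_neg, sub_neg_eq_add]
  rw [h2, h3]
  field_simp

theorem hasDerivAt_mobius {a z : ℂ} (ha : a ∈ disc) (hz : z ∈ disc) :
    HasDerivAt (mobius a) ((1 - a * conj a) / (1 - z * conj a) ^ 2) z := by
  have h := ((hasDerivAt_id z).sub_const a).div
    (((hasDerivAt_id z).mul_const (conj a)).const_sub 1) (one_sub_ne_zero ha hz)
  refine h.congr_deriv ?_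
  simp only [id]
  ring

theorem mobius_image {a : ℂ} (ha : a ∈ disc) : mobius a '' disc = disc := by
  refine Set.Subset.antisymm (Set.image_subset_iff.2 fun z hz => mobius_mem ha hz) fun z hz => ?_
  refine ⟨mobius (-a) z, mobius_mem (neg_mem_disc ha) hz, ?_⟩
  simpa using mobius_neg_mobius (neg_mem_disc ha) hz

/-- `(U^η(p(a)) f)(z) = (1-|a|²)^η (1 - z ā)^(-2η) f((z - a)/(1 - z ā))`. -/
def dispFun (η : ℝ) (a : ℂ) (f : ℂ → ℂ) (z : ℂ) : ℂ :=
  ((1 - ‖a‖ ^ 2) ^ η : ℝ) * (1 - z * conj a) ^ ((-2 * η : ℝ) : ℂ) * f (mobius a z)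

theorem differentiableOn_dispFun {a : ℂ} (ha : a ∈ disc) {f : ℂ → ℂ}
    (hf : DifferentiableOn ℂ f disc) : DifferentiableOn ℂ (dispFun η a f) disc := by
  have h1 : DifferentiableOn ℂ (fun z => 1 - z * conj a) disc := by fun_prop
  have h2 : DifferentiableOn ℂ (fun z => (1 - z * conj a) ^ ((-2 * η : ℝ) : ℂ)) disc :=
    h1.cpow_const fun z hz => one_sub_mem_slitPlane ha hz
  have h3 : DifferentiableOn ℂ (fun z => f (mobius a z)) disc :=
    hf.comp (fun z hz => (hasDerivAt_mobius ha hz).differentiableAt.differentiableWithinAt)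
      fun z hz => mobius_mem ha hz
  exact (h2.const_mul _).mul h3

theorem lintegral_dispFun {a : ℂ} (ha : a ∈ disc) (f : ℂ → ℂ) :
    ∫⁻ z, ‖dispFun η a f z‖ₑ ^ 2 ∂fbMeasure η = ∫⁻ z, ‖f z‖ₑ ^ 2 ∂fbMeasure η := by
  rw [lintegral_fbMeasure, lintegral_fbMeasure]
  have hinj : Set.InjOn (mobius a) disc := fun z hz w hw h => by
    rw [← mobius_neg_mobius ha hz, h, mobius_neg_mobius ha hw]
  have key := lintegral_image_eq_lintegral_abs_det_fderiv_mul volume measurableSet_disc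
    (fun z hz => ((hasDerivAt_mobius ha hz).hasFDerivAt.restrictScalars ℝ).hasFDerivWithinAt)
    hinj (fun z => ENNReal.ofReal (density η z) * ‖f z‖ₑ ^ 2)
  rw [mobius_image ha] at key
  rw [key]
  refine setLIntegral_congr_fun measurableSet_disc fun z hz => ?_
  have hdet : |((ContinuousLinearMap.toSpanSingleton ℂ
      ((1 - a * conj a) / (1 - z * conj a) ^ 2)).restrictScalars ℝ).det| =
      ((1 - ‖a‖ ^ 2) / ‖1 - z * conj a‖ ^ 2) ^ 2 := by
    have h1 : ‖1 - a * conj a‖ = 1 - ‖a‖ ^ 2 := by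
      rw [Complex.mul_conj', ← Complex.ofReal_pow, ← Complex.ofReal_one, ← Complex.ofReal_sub,
        Complex.norm_real, Real.norm_of_nonneg (one_sub_sq_pos ha).le]
    simp [ContinuousLinearMap.det, LinearMap.det_restrictScalars, Algebra.norm_complex_eq,
      Complex.normSq_eq_norm_sq, h1]
    rw [div_pow, abs_of_nonneg (by positivity)]
  have h0 := norm_pos_iff.2 (one_sub_ne_zero ha hz)
  have h1 := one_sub_sq_pos ha
  have h2 := one_sub_sq_pos hz
  have hreal : density η z * ((1 - ‖a‖ ^ 2) ^ η * ‖1 - z * conj a‖ ^ (-2 * η)) ^ 2 =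
      ((1 - ‖a‖ ^ 2) / ‖1 - z * conj a‖ ^ 2) ^ 2 * density η (mobius a z) := by
    rw [density, density, one_sub_norm_mobius ha hz]
    generalize 1 - ‖a‖ ^ 2 = A at *
    generalize 1 - ‖z‖ ^ 2 = B at *
    generalize ‖1 - z * conj a‖ = C at *
    rw [Real.div_rpow (by positivity) (by positivity), Real.mul_rpow h1.le h2.le, mul_pow,
      ← Real.rpow_natCast (A ^ η), ← Real.rpow_natCast (C ^ (-2 * η)), ← Real.rpow_mul h1.le,
      ← Real.rpow_mul h0.le, ← Real.rpow_natCast C, ← Real.rpow_mul h0.le, div_pow,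
      ← Real.rpow_natCast A, ← Real.rpow_natCast (C ^ _), ← Real.rpow_mul h0.le]
    have e1 : A ^ (η * (2 : ℕ)) = A ^ ((2 : ℕ) : ℝ) * A ^ (2 * η - 2) := by
      rw [← Real.rpow_add h1]; congr 1; push_cast; ring
    have e2 : C ^ (-2 * η * (2 : ℕ)) =
        (C ^ (((2 : ℕ) : ℝ) * (2 : ℕ)))⁻¹ * (C ^ (((2 : ℕ) : ℝ) * (2 * η - 2)))⁻¹ := by
      rw [← mul_inv, ← Real.rpow_add h0, ← Real.rpow_neg h0.le]; congr 1; push_cast; ring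
    rw [e1, e2]
    ring
  have hn : ‖dispFun η a f z‖ₑ = ENNReal.ofReal ((1 - ‖a‖ ^ 2) ^ η *
      ‖1 - z * conj a‖ ^ (-2 * η)) * ‖f (mobius a z)‖ₑ := by
    rw [dispFun, enorm_mul]
    congr 1
    rw [← ofReal_norm, norm_mul, Complex.norm_real, Complex.norm_cpow_real,
      Real.norm_of_nonneg (by positivity)]
  rw [hn, mul_pow, ← mul_assoc, ← mul_assoc, ← ENNReal.ofReal_pow (by positivity),
    ← ENNReal.ofReal_mul' (by positivity), ← ENNReal.ofReal_mul (abs_nonneg _), hreal]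
  congr 3
  exact hdet.symm

theorem memLp_dispFun {a : ℂ} (ha : a ∈ disc) {f : ℂ → ℂ} (hf : DifferentiableOn ℂ f disc)
    (hf' : MemLp f 2 (fbMeasure η)) : MemLp (dispFun η a f) 2 (fbMeasure η) := by
  rw [memLp_iff (differentiableOn_dispFun ha hf).continuousOn, lintegral_dispFun ha]
  exact (memLp_iff hf.continuousOn).1 hf'

/-- The displacement operator `U^η(p(a))` for `a` in the disk, as an isometry of `FB η`. -/
def dispIsometry [Fact (1 / 2 < η)] (a : ℂ) (ha : a ∈ disc) : FB η →ₗᵢ[ℂ] FB η where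
  toFun f := FB.mk (dispFun η a f) (differentiableOn_dispFun ha f.differentiableOn)
    (memLp_dispFun ha f.differentiableOn f.memLp)
  map_add' f g := FB.ext fun z hz => by
    rw [FB.add_apply, FB.mk_apply _ _ hz, FB.mk_apply _ _ hz, FB.mk_apply _ _ hz]
    simp only [dispFun, FB.add_apply]
    ring
  map_smul' c f := FB.ext fun z hz => by
    rw [RingHom.id_apply, FB.smul_apply, FB.mk_apply _ _ hz, FB.mk_apply _ _ hz]
    simp only [dispFun, FB.smul_apply]
    ring
  norm_map' f := by
    rw [← sq_eq_sq₀ (norm_nonneg _) (norm_nonneg _), norm_sq_eq, norm_sq_eq,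
      ← lintegral_dispFun ha f]
    congr 1
    refine lintegral_congr_ae (ac_fbMeasure.ae_le ?_)
    filter_upwards [ae_restrict_mem measurableSet_disc] with z hz
    simp only [LinearMap.coe_mk, AddHom.coe_mk]
    rw [FB.mk_apply _ _ hz]

open Classical in
/-- The operator `U^η(p(a))`. (For `a` outside the disk, where it is never used, it is `0`.) -/
def disp [Fact (1 / 2 < η)] (a : ℂ) : FB η →L[ℂ] FB η :=
  if ha : a ∈ disc then (dispIsometry a ha).toContinuousLinearMap else 0

/-- `M(p(z)) = U^η(p(z)) M U^η(p(-z))`. -/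
def transported [Fact (1 / 2 < η)] (M : FB η →L[ℂ] FB η) (z : ℂ) : FB η →L[ℂ] FB η :=
  disp z ∘L M ∘L disp (-z)

/-! ### The quantizer -/

/-- `M = 2 ∫_𝒟 d²z/(1-|z|²)² w(|z|²) U^η(p(z)) P`, where the integral is understood in the weak
sense, on the matrix elements in the basis `e_n`. -/
def IsQuantizer [Fact (1 / 2 < η)] (w : ℝ → ℂ) (M : FB η →L[ℂ] FB η) : Prop :=
  ∀ m n : ℕ,
    IntegrableOn (fun z : ℂ => w (‖z‖ ^ 2) / (1 - ‖z‖ ^ 2) ^ 2 *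
      ⟪(e m : FB η), disp z (parity (e n))⟫_ℂ) disc ∧
    ⟪(e m : FB η), M (e n)⟫_ℂ = 2 * ∫ z in disc, w (‖z‖ ^ 2) / (1 - ‖z‖ ^ 2) ^ 2 *
      ⟪(e m : FB η), disp z (parity (e n))⟫_ℂ

/-- Trace class operators on an infinite dimensional Hilbert space: `∑ |⟨a_i|T b_i⟩| < ∞` for all
orthonormal sequences `a`, `b`. -/
def IsTraceClass {H : Type*} [NormedAddCommGroup H] [InnerProductSpace ℂ H] (T : H →L[ℂ] H) :
    Prop :=
  ∀ a b : ℕ → H, Orthonormal ℂ a → Orthonormal ℂ b → Summable fun i => ‖⟪a i, T (b i)⟫_ℂ‖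

/-- The diagonal matrix element `M_kk = ⟨e_k|M e_k⟩`. -/
def diagElem [Fact (1 / 2 < η)] (M : FB η →L[ℂ] FB η) (k : ℕ) : ℂ := ⟪(e k : FB η), M (e k)⟫_ℂ

/-- The trace `∑_k ⟨e_k|M e_k⟩`. -/
def trace [Fact (1 / 2 < η)] (M : FB η →L[ℂ] FB η) : ℂ := ∑' k, diagElem M k

/-! ### Classical observables and generators -/

/-- `k_0(z) = (1+|z|²)/(1-|z|²)`. -/
def k0 (z : ℂ) : ℂ := (1 + ‖z‖ ^ 2) / (1 - ‖z‖ ^ 2)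

/-- `k_1(z) = (1/i) (z - z̄)/(1-|z|²)`. -/
def k1 (z : ℂ) : ℂ := 1 / Complex.I * ((z - conj z) / (1 - ‖z‖ ^ 2))

/-- `k_2(z) = (z + z̄)/(1-|z|²)`. -/
def k2 (z : ℂ) : ℂ := (z + conj z) / (1 - ‖z‖ ^ 2)

/-- `k_+ = k_2 - i k_1`. -/
def kPlus (z : ℂ) : ℂ := k2 z - Complex.I * k1 z

/-- `k_- = k_2 + i k_1`. -/
def kMinus (z : ℂ) : ℂ := k2 z + Complex.I * k1 z

theorem differentiableOn_deriv (f : FB η) : DifferentiableOn ℂ (deriv f) disc :=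
  f.differentiableOn.deriv isOpen_disc

/-- The elements `f` of `FB η` with `f'` square integrable. This is the domain of the self-adjoint
operator `K_0`, i.e. `z f' + η f` is square integrable if and only if `f'` is. -/
def domK (η : ℝ) : Submodule ℂ (FB η) where
  carrier := {f | MemLp (deriv f) 2 (fbMeasure η)}
  add_mem' {f g} hf hg := by
    refine memLp_congr (fun z hz => ?_) (hf.add hg)
    exact deriv_add (f.differentiableOn.differentiableAt (isOpen_disc.mem_nhds hz))
      (g.differentiableOn.differentiableAt (isOpen_disc.mem_nhds hz))
  zero_mem' := by
    have h : deriv ((0 : FB η) : ℂ → ℂ) = 0 := funext fun z => deriv_const z (0 : ℂ)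
    simp only [Set.mem_ofPred_eq, h]
    exact MemLp.zero
  smul_mem' c f hf := by
    refine memLp_congr (fun z hz => ?_) (hf.const_smul c)
    exact deriv_const_smul c (f.differentiableOn.differentiableAt (isOpen_disc.mem_nhds hz))

open Polynomial in
theorem memLp_poly_mul (p : ℂ[X]) {f : ℂ → ℂ} (hf : MemLp f 2 (fbMeasure η)) :
    MemLp (fun z => p.eval z * f z) 2 (fbMeasure η) := by
  obtain ⟨C, hC⟩ := (isCompact_closedBall (0 : ℂ) 1).exists_bound_of_continuousOn
    p.continuous.continuousOn
  refine MemLp.of_le_mul (c := C) hf (p.continuous.aestronglyMeasurable.mul hf.1)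
    (ac_fbMeasure.ae_le ?_)
  filter_upwards [ae_restrict_mem measurableSet_disc] with z hz
  rw [norm_mul]
  exact mul_le_mul_of_nonneg_right (hC z (Metric.ball_subset_closedBall hz)) (norm_nonneg _)

open Polynomial in
/-- The first order differential operator `p(z) d/dz + q(z)` on `FB η`, with domain `domK η`. -/
def firstOrder (p q : ℂ[X]) : FB η →ₗ.[ℂ] FB η where
  domain := domK η
  toFun :=
    { toFun := fun f => FB.mk (fun z => p.eval z * deriv f.1 z + q.eval z * f.1 z)
        ((p.differentiable.differentiableOn.mul (differentiableOn_deriv f.1)).add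
          (q.differentiable.differentiableOn.mul f.1.differentiableOn))
        ((memLp_poly_mul p f.2).add (memLp_poly_mul q f.1.memLp))
      map_add' := fun f g => FB.ext fun z hz => by
        have hd : deriv (f + g).1 z = deriv f.1 z + deriv g.1 z :=
          deriv_add (f.1.differentiableOn.differentiableAt (isOpen_disc.mem_nhds hz))
            (g.1.differentiableOn.differentiableAt (isOpen_disc.mem_nhds hz))
        have hv : (f + g).1 z = f.1 z + g.1 z := rfl
        rw [FB.add_apply, FB.mk_apply _ _ hz, FB.mk_apply _ _ hz, FB.mk_apply _ _ hz, hd, hv]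
        ring
      map_smul' := fun c f => FB.ext fun z hz => by
        have hd : deriv (c • f).1 z = c * deriv f.1 z :=
          deriv_const_smul c (f.1.differentiableOn.differentiableAt (isOpen_disc.mem_nhds hz))
        have hv : (c • f).1 z = c * f.1 z := rfl
        rw [RingHom.id_apply, FB.smul_apply, FB.mk_apply _ _ hz, FB.mk_apply _ _ hz, hd, hv]
        ring }

open Polynomial in
/-- `K_0 = z d/dz + η`. -/
def K0 (η : ℝ) : FB η →ₗ.[ℂ] FB η := firstOrder X (C (η : ℂ))

open Polynomial in
/-- `K_1 = -(i/2)(1-z²) d/dz + iηz`. -/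
def K1 (η : ℝ) : FB η →ₗ.[ℂ] FB η :=
  firstOrder (C (-(Complex.I / 2)) * (1 - X ^ 2)) (C (Complex.I * η) * X)

open Polynomial in
/-- `K_2 = (1/2)(1+z²) d/dz + ηz`. -/
def K2 (η : ℝ) : FB η →ₗ.[ℂ] FB η :=
  firstOrder (C (1 / 2) * (1 + X ^ 2)) (C (η : ℂ) * X)

/-- `K_+ = K_2 - i K_1`. -/
def KPlus (η : ℝ) : FB η →ₗ.[ℂ] FB η := K2 η - Complex.I • K1 η

/-- `K_- = K_2 + i K_1`. -/
def KMinus (η : ℝ) : FB η →ₗ.[ℂ] FB η := K2 η + Complex.I • K1 η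

/-! ### The quantization -/

/-- The weak integral `⟨φ| ∫_𝒟 d²z/(1-|z|²)² f(z) N(z) |ψ⟩`: its integrand. -/
def integrand [Fact (1 / 2 < η)] (N : ℂ → FB η →L[ℂ] FB η) (f : ℂ → ℂ) (φ ψ : FB η) (z : ℂ) : ℂ :=
  f z / (1 - ‖z‖ ^ 2) ^ 2 * ⟪φ, N z ψ⟫_ℂ

/-- `A = (2η-1)/π ∫_𝒟 d²z/(1-|z|²)² f(z) N(z)` as a weak integral: on the domain of `A`, the
integral converges absolutely and the sesquilinear forms on both sides agree. For
`N z = M(p(z))` this says that the quantization `f ↦ A_f` sends `f` to `A`. -/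
def IsQuantization [Fact (1 / 2 < η)] (N : ℂ → FB η →L[ℂ] FB η) (f : ℂ → ℂ)
    (A : FB η →ₗ.[ℂ] FB η) : Prop :=
  ∀ φ ψ : A.domain,
    IntegrableOn (integrand N f φ ψ) disc ∧
    ⟪(φ : FB η), A ψ⟫_ℂ = (2 * η - 1) / Real.pi * ∫ z in disc, integrand N f φ ψ z

/-- A summation method by convergence factors `c i k → 1` that are uniformly bounded: partial sums,
Abel means, Cesàro means, and so on. -/
structure IsSummationMethod {ι : Type} (l : Filter ι) (c : ι → ℕ → ℝ) : Prop where
  bounded : ∃ B, ∀ᶠ i in l, ∀ k, |c i k| ≤ B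
  tendsto : ∀ k, Tendsto (fun i => c i k) l (𝓝 1)

/-- The series `∑ a_k` has the sum `s` in the sense of the summation method `c`. -/
def SumsTo {ι : Type} (l : Filter ι) (c : ι → ℕ → ℝ) (a : ℕ → ℂ) (s : ℂ) : Prop :=
  (∀ᶠ i in l, Summable fun k => c i k * a k) ∧ Tendsto (fun i => ∑' k, c i k * a k) l (𝓝 s)

/-- `A = (2η-1)/π ∑_k m_k ∫_𝒟 d²z/(1-|z|²)² f(z) N_k(z)` with weak integrals as before and the
series understood in the sense of the summation method `c`. For `m_k = M_kk` and
`N_k(z) = U(p(z)) |e_k⟩⟨e_k| U(p(-z))` this is the quantization `A_f` when `M` is the diagonal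
operator with entries `M_kk`. -/
def IsSummedQuantization [Fact (1 / 2 < η)] {ι : Type} (l : Filter ι) (c : ι → ℕ → ℝ) (m : ℕ → ℂ)
    (N : ℕ → ℂ → FB η →L[ℂ] FB η) (f : ℂ → ℂ) (A : FB η →ₗ.[ℂ] FB η) : Prop :=
  ∀ φ ψ : A.domain,
    (∀ k, IntegrableOn (integrand (N k) f φ ψ) disc) ∧
    SumsTo l c (fun k => (2 * η - 1) / Real.pi * (m k * ∫ z in disc, integrand (N k) f φ ψ z))
      ⟪(φ : FB η), A ψ⟫_ℂ

/-- The projector `|e_k⟩⟨e_k|`. -/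
def proj [Fact (1 / 2 < η)] (k : ℕ) : FB η →L[ℂ] FB η := InnerProductSpace.rankOne ℂ (e k) (e k)

/-- `γ = (1/(η-1)) (1 + S/η)`. -/
def gammaConst (η : ℝ) (S : ℂ) : ℂ := 1 / (η - 1) * (1 + S / η)

end SU11

end

/-!
The proof expands the displaced operators in the basis `e_n` and evaluates every integral by
integration by parts.

*Reduction to rank one.* Rotations of the disk multiply `⟨e_m|U(p(z)) P e_n⟩` by a character, so the
quantizer `M` is diagonal in the basis `e_n` (`quantizer_e`). It is therefore enough to treat the
projectors `|e_k⟩⟨e_k|`, for which the integrand is `f(z) conj (u_k φ) (u_k ψ) / (1-|z|²)²` with the matrix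
coefficient `u_k ψ (z) = ⟨U(p(z)) e_k|ψ⟩` (`matFn`). The claim `IsCore` is that the quantization of `f` with
weight `|e_k⟩⟨e_k|` is `(k + η) / (η (η - 1))` times the generator belonging to `f`. Multiplying by `M_kk` and
summing over `k`, with `∑ M_kk = 1` and `∑ k M_kk = S`, gives the factor `(S + η) / (η (η - 1)) = γ`.

*Matrix coefficients.* For basis vectors, `u_k e_n` is a phase times a real radial function of `r = |z|`,
which is `(1-r²)^η` times a constant times `matCoeff η k n r`, the coefficient of `X^k` in the power series of `(1+rX)^(-2η) ((X+r)/(1+rX))ⁿ`. Differentiating this series in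
`r` and applying the Euler operator `X d/dX` to it gives two relations between `matCoeff η k n` and its
neighbours in `n` (`hasDerivAt_matCoeff`, `matCoeff_weight`), that is, a lowering and a raising
relation. Integrating exact derivatives by parts turns them into recursions in `n` for the radial
integrals with the weights `1`, `k₀` and `k_±`, which are solved by `matNorm_eq`, `matNormK_eq` and
`matCross_eq`; the boundary terms vanish because `η > 1`. Together with the orthogonality under rotations
this shows that the matrix elements of the quantized `k₀` and `k_±` are those of `K₀` and `K_∓`, up to the
factor depending on `k`.

*The domain.* With respect to the measure `k₀(z) d²z/(1-|z|²)²`, the functions `u_k e_n` are orthogonal with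
square norms proportional to `n + η`. Hence for `ψ` in the domain of `K₀` the expansion of `u_k ψ` converges in
`L²` of this measure (`hasSum_toLp_matFn`). As all observables are dominated by `k₀`, the integrals
converge absolutely, with bounds linear in `k + η`, and the identities pass from the basis to the domain
(`isCore_of_hasSum`).

*Conjugate labelling.* Substituting `conj z` for `z` fixes `k₀` and `k₂`, changes the sign of `k₁` and exchanges
`k₊` and `k₋`.
-/

noncomputable section

namespace SU11

/-! ### Radial integrals with the weight `(1-r²)^(2η-3)` -/

/-- The weighted radial integral `∫₀¹ (1-r²)^(2η-3) p(r) dr`. -/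
def radInt (η : ℝ) (p : ℝ → ℝ) : ℝ := ∫ r in (0 : ℝ)..1, (1 - r ^ 2) ^ (2 * η - 3) * p r

theorem intervalIntegrable_radial {η : ℝ} (hη : 1 < η) {p : ℝ → ℝ} (hp : Continuous p) :
    IntervalIntegrable (fun r : ℝ => (1 - r ^ 2) ^ (2 * η - 3) * p r) volume 0 1 := by
  have h1 : IntervalIntegrable (fun r : ℝ => (1 - r) ^ (2 * η - 3)) volume 0 1 := by
    have h := (intervalIntegral.intervalIntegrable_rpow' (a := 0) (b := 1) (r := 2 * η - 3)
      (by linarith)).comp_sub_left 1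
    simpa using h.symm
  have h2 : ContinuousOn (fun r : ℝ => (1 + r) ^ (2 * η - 3) * p r) (Set.uIcc 0 1) := by
    refine ContinuousOn.mul ?_ hp.continuousOn
    refine (continuousOn_const.add continuousOn_id).rpow_const fun x hx => Or.inl ?_
    rw [Set.uIcc_of_le zero_le_one] at hx
    exact (by linarith [hx.1] : (0 : ℝ) < 1 + x).ne'
  refine (h1.mul_continuousOn h2).congr_uIoo fun r hr => ?_
  rw [Set.uIoo_of_le zero_le_one] at hr
  have h3 : (1 : ℝ) - r ^ 2 = (1 - r) * (1 + r) := by ring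
  simp only
  rw [h3, Real.mul_rpow (by linarith [hr.2]) (by linarith [hr.1])]
  ring

theorem radInt_add {η : ℝ} (hη : 1 < η) {p q : ℝ → ℝ} (hp : Continuous p) (hq : Continuous q) :
    radInt η (fun r => p r + q r) = radInt η p + radInt η q := by
  rw [radInt, radInt, radInt, ← intervalIntegral.integral_add (intervalIntegrable_radial hη hp)
    (intervalIntegrable_radial hη hq)]
  simp only [mul_add]

theorem radInt_const_mul (η c : ℝ) (p : ℝ → ℝ) :
    radInt η (fun r => c * p r) = c * radInt η p := by
  rw [radInt, radInt, ← intervalIntegral.integral_const_mul]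
  congr 1; ext r; ring

/-- Integration by parts: `(1-r²)^(2η-2) q(r)` vanishes at `r = 1`. -/
theorem radInt_deriv {η : ℝ} (hη : 1 < η) {q d p : ℝ → ℝ} (hq : ∀ r, HasDerivAt q (d r) r)
    (hp : Continuous p) (h : ∀ r, (1 - r ^ 2) * d r - (4 * η - 4) * r * q r = p r) :
    radInt η p = -q 0 := by
  have hq' : Continuous q := continuous_iff_continuousAt.2 fun r => (hq r).continuousAt
  have hF : ∀ r ∈ Set.Ioo (0 : ℝ) 1, HasDerivAt (fun r : ℝ => (1 - r ^ 2) ^ (2 * η - 2) * q r)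
      ((1 - r ^ 2) ^ (2 * η - 3) * p r) r := by
    intro r hr
    have h0 : 0 < 1 - r ^ 2 := by nlinarith [hr.1, hr.2]
    have h1 : HasDerivAt (fun r : ℝ => 1 - r ^ 2) (-(2 * r)) r := by
      simpa using (hasDerivAt_pow 2 r).const_sub 1
    have h2 := (h1.rpow_const (p := 2 * η - 2) (Or.inl h0.ne')).mul (hq r)
    refine h2.congr_deriv ?_
    rw [← h r, show 2 * η - 2 = (2 * η - 3) + 1 by ring, Real.rpow_add h0, Real.rpow_one,
      add_sub_cancel_right]
    ring
  have hc : Continuous (fun r : ℝ => (1 - r ^ 2) ^ (2 * η - 2) * q r) :=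
    ((continuous_const.sub (continuous_id.pow 2)).rpow_const
      fun _ => Or.inr (by linarith)).mul hq'
  rw [radInt, intervalIntegral.integral_eq_sub_of_hasDerivAt_of_le zero_le_one hc.continuousOn hF
    (intervalIntegrable_radial hη hp)]
  have : (0 : ℝ) ^ (2 * η - 2) = 0 := Real.zero_rpow (by linarith)
  simp [this]

/-- The square `(2η)_n / n!` of the normalization of `e n`. -/
def nuSq (η : ℝ) (n : ℕ) : ℝ := Real.Gamma (2 * η + n) / Real.Gamma (2 * η) / n.factorial

theorem nuSq_pos {η : ℝ} (hη : 0 < η) (n : ℕ) : 0 < nuSq η n := by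
  have h1 : 0 < Real.Gamma (2 * η + n) := Real.Gamma_pos_of_pos (by positivity)
  have h2 : 0 < Real.Gamma (2 * η) := Real.Gamma_pos_of_pos (by positivity)
  unfold nuSq; positivity

theorem nuSq_zero {η : ℝ} (hη : 0 < η) : nuSq η 0 = 1 := by
  have h2 : 0 < Real.Gamma (2 * η) := Real.Gamma_pos_of_pos (by positivity)
  simp [nuSq, h2.ne']

theorem nuSq_succ {η : ℝ} (hη : 0 < η) (n : ℕ) :
    (n + 1) * nuSq η (n + 1) = (2 * η + n) * nuSq η n := by
  have h2 : 0 < Real.Gamma (2 * η) := Real.Gamma_pos_of_pos (by positivity)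
  have h3 : (0 : ℝ) < n.factorial := by positivity
  rw [nuSq, nuSq, Nat.factorial_succ]
  push_cast
  rw [← add_assoc, Real.Gamma_add_one (by positivity)]
  field_simp

/-- The norm of `z ^ k` in polar coordinates, by the recursion that integration by parts gives. -/
theorem radInt_moment {η : ℝ} (hη : 1 < η) (k : ℕ) :
    radInt η (fun r => (1 - r ^ 2) * r ^ (2 * k + 1)) = 1 / (2 * (2 * η - 1) * nuSq η k) := by
  have h0 : 0 < η := by linarith
  induction k with
  | zero =>
    have h := radInt_deriv hη (q := fun r => 1 - r ^ 2) (d := fun r => -(2 * r))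
      (p := fun r => (-(4 * η - 2)) * ((1 - r ^ 2) * r ^ (2 * 0 + 1)))
      (fun r => by simpa using (hasDerivAt_pow 2 r).const_sub 1) (by fun_prop)
      (fun r => by ring)
    rw [radInt_const_mul] at h
    rw [nuSq_zero h0, eq_div_iff (by linarith)]
    norm_num at h ⊢
    linarith
  | succ k ih =>
    have h := radInt_deriv hη (q := fun r => r ^ (2 * k + 2) - r ^ (2 * k + 4))
      (d := fun r => (2 * k + 2) * r ^ (2 * k + 1) - (2 * k + 4) * r ^ (2 * k + 3))
      (p := fun r => (2 * k + 2) * ((1 - r ^ 2) * r ^ (2 * k + 1)) +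
        (-(2 * k + 4 * η)) * ((1 - r ^ 2) * r ^ (2 * (k + 1) + 1)))
      (fun r => ((hasDerivAt_pow (2 * k + 2) r).sub (hasDerivAt_pow (2 * k + 4) r)).congr_deriv
        (by simp))
      (by fun_prop) (fun r => by ring)
    rw [radInt_add hη (by fun_prop) (by fun_prop), radInt_const_mul, radInt_const_mul, ih] at h
    have h1 := nuSq_succ h0 k
    have h2 := nuSq_pos h0 k
    have h3 := nuSq_pos h0 (k + 1)
    have h4 : (0 : ℝ) < 2 * η - 1 := by linarith
    simp only [ne_eq, Nat.add_eq_zero_iff, OfNat.ofNat_ne_zero, and_false, not_false_eq_true,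
      zero_pow, sub_zero, neg_zero] at h
    rw [eq_div_iff (by positivity)]
    have h5 : (2 * (k : ℝ) + 4 * η) * radInt η (fun r => (1 - r ^ 2) * r ^ (2 * (k + 1) + 1)) =
        (2 * k + 2) * (1 / (2 * (2 * η - 1) * nuSq η k)) := by linarith
    rw [mul_one_div, eq_div_iff (by positivity)] at h5
    have h6 : (2 * η + k) ≠ 0 := by positivity
    have h7 : ((k : ℝ) + 1) ≠ 0 := by positivity
    refine mul_left_cancel₀ h7 ?_
    calc _ = radInt η (fun r => (1 - r ^ 2) * r ^ (2 * (k + 1) + 1)) * (2 * (2 * η - 1)) *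
          ((k + 1) * nuSq η (k + 1)) := by ring
      _ = (k + 1) * 1 := by rw [h1]; linarith

/-! ### Rotations and polar coordinates -/

theorem integral_disc_radial (F : ℝ → ℝ) :
    ∫ z in disc, F ‖z‖ = 2 * Real.pi * ∫ r in (0 : ℝ)..1, r * F r := by
  have h := integral_fun_norm_addHaar (volume : Measure ℂ) ((Set.Iio (1 : ℝ)).indicator F)
  have h1 : ∀ z : ℂ, (Set.Iio (1 : ℝ)).indicator F ‖z‖ = disc.indicator (fun z => F ‖z‖) z := by
    intro z
    by_cases hz : ‖z‖ < 1
    · rw [Set.indicator_of_mem (show ‖z‖ ∈ Set.Iio (1 : ℝ) from hz),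
        Set.indicator_of_mem (mem_disc.2 hz)]
    · rw [Set.indicator_of_notMem (show ‖z‖ ∉ Set.Iio (1 : ℝ) from hz),
        Set.indicator_of_notMem (fun h => hz (mem_disc.1 h))]
  simp only [h1] at h
  rw [integral_indicator measurableSet_disc] at h
  have h2 : volume.real (Metric.ball (0 : ℂ) 1) = Real.pi := by
    simp [Measure.real, Complex.volume_ball]
  have h3 : ∫ y in Set.Ioi (0 : ℝ), y ^ (2 - 1) • (Set.Iio (1 : ℝ)).indicator F y =
      ∫ r in (0 : ℝ)..1, r * F r := by
    rw [intervalIntegral.integral_of_le zero_le_one, integral_Ioc_eq_integral_Ioo,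
      ← Set.Ioi_inter_Iio, Set.inter_comm, ← Measure.restrict_restrict measurableSet_Iio,
      ← integral_indicator measurableSet_Iio]
    refine integral_congr_ae (ae_of_all _ fun r => ?_)
    by_cases hr : r < 1 <;> simp [hr]
  rw [h, Complex.finrank_real_complex, h2, h3]
  simp only [nsmul_eq_mul, smul_eq_mul]
  push_cast
  ring

theorem integrableOn_disc_radial {F : ℝ → ℝ}
    (hF : IntervalIntegrable (fun r => r * F r) volume 0 1) :
    IntegrableOn (fun z : ℂ => F ‖z‖) disc := by
  rw [disc, integrableOn_fun_norm_addHaar, Complex.finrank_real_complex]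
  rw [intervalIntegrable_iff_integrableOn_Ioo_of_le zero_le_one] at hF
  simpa using hF

theorem integral_ball_rotate {E : Type*} [NormedAddCommGroup E] [NormedSpace ℝ E] (R : ℝ)
    (F : ℂ → E) {u : ℂ} (hu : ‖u‖ = 1) :
    ∫ z in Metric.ball 0 R, F (u * z) = ∫ z in Metric.ball 0 R, F z := by
  let L : ℂ ≃ₗᵢ[ℝ] ℂ := rotation ⟨u, mem_sphere_zero_iff_norm.2 hu⟩
  have h := L.measurePreserving.setIntegral_preimage_emb
    L.toHomeomorph.measurableEmbedding F (Metric.ball 0 R)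
  have h1 : L ⁻¹' Metric.ball 0 R = Metric.ball 0 R := by
    simp
  rw [h1] at h
  exact h

/-- An integral over a ball vanishes if rotations multiply the integrand by a nontrivial
character. -/
theorem integral_ball_eq_zero_of_rotate {R : ℝ} {F : ℂ → ℂ} {p : ℤ} (hp : p ≠ 0)
    (hF : ∀ u : ℂ, ‖u‖ = 1 → ∀ z ∈ Metric.ball (0 : ℂ) R, F (u * z) = u ^ p * F z) :
    ∫ z in Metric.ball 0 R, F z = 0 := by
  -- a rotation `u` with `u ^ p = -1`
  set u : ℂ := Complex.exp ((Real.pi / p : ℝ) * Complex.I) with hu_def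
  have hu : ‖u‖ = 1 := Complex.norm_exp_ofReal_mul_I _
  have hup : u ^ p = -1 := by
    rw [hu_def, ← Complex.exp_int_mul, ← Complex.exp_pi_mul_I]
    congr 1
    have : (p : ℂ) ≠ 0 := by exact_mod_cast hp
    push_cast
    field_simp
  have h1 := integral_ball_rotate R F hu
  rw [setIntegral_congr_fun measurableSet_ball (hF u hu), integral_const_mul, hup] at h1
  linear_combination (-1 / 2 : ℂ) * h1

variable {η : ℝ}

/-! ### Taylor series on the disk -/

open PowerSeries in
/-- The power series `P` converges to `f` on the open unit disk. -/
def IsTaylor (f : ℂ → ℂ) (P : PowerSeries ℂ) : Prop :=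
  ∀ z ∈ disc, HasSum (fun n => coeff n P * z ^ n) (f z)

namespace IsTaylor

open PowerSeries

variable {f g : ℂ → ℂ} {P Q : PowerSeries ℂ}

theorem congr (hf : IsTaylor f P) (h : ∀ z ∈ disc, f z = g z) : IsTaylor g P :=
  fun z hz => h z hz ▸ hf z hz

theorem unique (hP : IsTaylor f P) (hQ : IsTaylor f Q) : P = Q := by
  have key : ∀ P : PowerSeries ℂ, IsTaylor f P →
      HasFPowerSeriesAt f (FormalMultilinearSeries.ofScalars ℂ fun n => coeff n P) 0 := by
    intro P hP
    rw [hasFPowerSeriesAt_iff]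
    filter_upwards [isOpen_disc.mem_nhds (mem_disc.2 (by simp : ‖(0 : ℂ)‖ < 1))] with z hz
    simpa [FormalMultilinearSeries.coeff_ofScalars, mul_comm] using hP z hz
  have h := (key P hP).eq_formalMultilinearSeries (key Q hQ)
  ext n
  have h1 := congrArg (fun p => FormalMultilinearSeries.coeff p n) h
  simpa [FormalMultilinearSeries.coeff_ofScalars] using h1

theorem of_differentiableOn (hf : DifferentiableOn ℂ f disc) :
    IsTaylor f (PowerSeries.mk fun n => (n.factorial : ℂ)⁻¹ * iteratedDeriv n f 0) := by
  intro z hz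
  have h := Complex.hasSum_taylorSeries_on_ball (r := 1) (f := f) (c := 0)
    (by simpa [disc] using hf) (z := z) (by simpa [disc] using hz)
  simpa [mul_comm, mul_assoc, mul_left_comm] using h

theorem exists_of_differentiableOn (hf : DifferentiableOn ℂ f disc) : ∃ P, IsTaylor f P :=
  ⟨_, of_differentiableOn hf⟩

theorem add (hf : IsTaylor f P) (hg : IsTaylor g Q) :
    IsTaylor (fun z => f z + g z) (P + Q) := fun z hz => by
  simpa [add_mul] using (hf z hz).add (hg z hz)

theorem C_mul (c : ℂ) (hf : IsTaylor f P) : IsTaylor (fun z => c * f z) (C c * P) := fun z hz => by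
  simpa [mul_assoc] using (hf z hz).mul_left c

theorem X_mul (hf : IsTaylor f P) : IsTaylor (fun z => z * f z) (X * P) := fun z hz => by
  rw [← hasSum_nat_add_iff' 1]
  simpa [coeff_succ_X_mul, pow_succ, mul_comm, mul_assoc, mul_left_comm] using (hf z hz).mul_left z

theorem deriv (hf : DifferentiableOn ℂ f disc) (hP : IsTaylor f P) :
    IsTaylor (deriv f) (d⁄dX ℂ P) := by
  have h1 := of_differentiableOn (hf.deriv isOpen_disc)
  rw [hP.unique (of_differentiableOn hf)]
  convert h1 using 1
  ext n
  rw [coeff_derivative, coeff_mk, coeff_mk, iteratedDeriv_succ', Nat.factorial_succ]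
  have : ((n : ℂ) + 1) ≠ 0 := by exact_mod_cast n.succ_ne_zero
  push_cast
  field_simp

theorem summable_norm (hf : IsTaylor f P) {r : ℝ} (hr0 : 0 ≤ r) (hr : r < 1) :
    Summable fun n => ‖coeff n P‖ * r ^ n := by
  have h := (hf r (mem_disc.2 (by rwa [Complex.norm_real, Real.norm_of_nonneg hr0]))).summable.norm
  simpa [Complex.norm_real, abs_of_nonneg hr0] using h

end IsTaylor

/-! ### The orthonormal basis -/

theorem e_apply [Fact (1 / 2 < η)] (n : ℕ) {z : ℂ} (hz : z ∈ disc) :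
    (e n : FB η) z = (√(nuSq η n) : ℝ) * z ^ n := FB.mk_apply _ _ hz

theorem setIntegral_fbMeasure (hη : 1 / 2 < η) {R : ℝ} (hR : R ≤ 1) (g : ℂ → ℂ) :
    ∫ z in Metric.ball 0 R, g z ∂fbMeasure η =
      ∫ z in Metric.ball 0 R, (density η z : ℂ) * g z := by
  rw [fbMeasure, restrict_withDensity measurableSet_ball, Measure.restrict_restrict
    measurableSet_ball, disc, Set.inter_eq_left.2 (Metric.ball_subset_ball hR),
    integral_withDensity_eq_integral_toReal_smul measurable_density.ennreal_ofReal
      (ae_of_all _ fun _ => ENNReal.ofReal_lt_top)]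
  refine setIntegral_congr_fun measurableSet_ball fun z hz => ?_
  rw [ENNReal.toReal_ofReal (density_pos hη (Metric.ball_subset_ball hR hz)).le, Complex.real_smul]

theorem restrict_disc_fbMeasure : (fbMeasure η).restrict disc = fbMeasure η := by
  rw [fbMeasure, restrict_withDensity measurableSet_disc, Measure.restrict_restrict
    measurableSet_disc, Set.inter_self]

theorem integral_fbMeasure (hη : 1 / 2 < η) (g : ℂ → ℂ) :
    ∫ z, g z ∂fbMeasure η = ∫ z in disc, (density η z : ℂ) * g z := by
  have h := setIntegral_fbMeasure hη le_rfl g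
  rwa [← disc, restrict_disc_fbMeasure] at h

theorem setIntegral_monomial_orthogonal (hη : 1 / 2 < η) {R : ℝ} (hR : R ≤ 1) {m n : ℕ}
    (h : m ≠ n) :
    ∫ z in Metric.ball 0 R, conj (z ^ m) * z ^ n ∂fbMeasure η = 0 := by
  rw [setIntegral_fbMeasure hη hR]
  refine integral_ball_eq_zero_of_rotate (p := n - m) (by omega) fun u hu z _ => ?_
  have hu0 : u ≠ 0 := fun h => by simp [h] at hu
  have hc : conj u = u⁻¹ := (Complex.inv_eq_conj hu).symm
  have hd : density η (u * z) = density η z := by simp [density, hu]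
  rw [hd, zpow_sub₀ hu0, mul_pow, mul_pow, map_mul, map_pow conj u, hc]
  simp only [zpow_natCast, inv_pow]
  ring

theorem integral_monomial_self (hη : 1 < η) (n : ℕ) :
    ∫ z, conj (z ^ n) * z ^ n ∂fbMeasure η = ((1 / nuSq η n : ℝ) : ℂ) := by
  rw [integral_fbMeasure (by linarith)]
  have h1 : ∀ z : ℂ, (density η z : ℂ) * (conj (z ^ n) * z ^ n) =
      ((fun r : ℝ => (2 * η - 1) / Real.pi * (1 - r ^ 2) ^ (2 * η - 2) * r ^ (2 * n)) ‖z‖ : ℝ) := by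
    intro z
    rw [Complex.conj_mul', norm_pow]
    simp only [density]
    push_cast
    ring
  simp only [h1]
  rw [integral_complex_ofReal, integral_disc_radial (fun r : ℝ =>
    (2 * η - 1) / Real.pi * (1 - r ^ 2) ^ (2 * η - 2) * r ^ (2 * n))]
  congr 1
  have h2 : ∫ r in (0 : ℝ)..1, r * ((2 * η - 1) / Real.pi * (1 - r ^ 2) ^ (2 * η - 2) *
      r ^ (2 * n)) = (2 * η - 1) / Real.pi * radInt η (fun r => (1 - r ^ 2) * r ^ (2 * n + 1)) := by
    rw [radInt, ← intervalIntegral.integral_const_mul]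
    refine intervalIntegral.integral_congr_uIoo fun r hr => ?_
    rw [Set.uIoo_of_le zero_le_one] at hr
    have h0 : 0 < 1 - r ^ 2 := by nlinarith [hr.1, hr.2]
    rw [show 2 * η - 2 = (2 * η - 3) + 1 by ring, Real.rpow_add h0, Real.rpow_one]
    ring
  rw [h2, radInt_moment hη]
  have := nuSq_pos (by linarith : 0 < η) n
  have := Real.pi_pos
  have : 2 * η - 1 ≠ 0 := by linarith
  field_simp

/-- The radii `1 - 1/(n+1)` exhaust the disk. -/
theorem tendsto_setIntegral_ball {E : Type*} [NormedAddCommGroup E] [NormedSpace ℝ E]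
    {g : ℂ → E} (hg : Integrable g (fbMeasure η)) :
    Tendsto (fun n : ℕ => ∫ z in Metric.ball 0 (1 - 1 / ((n : ℝ) + 1)), g z ∂fbMeasure η) atTop
      (𝓝 (∫ z, g z ∂fbMeasure η)) := by
  have hU : ⋃ n : ℕ, Metric.ball (0 : ℂ) (1 - 1 / ((n : ℝ) + 1)) = disc := by
    ext z
    simp only [Set.mem_iUnion, mem_ball_zero_iff, mem_disc]
    constructor
    · rintro ⟨n, hn⟩
      have : (0 : ℝ) < 1 / ((n : ℝ) + 1) := by positivity
      linarith
    · intro hz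
      obtain ⟨n, hn⟩ := exists_nat_one_div_lt (sub_pos.2 hz)
      exact ⟨n, by linarith⟩
  have h := tendsto_setIntegral_of_monotone (μ := fbMeasure η) (f := g)
    (s := fun n : ℕ => Metric.ball (0 : ℂ) (1 - 1 / ((n : ℝ) + 1)))
    (fun _ => measurableSet_ball) (fun m n hmn => Metric.ball_subset_ball (by gcongr))
    hg.integrableOn
  rwa [hU, restrict_disc_fbMeasure] at h

theorem one_sub_one_div_lt (n : ℕ) : 1 - 1 / ((n : ℝ) + 1) < 1 := by
  have : (0 : ℝ) < 1 / ((n : ℝ) + 1) := by positivity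
  linarith

section

variable [Fact (1 / 2 < η)]

theorem inner_e_eq (f : FB η) (k : ℕ) :
    ⟪(e k : FB η), f⟫_ℂ = (√(nuSq η k) : ℝ) * ∫ z, conj (z ^ k) * f z ∂fbMeasure η := by
  rw [inner_def, ← integral_const_mul]
  refine integral_congr_ae (ac_fbMeasure.ae_le ?_)
  filter_upwards [ae_restrict_mem measurableSet_disc] with z hz
  rw [e_apply k hz, map_mul, Complex.conj_ofReal]
  ring

theorem orthonormal_e (hη : 1 < η) : Orthonormal ℂ (fun n => (e n : FB η)) := by
  rw [orthonormal_iff_ite]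
  intro m n
  have h : ∫ z, conj (z ^ m) * (e n : FB η) z ∂fbMeasure η =
      (√(nuSq η n) : ℝ) * ∫ z, conj (z ^ m) * z ^ n ∂fbMeasure η := by
    rw [← integral_const_mul]
    refine integral_congr_ae (ac_fbMeasure.ae_le ?_)
    filter_upwards [ae_restrict_mem measurableSet_disc] with z hz
    rw [e_apply n hz]
    ring
  rw [inner_e_eq, h]
  split_ifs with hmn
  · subst hmn
    rw [integral_monomial_self hη, ← mul_assoc, ← Complex.ofReal_mul, ← Complex.ofReal_mul,
      Real.mul_self_sqrt (nuSq_pos (by linarith) m).le,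
      mul_one_div_cancel (nuSq_pos (by linarith) m).ne', Complex.ofReal_one]
  · have h0 := setIntegral_monomial_orthogonal (η := η) Fact.out le_rfl hmn
    rw [← disc, restrict_disc_fbMeasure] at h0
    rw [h0, mul_zero, mul_zero]

open PowerSeries in
theorem hasSum_setIntegral_taylor {f h : ℂ → ℂ} {P : PowerSeries ℂ} (hf : IsTaylor f P)
    (hh : ContinuousOn h disc) {R : ℝ} (hR : R < 1) :
    HasSum (fun n => coeff n P * ∫ z in Metric.ball 0 R, conj (h z) * z ^ n ∂fbMeasure η)
      (∫ z in Metric.ball 0 R, conj (h z) * f z ∂fbMeasure η) := by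
  have := isFiniteMeasure_fbMeasure (η := η) Fact.out
  rcases le_or_gt R 0 with hR0 | hR0
  · simp [Metric.ball_eq_empty.2 hR0, hasSum_zero]
  have hsub : Metric.closedBall (0 : ℂ) R ⊆ disc := Metric.closedBall_subset_ball hR
  obtain ⟨C, hC⟩ := (isCompact_closedBall (0 : ℂ) R).exists_bound_of_continuousOn (hh.mono hsub)
  have hC0 : 0 ≤ C := (norm_nonneg _).trans (hC 0 (Metric.mem_closedBall_self hR0.le))
  have hbound : ∀ n, ∀ z ∈ Metric.ball (0 : ℂ) R,
      ‖coeff n P * (conj (h z) * z ^ n)‖ ≤ ‖coeff n P‖ * R ^ n * C := by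
    intro n z hz
    have hz' : ‖z‖ < R := by simpa using hz
    rw [norm_mul, norm_mul, norm_pow, RCLike.norm_conj, mul_assoc, mul_comm (R ^ n)]
    gcongr
    exact hC z (Metric.ball_subset_closedBall hz)
  have hmeas : ∀ n, AEStronglyMeasurable (fun z => coeff n P * (conj (h z) * z ^ n))
      ((fbMeasure η).restrict (Metric.ball 0 R)) := by
    intro n
    refine ContinuousOn.aestronglyMeasurable ?_ measurableSet_ball
    have h1 : ContinuousOn h (Metric.ball 0 R) := hh.mono (Metric.ball_subset_ball hR.le)
    exact continuousOn_const.mul ((RCLike.continuous_conj.comp_continuousOn h1).mul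
      (continuous_pow n).continuousOn)
  have hae : ∀ n, ∀ᵐ z ∂(fbMeasure η).restrict (Metric.ball 0 R),
      ‖coeff n P * (conj (h z) * z ^ n)‖ ≤ ‖coeff n P‖ * R ^ n * C := fun n => by
    filter_upwards [ae_restrict_mem measurableSet_ball] with z hz using hbound n z hz
  have hint : ∀ n, Integrable (fun z => coeff n P * (conj (h z) * z ^ n))
      ((fbMeasure η).restrict (Metric.ball 0 R)) := fun n =>
    Integrable.of_bound (hmeas n) _ (hae n)
  have hsum : Summable fun n => ∫ z in Metric.ball 0 R,
      ‖coeff n P * (conj (h z) * z ^ n)‖ ∂fbMeasure η := by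
    refine Summable.of_nonneg_of_le (fun n => integral_nonneg fun _ => norm_nonneg _) (fun n => ?_)
      (((hf.summable_norm hR0.le hR).mul_right C).mul_left
        ((fbMeasure η).real (Metric.ball 0 R)))
    refine (integral_mono_ae (hint n).norm (integrable_const _) (hae n)).trans_eq ?_
    simp [Measure.real]
  have key := hasSum_integral_of_summable_integral_norm hint hsum
  simp only [integral_const_mul] at key
  have hfun : ∫ z in Metric.ball 0 R, conj (h z) * f z ∂fbMeasure η =
      ∫ z in Metric.ball 0 R, ∑' n, coeff n P * (conj (h z) * z ^ n) ∂fbMeasure η := by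
    refine integral_congr_ae ?_
    filter_upwards [ae_restrict_mem measurableSet_ball] with z hz
    have h1 := (hf z (Metric.ball_subset_ball hR.le hz)).mul_left (conj (h z))
    refine h1.tsum_eq.symm.trans (tsum_congr fun n => ?_)
    ring
  rw [hfun]
  exact key

open PowerSeries in
theorem setIntegral_monomial_mul {f : ℂ → ℂ} {P : PowerSeries ℂ} (hf : IsTaylor f P) (k : ℕ)
    {R : ℝ} (hR : R < 1) :
    ∫ z in Metric.ball 0 R, conj (z ^ k) * f z ∂fbMeasure η =
      coeff k P * ∫ z in Metric.ball 0 R, conj (z ^ k) * z ^ k ∂fbMeasure η := by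
  refine (hasSum_setIntegral_taylor hf (continuous_pow k).continuousOn hR).unique ?_
  refine hasSum_single k fun n hn => ?_
  rw [setIntegral_monomial_orthogonal Fact.out hR.le hn.symm, mul_zero]

theorem integrable_monomial (k : ℕ) :
    Integrable (fun z : ℂ => conj (z ^ k) * z ^ k) (fbMeasure η) := by
  have h : MemLp (fun z : ℂ => z ^ k) 2 (fbMeasure η) :=
    memLp_of_bound Fact.out (by fun_prop) 1 fun z hz => by
      rw [norm_pow]; exact pow_le_one₀ (norm_nonneg _) (mem_disc.1 hz).le
  exact MemLp.integrable_mul (p := 2) (q := 2) h.star h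

open PowerSeries in
/-- The coefficients in the basis `e k` are the normalized Taylor coefficients. -/
theorem inner_e (hη : 1 < η) {f : FB η} {P : PowerSeries ℂ} (hf : IsTaylor f P) (k : ℕ) :
    ⟪(e k : FB η), f⟫_ℂ = coeff k P / (√(nuSq η k) : ℝ) := by
  have h0 := nuSq_pos (by linarith : 0 < η) k
  have h : MemLp (fun z : ℂ => z ^ k) 2 (fbMeasure η) :=
    memLp_of_bound Fact.out (by fun_prop) 1 fun z hz => by
      rw [norm_pow]; exact pow_le_one₀ (norm_nonneg _) (mem_disc.1 hz).le
  have h1 := tendsto_setIntegral_ball (η := η)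
    (MemLp.integrable_mul (p := 2) (q := 2) h.star f.memLp)
  have h2 := (tendsto_setIntegral_ball (integrable_monomial (η := η) k)).const_mul (coeff k P)
  have h3 : ∫ z, conj (z ^ k) * f z ∂fbMeasure η = coeff k P * ((1 / nuSq η k : ℝ) : ℂ) := by
    rw [← integral_monomial_self hη k]
    refine tendsto_nhds_unique h1 (h2.congr fun n => ?_)
    exact (setIntegral_monomial_mul hf k (one_sub_one_div_lt n)).symm
  rw [inner_e_eq, h3]
  have h4 : ((√(nuSq η k) : ℝ) : ℂ) ≠ 0 := by
    exact_mod_cast (Real.sqrt_pos.2 h0).ne'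
  rw [eq_div_iff h4]
  have h5 : ((√(nuSq η k) : ℝ) : ℂ) * ((√(nuSq η k) : ℝ) : ℂ) = (nuSq η k : ℂ) := by
    rw [← Complex.ofReal_mul, Real.mul_self_sqrt h0.le]
  calc _ = coeff k P * (((√(nuSq η k) : ℝ) : ℂ) * ((√(nuSq η k) : ℝ) : ℂ)) *
        ((1 / nuSq η k : ℝ) : ℂ) := by ring
    _ = coeff k P := by
      rw [h5, mul_assoc, ← Complex.ofReal_mul, mul_one_div_cancel h0.ne']; simp

open PowerSeries in
/-- Completeness of the basis. On a smaller ball the Taylor series can be integrated term by term, and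
each term is at most the square of a coefficient in the basis. -/
theorem norm_sq_le_tsum (hη : 1 < η) (f : FB η) :
    ‖f‖ ^ 2 ≤ ∑' k, ‖⟪(e k : FB η), f⟫_ℂ‖ ^ 2 := by
  obtain ⟨P, hP⟩ := IsTaylor.exists_of_differentiableOn f.differentiableOn
  have hre : ‖f‖ ^ 2 = (∫ z, conj (f z) * f z ∂fbMeasure η).re := by
    rw [← inner_def, ← inner_self_eq_norm_sq (𝕜 := ℂ)]
    rfl
  rw [hre]
  refine le_of_tendsto ((Complex.continuous_re.tendsto _).comp
    (tendsto_setIntegral_ball (FB.integrable f f))) (Eventually.of_forall fun N => ?_)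
  have hR := one_sub_one_div_lt N
  set R : ℝ := 1 - 1 / ((N : ℝ) + 1)
  have h1 := hasSum_setIntegral_taylor (η := η) hP f.differentiableOn.continuousOn hR
  have h2 : HasSum _ (∫ z in Metric.ball 0 R, conj (f z) * f z ∂fbMeasure η).re :=
    Complex.hasSum_re h1
  refine hasSum_le (fun k => ?_) h2 ((orthonormal_e hη).inner_products_summable f).hasSum
  -- the `k`-th term is `|P_k|²` times the moment of `|z|^(2k)` over the ball
  have h0 := nuSq_pos (by linarith : 0 < η) k
  have hm : ∫ z in Metric.ball 0 R, conj (z ^ k) * z ^ k ∂fbMeasure η =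
      ((∫ z in Metric.ball 0 R, ‖z‖ ^ (2 * k) ∂fbMeasure η : ℝ) : ℂ) := by
    rw [← integral_complex_ofReal]
    refine integral_congr_ae (ae_of_all _ fun z => ?_)
    simp only
    rw [Complex.conj_mul', norm_pow]
    push_cast
    ring
  have hnorm : ∀ z : ℂ, conj (z ^ k) * z ^ k = ((‖z‖ ^ (2 * k) : ℝ) : ℂ) := fun z => by
    rw [Complex.conj_mul', norm_pow]
    push_cast
    ring
  have hle : ∫ z in Metric.ball 0 R, ‖z‖ ^ (2 * k) ∂fbMeasure η ≤ 1 / nuSq η k := by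
    have h3 : ∫ z, ‖z‖ ^ (2 * k) ∂fbMeasure η = 1 / nuSq η k := by
      have h4 := integral_monomial_self hη k
      simp only [hnorm] at h4
      rw [integral_complex_ofReal] at h4
      exact_mod_cast h4
    rw [← h3]
    refine setIntegral_le_integral ?_ (ae_of_all _ fun z => by positivity)
    have h5 := (integrable_monomial (η := η) k).norm
    refine h5.congr (ae_of_all _ fun z => ?_)
    simp only
    rw [hnorm, Complex.norm_real, Real.norm_of_nonneg (by positivity)]
  have hc : ∫ z in Metric.ball 0 R, conj (f z) * z ^ k ∂fbMeasure η =
      conj (∫ z in Metric.ball 0 R, conj (z ^ k) * f z ∂fbMeasure η) := by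
    rw [← integral_conj]
    simp [mul_comm]
  rw [hc, setIntegral_monomial_mul hP k hR, hm, map_mul, Complex.conj_ofReal, ← mul_assoc,
    Complex.mul_conj', inner_e hη hP, norm_div, Complex.norm_real, div_pow, Real.norm_eq_abs,
    sq_abs, Real.sq_sqrt h0.le, ← Complex.ofReal_pow, ← Complex.ofReal_mul, Complex.ofReal_re,
    div_eq_mul_one_div]
  gcongr

theorem hasSum_e (hη : 1 < η) (f : FB η) :
    HasSum (fun k => ⟪(e k : FB η), f⟫_ℂ • (e k : FB η)) f := by
  have ho := orthonormal_e (η := η) hη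
  rw [HasSum, tendsto_iff_norm_sub_tendsto_zero]
  have hsum := ho.inner_products_summable f
  have h1 : Tendsto (fun s : Finset ℕ => ‖f‖ ^ 2 - ∑ k ∈ s, ‖⟪(e k : FB η), f⟫_ℂ‖ ^ 2) atTop
      (𝓝 0) := by
    have heq : ‖f‖ ^ 2 = ∑' k, ‖⟪(e k : FB η), f⟫_ℂ‖ ^ 2 :=
      le_antisymm (norm_sq_le_tsum hη f) (ho.tsum_inner_products_le f)
    have h2 := (tendsto_const_nhds (x := ‖f‖ ^ 2)).sub hsum.hasSum
    rwa [← heq, sub_self] at h2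
  have h3 : ∀ s : Finset ℕ, ‖∑ k ∈ s, ⟪(e k : FB η), f⟫_ℂ • (e k : FB η) - f‖ ^ 2 =
      ‖f‖ ^ 2 - ∑ k ∈ s, ‖⟪(e k : FB η), f⟫_ℂ‖ ^ 2 := by
    intro s
    have h4 : ‖∑ k ∈ s, ⟪(e k : FB η), f⟫_ℂ • (e k : FB η)‖ ^ 2 =
        ∑ k ∈ s, ‖⟪(e k : FB η), f⟫_ℂ‖ ^ 2 := by
      rw [← inner_self_eq_norm_sq (𝕜 := ℂ), ho.inner_sum]
      simp only [Complex.conj_mul', RCLike.re_to_complex, Complex.re_sum, ← Complex.ofReal_pow,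
        Complex.ofReal_re]
    have h5 : RCLike.re ⟪∑ k ∈ s, ⟪(e k : FB η), f⟫_ℂ • (e k : FB η), f⟫_ℂ =
        ∑ k ∈ s, ‖⟪(e k : FB η), f⟫_ℂ‖ ^ 2 := by
      simp only [sum_inner, inner_smul_left, Complex.conj_mul', RCLike.re_to_complex,
        Complex.re_sum, ← Complex.ofReal_pow, Complex.ofReal_re]
    rw [norm_sub_sq (𝕜 := ℂ), h4, h5]
    ring
  have h6 : Tendsto (fun s : Finset ℕ => √(‖f‖ ^ 2 - ∑ k ∈ s, ‖⟪(e k : FB η), f⟫_ℂ‖ ^ 2)) atTop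
      (𝓝 0) := by simpa using h1.sqrt
  refine h6.congr fun s => ?_
  rw [← h3, Real.sqrt_sq (norm_nonneg _)]

end

/-! ### The generating series of the matrix coefficients -/

section

open PowerSeries

/-- The expansion of `1/(1+rX)`. -/
def geomSeries (r : ℝ) : PowerSeries ℝ := PowerSeries.mk fun k => (-r) ^ k

/-- The expansion of the Möbius map `(X+r)/(1+rX)`. -/
def mobiusSeries (r : ℝ) : PowerSeries ℝ := (X + C r) * geomSeries r

/-- The expansion of `(1+rX)^(-2η)`. -/
def binomSeries (η r : ℝ) : PowerSeries ℝ := PowerSeries.mk fun k => (-1) ^ k * nuSq η k * r ^ k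

/-- The expansion of `(1+rX)^(-2η) ((X+r)/(1+rX))ⁿ`, which is, up to the factor `(1-r²)^η`, the
image of `Xⁿ` under the displacement by `-r`. -/
def matSeries (η : ℝ) (n : ℕ) (r : ℝ) : PowerSeries ℝ := binomSeries η r * mobiusSeries r ^ n

/-- The coefficient `u_kn(r)` of `X^k` in `matSeries η n r`. The matrix element
`⟨e_k|U(p(-r)) e_n⟩` is `√(ν_n/ν_k) (1-r²)^η u_kn(r)`, with `ν_n = nuSq η n`. -/
def matCoeff (η : ℝ) (k n : ℕ) (r : ℝ) : ℝ := coeff k (matSeries η n r)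

theorem geomSeries_mul (r : ℝ) : geomSeries r * (1 + C r * X) = 1 := by
  ext k
  rw [mul_add, mul_one, ← mul_assoc, map_add]
  cases k with
  | zero => simp [geomSeries]
  | succ k =>
    rw [coeff_succ_mul_X, coeff_mul_C, geomSeries, coeff_mk, coeff_mk, coeff_one]
    simp [pow_succ]

theorem mobiusSeries_mul (r : ℝ) : mobiusSeries r * (1 + C r * X) = X + C r := by
  rw [mobiusSeries, mul_assoc, geomSeries_mul, mul_one]

theorem C_mul_geomSeries (r : ℝ) :
    (1 - C r ^ 2) * geomSeries r = 1 - C r * mobiusSeries r := by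
  rw [mobiusSeries]
  linear_combination geomSeries_mul r

theorem C_mul_X_mul_geomSeries (r : ℝ) :
    (1 - C r ^ 2) * X * geomSeries r = mobiusSeries r - C r := by
  rw [mobiusSeries]
  linear_combination -C r * geomSeries_mul r

theorem derivative_mobiusSeries (r : ℝ) :
    (1 - C r ^ 2) * X * d⁄dX ℝ (mobiusSeries r) =
      (mobiusSeries r - C r) * (1 - C r * mobiusSeries r) := by
  have h := congrArg (d⁄dX ℝ) (mobiusSeries_mul r)
  simp only [Derivation.leibniz, map_add, derivative_X, derivative_C, smul_eq_mul,
    Derivation.map_one_eq_zero] at h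
  have h1 : d⁄dX ℝ (mobiusSeries r) = (1 - C r * mobiusSeries r) * geomSeries r := by
    linear_combination geomSeries r * h - d⁄dX ℝ (mobiusSeries r) * geomSeries_mul r
  rw [h1]
  linear_combination (1 - C r * mobiusSeries r) * C_mul_X_mul_geomSeries r

theorem derivative_binomSeries (hη : 0 < η) (r : ℝ) :
    d⁄dX ℝ (binomSeries η r) = -C (2 * η) * C r * geomSeries r * binomSeries η r := by
  have h : d⁄dX ℝ (binomSeries η r) * (1 + C r * X) = -C (2 * η) * C r * binomSeries η r := by
    ext k
    rw [mul_add, mul_one, ← mul_assoc, map_add, coeff_derivative, binomSeries, coeff_mk,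
      neg_mul, neg_mul, map_neg, ← map_mul C, coeff_C_mul, coeff_mk]
    have h1 := nuSq_succ hη k
    cases k with
    | zero =>
      rw [coeff_zero_mul_X]
      norm_num at h1 ⊢
      rw [h1]; ring
    | succ k =>
      rw [coeff_succ_mul_X, coeff_mul_C, coeff_derivative, coeff_mk]
      push_cast at h1 ⊢
      rw [pow_succ _ (k + 1), pow_succ r (k + 1)]
      linear_combination (-(-1) ^ (k + 1) * (r ^ (k + 1) * r)) * h1
  linear_combination geomSeries r * h - d⁄dX ℝ (binomSeries η r) * geomSeries_mul r

theorem derivative_matSeries (hη : 0 < η) (n : ℕ) (r : ℝ) :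
    (1 - C r ^ 2) * X * d⁄dX ℝ (matSeries η n r) =
      -C (2 * η + n) * C r * matSeries η (n + 1) r - C (n : ℝ) * C r * matSeries η (n - 1) r +
        (C (n : ℝ) + C (2 * η + n) * C r ^ 2) * matSeries η n r := by
  have hS := derivative_mobiusSeries r
  have hB := derivative_binomSeries hη r
  have hX := C_mul_X_mul_geomSeries r
  simp only [matSeries, Derivation.leibniz, smul_eq_mul, map_add]
  rw [Derivation.leibniz_pow, hB]
  cases n with
  | zero =>
    simp only [pow_zero, zero_add, pow_one, Nat.cast_zero, map_zero, zero_smul]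
    linear_combination (-C (2 * η) * C r * binomSeries η r) * hX
  | succ n =>
    simp only [Nat.add_sub_cancel, smul_eq_mul, nsmul_eq_mul, map_natCast]
    push_cast
    linear_combination (-C (2 * η) * C r * binomSeries η r * mobiusSeries r ^ (n + 1)) * hX +
      binomSeries η r * (n + 1) * mobiusSeries r ^ n * hS

/-- A family of power series is differentiable in its parameter, coefficient by coefficient. -/
def HasCoeffDerivAt (F : ℝ → PowerSeries ℝ) (F' : PowerSeries ℝ) (r : ℝ) : Prop :=
  ∀ k, HasDerivAt (fun r => coeff k (F r)) (coeff k F') r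

namespace HasCoeffDerivAt

variable {F G : ℝ → PowerSeries ℝ} {F' G' : PowerSeries ℝ} {r : ℝ}

theorem mul (hF : HasCoeffDerivAt F F' r) (hG : HasCoeffDerivAt G G' r) :
    HasCoeffDerivAt (fun r => F r * G r) (F' * G r + F r * G') r := fun k => by
  simp only [coeff_mul, map_add, ← Finset.sum_add_distrib]
  exact HasDerivAt.fun_sum fun p _ => (hF p.1).fun_mul (hG p.2)

theorem add (hF : HasCoeffDerivAt F F' r) (hG : HasCoeffDerivAt G G' r) :
    HasCoeffDerivAt (fun r => F r + G r) (F' + G') r := fun k => by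
  simpa only [map_add] using (hF k).fun_add (hG k)

theorem const (P : PowerSeries ℝ) (r : ℝ) : HasCoeffDerivAt (fun _ => P) 0 r := fun k => by
  simpa using hasDerivAt_const r (coeff k P)

theorem unique (hF : HasCoeffDerivAt F F' r) (hG : HasCoeffDerivAt F G' r) : F' = G' := by
  ext k
  exact (hF k).unique (hG k)

theorem C_id (r : ℝ) : HasCoeffDerivAt (fun r => C r) 1 r := fun k => by
  simp only [coeff_C, coeff_one]
  split_ifs with h
  · exact hasDerivAt_id r
  · exact hasDerivAt_const r 0

theorem pow (hF : HasCoeffDerivAt F F' r) (n : ℕ) :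
    HasCoeffDerivAt (fun r => F r ^ n) (n * F r ^ (n - 1) * F') r := by
  induction n with
  | zero => simpa using const 1 r
  | succ n ih =>
    have h := ih.mul hF
    simp only [pow_succ]
    convert h using 1
    cases n with
    | zero => simp
    | succ n => simp only [Nat.add_sub_cancel]; push_cast; ring

end HasCoeffDerivAt

theorem hasCoeffDerivAt_geomSeries (r : ℝ) :
    HasCoeffDerivAt geomSeries (-X * geomSeries r ^ 2) r := by
  have h : HasCoeffDerivAt geomSeries (PowerSeries.mk fun k => k * (-r) ^ (k - 1) * (-1)) r := by
    intro k
    simp only [geomSeries, coeff_mk]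
    exact (hasDerivAt_neg r).fun_pow k
  -- differentiate the relation `geomSeries r * (1 + rX) = 1`
  have h1 := h.mul ((HasCoeffDerivAt.const 1 r).add
    ((HasCoeffDerivAt.C_id r).mul (HasCoeffDerivAt.const X r)))
  simp only [geomSeries_mul] at h1
  have h2 := h1.unique (HasCoeffDerivAt.const 1 r)
  convert h using 1
  have h3 := geomSeries_mul r
  set D : PowerSeries ℝ := PowerSeries.mk fun k => k * (-r) ^ (k - 1) * (-1)
  linear_combination D * h3 - geomSeries r * h2

theorem hasCoeffDerivAt_mobiusSeries (r : ℝ) :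
    ∃ D, HasCoeffDerivAt mobiusSeries D r ∧ (1 - C r ^ 2) * D = 1 - mobiusSeries r ^ 2 := by
  refine ⟨_, ((HasCoeffDerivAt.const X r).add (HasCoeffDerivAt.C_id r)).mul
    (hasCoeffDerivAt_geomSeries r), ?_⟩
  have h1 := C_mul_geomSeries r
  have h2 := mobiusSeries_mul r
  have h3 : mobiusSeries r = (X + C r) * geomSeries r := rfl
  linear_combination (1 - X * mobiusSeries r) * h1 + mobiusSeries r * h2 +
    ((1 - C r ^ 2) * X * geomSeries r) * h3

theorem hasCoeffDerivAt_binomSeries (hη : 0 < η) (r : ℝ) :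
    ∃ D, HasCoeffDerivAt (binomSeries η) D r ∧
      (1 - C r ^ 2) * D = -C (2 * η) * (mobiusSeries r - C r) * binomSeries η r := by
  refine ⟨X * (-C (2 * η) * binomSeries η r - X * d⁄dX ℝ (binomSeries η r)), fun k => ?_, ?_⟩
  · simp only [binomSeries, coeff_mk]
    have h := (hasDerivAt_pow k r).const_mul ((-1) ^ k * nuSq η k)
    refine h.congr_deriv ?_
    cases k with
    | zero => simp
    | succ k =>
      have h1 := nuSq_succ hη k
      rw [coeff_succ_X_mul, map_sub, neg_mul, map_neg, coeff_C_mul, coeff_mk, Nat.add_sub_cancel,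
        pow_succ (-1 : ℝ)]
      push_cast
      cases k with
      | zero =>
        norm_num at h1 ⊢
        exact h1
      | succ k =>
        rw [coeff_succ_X_mul, coeff_derivative, coeff_mk]
        push_cast at h1 ⊢
        linear_combination (-(-1) ^ (k + 1) * (r ^ (k + 1))) * h1
  · have h1 := derivative_binomSeries hη r
    have h2 := C_mul_X_mul_geomSeries r
    have h3 := geomSeries_mul r
    rw [h1]
    linear_combination (-C (2 * η) * binomSeries η r) * h2 +
      (C (2 * η) * binomSeries η r * (1 - C r ^ 2) * X) * h3

theorem coeff_X_mul_derivative {R : Type*} [CommRing R] (P : PowerSeries R) (k : ℕ) :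
    coeff k (X * d⁄dX R P) = k * coeff k P := by
  cases k with
  | zero => simp
  | succ k => rw [coeff_succ_X_mul, coeff_derivative]; push_cast; ring

/-- The derivative of a matrix coefficient with respect to the displacement. -/
theorem hasDerivAt_matCoeff (hη : 0 < η) (k n : ℕ) (r : ℝ) :
    ∃ d, HasDerivAt (matCoeff η k n) d r ∧ (1 - r ^ 2) * d =
      -(2 * η + n) * matCoeff η k (n + 1) r + n * matCoeff η k (n - 1) r +
        2 * η * r * matCoeff η k n r := by
  obtain ⟨B', hB, hB'⟩ := hasCoeffDerivAt_binomSeries hη r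
  obtain ⟨S', hS, hS'⟩ := hasCoeffDerivAt_mobiusSeries r
  refine ⟨_, (hB.mul (hS.pow n)) k, ?_⟩
  have key : C (1 - r ^ 2) * (B' * mobiusSeries r ^ n +
      binomSeries η r * ((n : PowerSeries ℝ) * mobiusSeries r ^ (n - 1) * S')) =
      C (-(2 * η + n)) * matSeries η (n + 1) r + C (n : ℝ) * matSeries η (n - 1) r +
        C (2 * η * r) * matSeries η n r := by
    simp only [matSeries, map_mul, map_add, map_natCast, map_neg, map_sub, map_pow, map_one]
      at hB' ⊢
    cases n with
    | zero =>
      simp only [pow_zero, Nat.cast_zero, zero_mul, mul_zero, add_zero, zero_add, pow_one]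
      linear_combination hB'
    | succ n =>
      simp only [Nat.add_sub_cancel]
      push_cast
      linear_combination mobiusSeries r ^ (n + 1) * hB' +
        (binomSeries η r * (n + 1) * mobiusSeries r ^ n) * hS'
  have h1 := congrArg (coeff k) key
  rw [coeff_C_mul, map_add (coeff k) (C _ * _ + C _ * _), map_add (coeff k) (C _ * _) (C _ * _),
    coeff_C_mul, coeff_C_mul, coeff_C_mul] at h1
  exact h1

/-- The weight relation between matrix coefficients, from the Euler operator `X d/dX`. -/
theorem matCoeff_weight (hη : 0 < η) (k n : ℕ) (r : ℝ) :
    (1 - r ^ 2) * (k * matCoeff η k n r) =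
      -(2 * η + n) * r * matCoeff η k (n + 1) r - n * r * matCoeff η k (n - 1) r +
        (n + (2 * η + n) * r ^ 2) * matCoeff η k n r := by
  have h := derivative_matSeries hη n r
  have key : C (1 - r ^ 2) * (X * d⁄dX ℝ (matSeries η n r)) =
      C (-(2 * η + n) * r) * matSeries η (n + 1) r + C (-(n * r)) * matSeries η (n - 1) r +
        C (n + (2 * η + n) * r ^ 2) * matSeries η n r := by
    simp only [map_mul, map_add, map_sub, map_neg, map_pow, map_one] at h ⊢
    linear_combination h
  have h1 := congrArg (coeff k) key
  rw [coeff_C_mul, coeff_X_mul_derivative, map_add (coeff k), map_add (coeff k) (_ * _),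
    coeff_C_mul, coeff_C_mul, coeff_C_mul] at h1
  simp only [matCoeff]
  linear_combination h1

theorem continuous_matCoeff (hη : 0 < η) (k n : ℕ) : Continuous (matCoeff η k n) :=
  continuous_iff_continuousAt.2 fun r =>
    (hasDerivAt_matCoeff hη k n r).choose_spec.1.continuousAt

theorem matCoeff_zero (k : ℕ) (r : ℝ) : matCoeff η k 0 r = (-1) ^ k * nuSq η k * r ^ k := by
  simp [matCoeff, matSeries, binomSeries]

/-! ### Taylor series of displaced monomials -/

/-- Both sides solve the same first order differential equation and agree at `0`. -/
theorem isTaylor_binomSeries (hη : 0 < η) {r : ℝ} (hr : (r : ℂ) ∈ disc) :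
    IsTaylor (fun z => (1 + z * r) ^ ((-2 * η : ℝ) : ℂ))
      (PowerSeries.map (algebraMap ℝ ℂ) (binomSeries η r)) := by
  have hslit : ∀ z ∈ disc, 1 + z * (r : ℂ) ∈ Complex.slitPlane := fun z hz => by
    have h := one_sub_mem_slitPlane (neg_mem_disc hr) hz
    simpa using h
  have hd : ∀ z ∈ disc, HasDerivAt (fun z : ℂ => (1 + z * r) ^ ((-2 * η : ℝ) : ℂ))
      (((-2 * η : ℝ) : ℂ) * (1 + z * r) ^ (((-2 * η : ℝ) : ℂ) - 1) * r) z := fun z hz => by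
    have h1 : HasDerivAt (fun z : ℂ => 1 + z * r) r z := by
      simpa using ((hasDerivAt_id z).mul_const (r : ℂ)).const_add 1
    exact h1.cpow_const (hslit z hz)
  have hdiff : DifferentiableOn ℂ (fun z : ℂ => (1 + z * r) ^ ((-2 * η : ℝ) : ℂ)) disc :=
    fun z hz => (hd z hz).differentiableAt.differentiableWithinAt
  obtain ⟨P, hP⟩ := IsTaylor.exists_of_differentiableOn hdiff
  have h1 := hP.deriv hdiff
  have h2 := (h1.add (h1.X_mul.C_mul (r : ℂ))).congr
    (g := fun z => ((-2 * η * r : ℝ) : ℂ) * (1 + z * r) ^ ((-2 * η : ℝ) : ℂ)) fun z hz => by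
      rw [(hd z hz).deriv]
      have h3 : 1 + z * (r : ℂ) ≠ 0 := Complex.slitPlane_ne_zero (hslit z hz)
      rw [Complex.cpow_sub _ _ h3, Complex.cpow_one]
      field_simp
      push_cast
      ring
  have h3 := h2.unique (hP.C_mul ((-2 * η * r : ℝ) : ℂ))
  have h0 : coeff 0 P = 1 := by
    have h4 := hP 0 (mem_disc.2 (by simp))
    have h5 := h4.unique (hasSum_single 0 fun n hn => by simp [hn])
    simpa using h5.symm
  suffices h : PowerSeries.map (algebraMap ℝ ℂ) (binomSeries η r) = P by rwa [h]
  ext k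
  rw [coeff_map, binomSeries, coeff_mk]
  induction k with
  | zero => simp [h0, nuSq_zero hη]
  | succ k ih =>
    have h4 := congrArg (coeff k) h3
    rw [map_add, coeff_C_mul, coeff_C_mul, coeff_X_mul_derivative, coeff_derivative, ← ih] at h4
    have h6 : ((k : ℂ) + 1) ≠ 0 := by exact_mod_cast k.succ_ne_zero
    refine mul_right_cancel₀ h6 ?_
    rw [eq_sub_of_add_eq h4]
    have h7 : (((k + 1) * nuSq η (k + 1) : ℝ) : ℂ) = (((2 * η + k) * nuSq η k : ℝ) : ℂ) := by
      rw [nuSq_succ hη k]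
    push_cast [Complex.coe_algebraMap] at h7 ⊢
    rw [pow_succ, pow_succ]
    linear_combination (-(-1) ^ k * (r ^ k * r)) * h7

theorem isTaylor_matSeries (hη : 0 < η) {r : ℝ} (hr : (r : ℂ) ∈ disc) (n : ℕ) :
    IsTaylor (fun z => (1 + z * r) ^ ((-2 * η : ℝ) : ℂ) * ((z + r) / (1 + z * r)) ^ n)
      (PowerSeries.map (algebraMap ℝ ℂ) (matSeries η n r)) := by
  have hne : ∀ z ∈ disc, 1 + z * (r : ℂ) ≠ 0 := fun z hz => by
    have h := one_sub_ne_zero (neg_mem_disc hr) hz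
    simpa using h
  induction n with
  | zero => simpa [matSeries] using isTaylor_binomSeries hη hr
  | succ n ih =>
    have hdiff : DifferentiableOn ℂ (fun z : ℂ => (1 + z * r) ^ ((-2 * η : ℝ) : ℂ) *
        ((z + r) / (1 + z * r)) ^ (n + 1)) disc := by
      refine DifferentiableOn.mul (fun z hz => ?_)
        (((differentiableOn_id.add_const _).div (by fun_prop) hne).pow _)
      have h := one_sub_mem_slitPlane (neg_mem_disc hr) hz
      have h' : 1 + z * (r : ℂ) ∈ Complex.slitPlane := by simpa using h
      have h1 : HasDerivAt (fun z : ℂ => 1 + z * r) r z := by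
        simpa using ((hasDerivAt_id z).mul_const (r : ℂ)).const_add 1
      exact (h1.cpow_const h').differentiableAt.differentiableWithinAt
    obtain ⟨P, hP⟩ := IsTaylor.exists_of_differentiableOn hdiff
    have h1 := (hP.add (hP.X_mul.C_mul (r : ℂ))).congr
      (g := fun z => z * ((1 + z * r) ^ ((-2 * η : ℝ) : ℂ) * ((z + r) / (1 + z * r)) ^ n) +
        r * ((1 + z * r) ^ ((-2 * η : ℝ) : ℂ) * ((z + r) / (1 + z * r)) ^ n)) fun z hz => by
        have h3 := hne z hz
        rw [pow_succ]
        field_simp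
    have h2 := h1.unique (ih.X_mul.add (ih.C_mul (r : ℂ)))
    have h3 := congrArg (PowerSeries.map (algebraMap ℝ ℂ)) (geomSeries_mul r)
    have h4 : (PowerSeries.map (algebraMap ℝ ℂ)) (matSeries η (n + 1) r) =
        PowerSeries.map (algebraMap ℝ ℂ) (matSeries η n r) * ((X + C (r : ℂ)) *
          PowerSeries.map (algebraMap ℝ ℂ) (geomSeries r)) := by
      simp only [matSeries, mobiusSeries, map_mul, map_pow, map_add, map_X, map_C, pow_succ,
        Complex.coe_algebraMap]
      ring
    suffices h : PowerSeries.map (algebraMap ℝ ℂ) (matSeries η (n + 1) r) = P by rwa [h]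
    rw [h4]
    simp only [map_mul, map_add, map_X, map_C, map_one, Complex.coe_algebraMap] at h3
    linear_combination P * h3 - PowerSeries.map (algebraMap ℝ ℂ) (geomSeries r) * h2

end

/-! ### Radial integrals of products of matrix coefficients -/

/-- The radial form of `∫ |U_kn|² d²z/(1-|z|²)²`, up to normalization, where
`U_kn(z) = ⟨U(p(z)) e_k|e_n⟩`. -/
def matNorm (η : ℝ) (k n : ℕ) : ℝ :=
  radInt η fun r => r * (1 - r ^ 2) * (matCoeff η k n r * matCoeff η k n r)

/-- The radial form of `∫ k₀ |U_kn|² d²z/(1-|z|²)²`, up to normalization. -/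
def matNormK (η : ℝ) (k n : ℕ) : ℝ :=
  radInt η fun r => r * (1 + r ^ 2) * (matCoeff η k n r * matCoeff η k n r)

/-- The radial form of `∫ k₊ conj(U_kn) U_k(n+1) d²z/(1-|z|²)²`, up to normalization. -/
def matCross (η : ℝ) (k n : ℕ) : ℝ :=
  radInt η fun r => 2 * r ^ 2 * (matCoeff η k (n + 1) r * matCoeff η k n r)

/-- The lowering relation: the derivative of the displacement and the weight relation combine to
eliminate `u_k(n+1)`. -/
theorem matCoeff_lower (hη : 0 < η) {k n : ℕ} {r d : ℝ}
    (hd : (1 - r ^ 2) * d = -(2 * η + n) * matCoeff η k (n + 1) r + n * matCoeff η k (n - 1) r +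
        2 * η * r * matCoeff η k n r) :
    (1 - r ^ 2) * r * d = 2 * n * r * matCoeff η k (n - 1) r -
      (n * (1 + r ^ 2) - k * (1 - r ^ 2)) * matCoeff η k n r := by
  linear_combination r * hd - matCoeff_weight hη k n r

/-- The raising relation, in which `u_k(n-1)` is eliminated instead. -/
theorem matCoeff_raise (hη : 0 < η) {k n : ℕ} {r d : ℝ}
    (hd : (1 - r ^ 2) * d = -(2 * η + n) * matCoeff η k (n + 1) r + n * matCoeff η k (n - 1) r +
        2 * η * r * matCoeff η k n r) :
    (1 - r ^ 2) * r * d = -2 * (2 * η + n) * r * matCoeff η k (n + 1) r +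
      (4 * η * r ^ 2 + n * (1 + r ^ 2) - k * (1 - r ^ 2)) * matCoeff η k n r := by
  linear_combination r * hd + matCoeff_weight hη k n r

/-- Integrate the derivative of `(1-r²)^(2η-2) (r-r³) u_k(n+1) u_kn`, where the lowering and the raising
relation turn the derivatives of the two factors into combinations of `u_kn` and `u_k(n+1)`. -/
theorem matNorm_succ (hη : 1 < η) (k n : ℕ) :
    (n + 1) * matNorm η k n = (2 * η + n) * matNorm η k (n + 1) := by
  have h0 : 0 < η := by linarith
  choose d hd hd' using fun n r => hasDerivAt_matCoeff h0 k n r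
  have hc := fun n => continuous_matCoeff h0 k n
  have hq : ∀ r, HasDerivAt (fun r => (r - r ^ 3) * (matCoeff η k (n + 1) r * matCoeff η k n r))
      ((1 - 3 * r ^ 2) * (matCoeff η k (n + 1) r * matCoeff η k n r) + (r - r ^ 3) *
        (d (n + 1) r * matCoeff η k n r + matCoeff η k (n + 1) r * d n r)) r := fun r => by
    have h1 : HasDerivAt (fun r : ℝ => r - r ^ 3) (1 - 3 * r ^ 2) r := by
      simpa using (hasDerivAt_id r).fun_sub (hasDerivAt_pow 3 r)
    exact h1.fun_mul ((hd (n + 1) r).fun_mul (hd n r))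
  have h := radInt_deriv hη hq
    (p := fun r => (2 * (n + 1)) * (r * (1 - r ^ 2) * (matCoeff η k n r * matCoeff η k n r)) +
      (-2 * (2 * η + n)) *
        (r * (1 - r ^ 2) * (matCoeff η k (n + 1) r * matCoeff η k (n + 1) r)))
    (by fun_prop) (fun r => by
      have h1 := matCoeff_lower h0 (hd' (n + 1) r)
      have h2 := matCoeff_raise h0 (hd' n r)
      rw [Nat.add_sub_cancel] at h1
      push_cast at h1
      linear_combination (1 - r ^ 2) * matCoeff η k n r * h1 +
        (1 - r ^ 2) * matCoeff η k (n + 1) r * h2)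
  rw [radInt_add hη (by fun_prop) (by fun_prop), radInt_const_mul, radInt_const_mul] at h
  simp only [matNorm]
  norm_num at h
  linarith

theorem matNorm_eq (hη : 1 < η) (k n : ℕ) :
    matNorm η k n = nuSq η k / (2 * (2 * η - 1) * nuSq η n) := by
  have h0 : 0 < η := by linarith
  have hk := nuSq_pos h0 k
  have h1 : 0 < 2 * η - 1 := by linarith
  induction n with
  | zero =>
    have h2 : matNorm η k 0 = nuSq η k ^ 2 *
        radInt η (fun r => (1 - r ^ 2) * r ^ (2 * k + 1)) := by
      rw [matNorm, ← radInt_const_mul]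
      congr 1
      ext r
      rw [matCoeff_zero]
      have h3 : ((-1 : ℝ) ^ k) * (-1) ^ k = 1 := by rw [← mul_pow]; norm_num
      linear_combination (r * (1 - r ^ 2) * nuSq η k ^ 2 * r ^ k * r ^ k) * h3
    rw [h2, radInt_moment hη, nuSq_zero h0]
    field_simp
  | succ n ih =>
    have h2 := matNorm_succ hη k n
    have h3 := nuSq_succ h0 n
    have h4 := nuSq_pos h0 n
    have h5 := nuSq_pos h0 (n + 1)
    rw [ih] at h2
    have h6 : (2 * η + n) ≠ 0 := by positivity
    refine mul_left_cancel₀ h6 ?_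
    rw [← h2]
    rw [← mul_div_assoc, ← mul_div_assoc, div_eq_div_iff (by positivity) (by positivity)]
    linear_combination (nuSq η k * (2 * (2 * η - 1))) * h3

/-- Integrate the derivative of `(1-r²)^(2η-2) r² u_k(n+1)²` and use the lowering relation. -/
theorem matNormK_lower (hη : 1 < η) (k n : ℕ) :
    (n + η) * matNormK η k (n + 1) =
      (k + η) * matNorm η k (n + 1) + (n + 1) * matCross η k n := by
  have h0 : 0 < η := by linarith
  choose d hd hd' using fun n r => hasDerivAt_matCoeff h0 k n r
  have hc := fun n => continuous_matCoeff h0 k n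
  have hq : ∀ r, HasDerivAt (fun r => r ^ 2 * (matCoeff η k (n + 1) r * matCoeff η k (n + 1) r))
      (2 * r * (matCoeff η k (n + 1) r * matCoeff η k (n + 1) r) + r ^ 2 *
        (d (n + 1) r * matCoeff η k (n + 1) r + matCoeff η k (n + 1) r * d (n + 1) r)) r :=
    fun r => by
      have h1 : HasDerivAt (fun r : ℝ => r ^ 2) (2 * r) r := by simpa using hasDerivAt_pow 2 r
      exact h1.fun_mul ((hd (n + 1) r).fun_mul (hd (n + 1) r))
  have h := radInt_deriv hη hq
    (p := fun r => (2 * (-n - η)) *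
        (r * (1 + r ^ 2) * (matCoeff η k (n + 1) r * matCoeff η k (n + 1) r)) +
      ((2 * (k + η)) * (r * (1 - r ^ 2) * (matCoeff η k (n + 1) r * matCoeff η k (n + 1) r)) +
      (2 * (n + 1)) * (2 * r ^ 2 * (matCoeff η k (n + 1) r * matCoeff η k n r))))
    (by fun_prop) (fun r => by
      have h1 := matCoeff_lower h0 (hd' (n + 1) r)
      rw [Nat.add_sub_cancel] at h1
      push_cast at h1
      linear_combination (2 * r * matCoeff η k (n + 1) r) * h1)
  rw [radInt_add hη (by fun_prop) (by fun_prop), radInt_add hη (by fun_prop) (by fun_prop),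
    radInt_const_mul, radInt_const_mul, radInt_const_mul] at h
  simp only [matNorm, matNormK, matCross]
  norm_num at h
  linarith

/-- Integrate the derivative of `(1-r²)^(2η-2) r² u_kn²` and use the raising relation. -/
theorem matNormK_raise (hη : 1 < η) (k n : ℕ) :
    (n + 1 + η) * matNormK η k n = (k + η) * matNorm η k n + (2 * η + n) * matCross η k n := by
  have h0 : 0 < η := by linarith
  choose d hd hd' using fun n r => hasDerivAt_matCoeff h0 k n r
  have hc := fun n => continuous_matCoeff h0 k n
  have hq : ∀ r, HasDerivAt (fun r => r ^ 2 * (matCoeff η k n r * matCoeff η k n r))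
      (2 * r * (matCoeff η k n r * matCoeff η k n r) + r ^ 2 *
        (d n r * matCoeff η k n r + matCoeff η k n r * d n r)) r :=
    fun r => by
      have h1 : HasDerivAt (fun r : ℝ => r ^ 2) (2 * r) r := by simpa using hasDerivAt_pow 2 r
      exact h1.fun_mul ((hd n r).fun_mul (hd n r))
  have h := radInt_deriv hη hq
    (p := fun r => (2 * (n + 1 + η)) *
        (r * (1 + r ^ 2) * (matCoeff η k n r * matCoeff η k n r)) +
      ((-2 * (k + η)) * (r * (1 - r ^ 2) * (matCoeff η k n r * matCoeff η k n r)) +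
      (-2 * (2 * η + n)) * (2 * r ^ 2 * (matCoeff η k (n + 1) r * matCoeff η k n r))))
    (by fun_prop) (fun r => by
      have h1 := matCoeff_raise h0 (hd' n r)
      linear_combination (2 * r * matCoeff η k n r) * h1)
  rw [radInt_add hη (by fun_prop) (by fun_prop), radInt_add hη (by fun_prop) (by fun_prop),
    radInt_const_mul, radInt_const_mul, radInt_const_mul] at h
  simp only [matNorm, matNormK, matCross]
  norm_num at h
  linarith

/-- At `n = 0` the lowering relation has no cross term. -/
theorem matNormK_zero (hη : 1 < η) (k : ℕ) :
    (η - 1) * matNormK η k 0 = (k + η) * matNorm η k 0 := by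
  have h0 : 0 < η := by linarith
  choose d hd hd' using fun n r => hasDerivAt_matCoeff h0 k n r
  have hc := fun n => continuous_matCoeff h0 k n
  have hq : ∀ r, HasDerivAt (fun r => r ^ 2 * (matCoeff η k 0 r * matCoeff η k 0 r))
      (2 * r * (matCoeff η k 0 r * matCoeff η k 0 r) + r ^ 2 *
        (d 0 r * matCoeff η k 0 r + matCoeff η k 0 r * d 0 r)) r :=
    fun r => by
      have h1 : HasDerivAt (fun r : ℝ => r ^ 2) (2 * r) r := by simpa using hasDerivAt_pow 2 r
      exact h1.fun_mul ((hd 0 r).fun_mul (hd 0 r))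
  have h := radInt_deriv hη hq
    (p := fun r => (2 * (1 - η)) *
        (r * (1 + r ^ 2) * (matCoeff η k 0 r * matCoeff η k 0 r)) +
      (2 * (k + η)) * (r * (1 - r ^ 2) * (matCoeff η k 0 r * matCoeff η k 0 r)))
    (by fun_prop) (fun r => by
      have h1 := matCoeff_lower h0 (hd' 0 r)
      push_cast at h1
      linear_combination (2 * r * matCoeff η k 0 r) * h1)
  rw [radInt_add hη (by fun_prop) (by fun_prop), radInt_const_mul, radInt_const_mul] at h
  simp only [matNorm, matNormK]
  norm_num at h
  linarith

/-- Eliminating the cross term from the lowering and the raising relation leaves a two-term recursion in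
`n`. This is where the symmetric dependence on `k + η` and `n + η` comes from. -/
theorem matNormK_eq (hη : 1 < η) (k n : ℕ) :
    matNormK η k n = (n + η) * (k + η) / (η * (η - 1)) * matNorm η k n := by
  have h0 : 0 < η := by linarith
  have h1 : η - 1 ≠ 0 := by linarith
  induction n with
  | zero =>
    refine mul_left_cancel₀ h1 ?_
    rw [matNormK_zero hη]
    field_simp
    push_cast
    ring
  | succ n ih =>
    have h2 := matNormK_lower hη k n
    have h3 := matNormK_raise hη k n
    have h4 := matNorm_succ hη k n
    have h5 : (2 * η + n) * (n + η) ≠ 0 := by positivity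
    have h6 : (2 * η + n) * (n + η) * matNormK η k (n + 1) =
        (n + 1) * (n + 1 + η) * matNormK η k n := by
      linear_combination (2 * η + n) * h2 - (n + 1) * h3 - (k + η) * h4
    refine mul_left_cancel₀ h5 ?_
    rw [h6, ih]
    push_cast
    linear_combination ((n + 1 + η) * ((n + η) * (k + η) / (η * (η - 1)))) * h4

theorem matCross_eq (hη : 1 < η) (k n : ℕ) :
    matCross η k n = (n + 1) * (k + η) / (η * (η - 1)) * matNorm η k n := by
  have h0 : 0 < η := by linarith
  have h1 : η - 1 ≠ 0 := by linarith
  have h3 := matNormK_raise hη k n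
  rw [matNormK_eq hη] at h3
  have h5 : (2 * η + n) ≠ 0 := by positivity
  refine mul_left_cancel₀ h5 ?_
  have h6 : (2 * η + n) * matCross η k n = (n + 1 + η) * ((n + η) * (k + η) / (η * (η - 1)) *
      matNorm η k n) - (k + η) * matNorm η k n := by linarith
  rw [h6]
  field_simp
  ring

theorem sqrt_nuSq_mul_self (hη : 0 < η) (k : ℕ) : √(nuSq η k) * √(nuSq η k) = nuSq η k :=
  Real.mul_self_sqrt (nuSq_pos hη k).le

/-- A product of two matrix coefficients with a radial weight of the form `p(r)/(1-r²)³`. -/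
theorem integral_radial_matFn (hη : 1 < η) (k m n : ℕ) {p : ℝ → ℝ} (hp : Continuous p) :
    IntegrableOn (fun a : ℂ => p ‖a‖ / (1 - ‖a‖ ^ 2) ^ 3 *
        ((√(nuSq η m) / √(nuSq η k) * (1 - ‖a‖ ^ 2) ^ η * matCoeff η k m ‖a‖) *
          (√(nuSq η n) / √(nuSq η k) * (1 - ‖a‖ ^ 2) ^ η * matCoeff η k n ‖a‖))) disc ∧
      ∫ a in disc, p ‖a‖ / (1 - ‖a‖ ^ 2) ^ 3 *
        ((√(nuSq η m) / √(nuSq η k) * (1 - ‖a‖ ^ 2) ^ η * matCoeff η k m ‖a‖) *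
          (√(nuSq η n) / √(nuSq η k) * (1 - ‖a‖ ^ 2) ^ η * matCoeff η k n ‖a‖)) =
      2 * Real.pi * (√(nuSq η m) * √(nuSq η n) / nuSq η k) *
        radInt η fun r => r * p r * (matCoeff η k m r * matCoeff η k n r) := by
  have h0 : 0 < η := by linarith
  have hm := continuous_matCoeff h0 k m
  have hn := continuous_matCoeff h0 k n
  have hk := nuSq_pos h0 k
  have heq : ∀ r ∈ Set.uIoo (0 : ℝ) 1, (1 - r ^ 2) ^ (2 * η - 3) *
      ((√(nuSq η m) * √(nuSq η n) / nuSq η k) *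
        (r * p r * (matCoeff η k m r * matCoeff η k n r))) =
      r * (p r / (1 - r ^ 2) ^ 3 *
        ((√(nuSq η m) / √(nuSq η k) * (1 - r ^ 2) ^ η * matCoeff η k m r) *
          (√(nuSq η n) / √(nuSq η k) * (1 - r ^ 2) ^ η * matCoeff η k n r))) := by
    intro r hr
    rw [Set.uIoo_of_le zero_le_one] at hr
    have hr' : 0 < 1 - r ^ 2 := by nlinarith [hr.1, hr.2]
    have h1 : (1 - r ^ 2) ^ (2 * η - 3) =
        (1 - r ^ 2) ^ η * (1 - r ^ 2) ^ η / (1 - r ^ 2) ^ 3 := by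
      rw [← Real.rpow_add hr', ← Real.rpow_natCast (1 - r ^ 2) 3, ← Real.rpow_sub hr']
      congr 1; push_cast; ring
    rw [h1]
    conv_lhs => rw [← sqrt_nuSq_mul_self h0 k]
    have hk' : √(nuSq η k) ≠ 0 := (Real.sqrt_pos.2 hk).ne'
    field_simp
  constructor
  · refine integrableOn_disc_radial (F := fun r => p r / (1 - r ^ 2) ^ 3 *
      ((√(nuSq η m) / √(nuSq η k) * (1 - r ^ 2) ^ η * matCoeff η k m r) *
        (√(nuSq η n) / √(nuSq η k) * (1 - r ^ 2) ^ η * matCoeff η k n r))) ?_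
    refine IntervalIntegrable.congr_uIoo ?_ heq
    exact intervalIntegrable_radial hη (by fun_prop)
  · rw [integral_disc_radial (fun r => p r / (1 - r ^ 2) ^ 3 *
      ((√(nuSq η m) / √(nuSq η k) * (1 - r ^ 2) ^ η * matCoeff η k m r) *
        (√(nuSq η n) / √(nuSq η k) * (1 - r ^ 2) ^ η * matCoeff η k n r))),
      ← intervalIntegral.integral_congr_uIoo heq, mul_assoc (2 * Real.pi), ← radInt_const_mul]
    rfl

/-! ### Matrix coefficients of the displacement operators -/

section

variable [Fact (1 / 2 < η)]

theorem disp_of_mem {a : ℂ} (ha : a ∈ disc) (f : FB η) : disp a f = dispIsometry a ha f := by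
  simp [disp, ha]

theorem disp_apply {a z : ℂ} (ha : a ∈ disc) (hz : z ∈ disc) (f : FB η) :
    disp a f z = dispFun η a f z := by
  rw [disp_of_mem ha]
  exact FB.mk_apply (differentiableOn_dispFun ha f.differentiableOn)
    (memLp_dispFun ha f.differentiableOn f.memLp) hz

/-- The two principal powers combine to a power of the real number `1 - |a|²`, since
`1 - z conj (-a)` stays off the negative axis. -/
theorem disp_neg_disp {a : ℂ} (ha : a ∈ disc) (f : FB η) : disp (-a) (disp a f) = f := by
  refine FB.ext fun z hz => ?_
  have hma := neg_mem_disc ha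
  have hm := mobius_mem hma hz
  have hmm : mobius a (mobius (-a) z) = z := by simpa using mobius_neg_mobius hma hz
  rw [disp_apply hma hz, dispFun, disp_apply ha hm, dispFun, hmm]
  have hslit := one_sub_mem_slitPlane hma hz
  have hx := one_sub_sq_pos ha
  set w := 1 - z * conj (-a) with hw
  set x : ℝ := 1 - ‖a‖ ^ 2 with hx_def
  have hw0 : w ≠ 0 := Complex.slitPlane_ne_zero hslit
  have h1 : 1 - mobius (-a) z * conj a = x * w⁻¹ := by
    have h2 : (x : ℂ) = 1 - a * conj a := by
      rw [Complex.mul_conj', hx_def]; push_cast; ring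
    rw [mobius, ← hw, h2, ← div_eq_mul_inv, eq_div_iff hw0, sub_mul, mul_right_comm,
      div_mul_cancel₀ _ hw0, hw, map_neg]
    ring
  have hx0 : (x : ℂ) ≠ 0 := by exact_mod_cast hx.ne'
  have h3 : w ^ ((-2 * η : ℝ) : ℂ) * (x * w⁻¹) ^ ((-2 * η : ℝ) : ℂ) =
      ((x ^ (-2 * η) : ℝ) : ℂ) := by
    rw [Complex.cpow_def_of_ne_zero hw0, Complex.cpow_def_of_ne_zero
      (mul_ne_zero hx0 (inv_ne_zero hw0)), Complex.log_ofReal_mul hx (inv_ne_zero hw0),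
      Complex.log_inv _ (Complex.slitPlane_arg_ne_pi hslit), ← Complex.exp_add,
      Complex.ofReal_cpow hx.le, Complex.cpow_def_of_ne_zero hx0, Complex.ofReal_log hx.le]
    congr 1
    ring
  have h4 : x ^ η * (x ^ η * x ^ (-2 * η)) = 1 := by
    rw [← Real.rpow_add hx, ← Real.rpow_add hx, show η + (η + -2 * η) = 0 by ring, Real.rpow_zero]
  have h5 : ((x ^ η : ℝ) : ℂ) * (((x ^ η : ℝ) : ℂ) * ((x ^ (-2 * η) : ℝ) : ℂ)) = 1 := by
    exact_mod_cast h4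
  rw [norm_neg, ← hx_def, h1]
  linear_combination (((x ^ η : ℝ) : ℂ) * ((x ^ η : ℝ) : ℂ) * f z) * h3 + f z * h5

/-- The displacement operators are unitary. -/
theorem inner_disp {a : ℂ} (ha : a ∈ disc) (φ ψ : FB η) :
    ⟪φ, disp a ψ⟫_ℂ = ⟪disp (-a) φ, ψ⟫_ℂ := by
  conv_rhs => rw [← disp_neg_disp ha ψ]
  rw [disp_of_mem (neg_mem_disc ha), disp_of_mem (neg_mem_disc ha), LinearIsometry.inner_map_map]

theorem inner_transported (M : FB η →L[ℂ] FB η) {z : ℂ} (hz : z ∈ disc) (φ ψ : FB η) :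
    ⟪φ, transported M z ψ⟫_ℂ = ⟪disp (-z) φ, M (disp (-z) ψ)⟫_ℂ := by
  rw [← inner_disp hz]
  rfl

/-- The coefficient `⟨e_k|U(p(-a)) ψ⟩ = ⟨U(p(a)) e_k|ψ⟩`, as a function of `a`. -/
def matFn (k : ℕ) (ψ : FB η) (a : ℂ) : ℂ := ⟪(e k : FB η), disp (-a) ψ⟫_ℂ

theorem hasSum_matFn (hη : 1 < η) (k : ℕ) (ψ : FB η) (a : ℂ) :
    HasSum (fun n => ⟪(e n : FB η), ψ⟫_ℂ * matFn k (e n : FB η) a) (matFn k ψ a) := by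
  have h := (hasSum_e hη ψ).mapL ((innerSL ℂ (e k : FB η)).comp (disp (-a)))
  simpa [matFn, inner_smul_right] using h

open PowerSeries in
/-- Displacing along the direction `u` is displacing along the real axis, conjugated by a rotation. -/
theorem matFn_e (hη : 1 < η) (k n : ℕ) {u : ℂ} (hu : ‖u‖ = 1) {r : ℝ} (hr0 : 0 ≤ r) (hr : r < 1) :
    matFn k (e n : FB η) (u * r) = ((√(nuSq η n) / √(nuSq η k) * (1 - r ^ 2) ^ η *
      matCoeff η k n r : ℝ) : ℂ) * (u ^ n * conj u ^ k) := by
  have hnorm : ‖u * (r : ℂ)‖ = r := by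
    rw [norm_mul, hu, one_mul, Complex.norm_real, Real.norm_of_nonneg hr0]
  have ha : u * (r : ℂ) ∈ disc := mem_disc.2 (by rwa [hnorm])
  have hrd : (r : ℂ) ∈ disc := mem_disc.2 (by rwa [Complex.norm_real, Real.norm_of_nonneg hr0])
  have huc : u * conj u = 1 := by rw [Complex.mul_conj', hu]; simp
  have hT : IsTaylor (disp (-(u * r)) (e n : FB η)) (PowerSeries.mk fun j =>
      ((√(nuSq η n) * (1 - r ^ 2) ^ η : ℝ) : ℂ) * u ^ n * ((matCoeff η j n r : ℂ) * conj u ^ j)) := by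
    intro z hz
    have hz' : conj u * z ∈ disc := by
      rw [mem_disc, norm_mul, RCLike.norm_conj, hu, one_mul]; exact mem_disc.1 hz
    have h := (isTaylor_matSeries (by linarith : 0 < η) hrd n (conj u * z) hz').mul_left
      (((√(nuSq η n) * (1 - r ^ 2) ^ η : ℝ) : ℂ) * u ^ n)
    have h1 : 1 + conj u * z * r = 1 - z * conj (-(u * r)) := by
      simp only [map_neg, map_mul, Complex.conj_ofReal]; ring
    have h2 : u * ((conj u * z + r) / (1 - z * conj (-(u * r)))) = mobius (-(u * r)) z := by
      rw [mobius, ← mul_div_assoc]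
      congr 1
      linear_combination z * huc
    rw [disp_apply (neg_mem_disc ha) hz, dispFun, e_apply n (mobius_mem (neg_mem_disc ha) hz),
      norm_neg, hnorm, ← h2, mul_pow]
    beta_reduce at h
    rw [h1] at h
    have h3 : ∀ j, coeff j (PowerSeries.mk fun j => ((√(nuSq η n) * (1 - r ^ 2) ^ η : ℝ) : ℂ) *
        u ^ n * ((matCoeff η j n r : ℂ) * conj u ^ j)) * z ^ j =
        ((√(nuSq η n) * (1 - r ^ 2) ^ η : ℝ) : ℂ) * u ^ n * (coeff j (PowerSeries.map
          (algebraMap ℝ ℂ) (matSeries η n r)) * (conj u * z) ^ j) := fun j => by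
      rw [coeff_mk, coeff_map, matCoeff, mul_pow, Complex.coe_algebraMap]
      ring
    simp only [h3]
    have h4 := h.tsum_eq
    refine (h.summable.hasSum_iff.2 (h4.trans ?_))
    push_cast
    ring
  rw [matFn, inner_e hη hT, coeff_mk]
  push_cast
  ring

/-- The phase of a complex number, with value `1` at `0`. -/
def phase (a : ℂ) : ℂ := if a = 0 then 1 else a / ‖a‖

theorem norm_phase (a : ℂ) : ‖phase a‖ = 1 := by
  unfold phase
  split_ifs with h
  · simp
  · simp [h]

theorem phase_mul_norm (a : ℂ) : phase a * ‖a‖ = a := by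
  unfold phase
  split_ifs with h
  · simp [h]
  · have : (‖a‖ : ℂ) ≠ 0 := by simpa using h
    field_simp

theorem measurable_phase : Measurable phase :=
  Measurable.ite (measurableSet_singleton 0) measurable_const (by fun_prop)

theorem matFn_e_eq (hη : 1 < η) (k n : ℕ) {a : ℂ} (ha : a ∈ disc) :
    matFn k (e n : FB η) a = ((√(nuSq η n) / √(nuSq η k) * (1 - ‖a‖ ^ 2) ^ η *
      matCoeff η k n ‖a‖ : ℝ) : ℂ) * (phase a ^ n * conj (phase a) ^ k) := by
  have h := matFn_e hη k n (norm_phase a) (norm_nonneg a) (mem_disc.1 ha)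
  rwa [phase_mul_norm] at h

theorem matFn_e_rotate (hη : 1 < η) (k n : ℕ) {u : ℂ} (hu : ‖u‖ = 1) {a : ℂ} (ha : a ∈ disc) :
    matFn k (e n : FB η) (u * a) = u ^ n * conj u ^ k * matFn k (e n : FB η) a := by
  have h := matFn_e hη k n (u := u * phase a) (by rw [norm_mul, hu, norm_phase, one_mul])
    (norm_nonneg a) (mem_disc.1 ha)
  rw [mul_assoc, phase_mul_norm] at h
  rw [h, matFn_e_eq hη k n ha, map_mul, mul_pow, mul_pow]
  ring

theorem aestronglyMeasurable_matFn (hη : 1 < η) (k : ℕ) (ψ : FB η) :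
    AEStronglyMeasurable (matFn k ψ) (volume.restrict disc) := by
  have h : ∀ n, AEStronglyMeasurable (matFn k (e n : FB η)) (volume.restrict disc) := by
    intro n
    have hc := continuous_matCoeff (by linarith : 0 < η) k n
    have hm : Measurable fun a : ℂ => ((√(nuSq η n) / √(nuSq η k) * (1 - ‖a‖ ^ 2) ^ η *
        matCoeff η k n ‖a‖ : ℝ) : ℂ) * (phase a ^ n * conj (phase a) ^ k) := by
      have h1 := measurable_phase
      have h2 : Measurable fun a : ℂ => conj (phase a) := RCLike.continuous_conj.measurable.comp h1
      have h3 : Measurable fun a : ℂ => matCoeff η k n ‖a‖ := (hc.comp continuous_norm).measurable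
      fun_prop
    refine hm.aestronglyMeasurable.congr ?_
    filter_upwards [ae_restrict_mem measurableSet_disc] with a ha
    exact (matFn_e_eq hη k n ha).symm
  refine aestronglyMeasurable_of_tendsto_ae atTop (f := fun N a =>
    ∑ n ∈ Finset.range N, ⟪(e n : FB η), ψ⟫_ℂ * matFn k (e n : FB η) a) (fun N => ?_)
    (ae_of_all _ fun a => (hasSum_matFn hη k ψ a).tendsto_sum_nat)
  exact Finset.aestronglyMeasurable_fun_sum _ fun n _ => (h n).const_mul _

/-! ### The integrals of products of matrix coefficients -/

theorem conj_phase_mul_phase (a : ℂ) : conj (phase a) * phase a = 1 := by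
  rw [Complex.conj_mul', norm_phase]; simp

theorem conj_matFn_mul_matFn (hη : 1 < η) (k m n : ℕ) {a : ℂ} (ha : a ∈ disc) :
    conj (matFn k (e m : FB η) a) * matFn k (e n : FB η) a =
      (((√(nuSq η m) / √(nuSq η k) * (1 - ‖a‖ ^ 2) ^ η * matCoeff η k m ‖a‖) *
          (√(nuSq η n) / √(nuSq η k) * (1 - ‖a‖ ^ 2) ^ η * matCoeff η k n ‖a‖) : ℝ) : ℂ) *
        (conj (phase a) ^ m * phase a ^ n) := by
  have h : (conj (phase a)) ^ k * phase a ^ k = 1 := by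
    rw [← mul_pow, conj_phase_mul_phase, one_pow]
  rw [matFn_e_eq hη k m ha, matFn_e_eq hη k n ha]
  generalize √(nuSq η m) / √(nuSq η k) * (1 - ‖a‖ ^ 2) ^ η * matCoeff η k m ‖a‖ = x
  generalize √(nuSq η n) / √(nuSq η k) * (1 - ‖a‖ ^ 2) ^ η * matCoeff η k n ‖a‖ = y
  rw [map_mul, Complex.conj_ofReal, map_mul, map_pow, map_pow, Complex.conj_conj,
    Complex.ofReal_mul]
  linear_combination (x * y * conj (phase a) ^ m * phase a ^ n) * h

/-- A weighted integral of two matrix coefficients vanishes unless their phases cancel. -/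
theorem integral_matFn_eq_zero (hη : 1 < η) (k m n : ℕ) (f : ℂ → ℂ) {s : ℤ}
    (hf : ∀ u : ℂ, ‖u‖ = 1 → ∀ a, f (u * a) = u ^ s * f a) (hs : s + n - m ≠ 0) :
    ∫ a in disc, f a * (conj (matFn k (e m : FB η) a) * matFn k (e n : FB η) a) = 0 := by
  refine integral_ball_eq_zero_of_rotate hs fun u hu a ha => ?_
  have hu0 : u ≠ 0 := fun h => by simp [h] at hu
  have hc : conj u = u⁻¹ := (Complex.inv_eq_conj hu).symm
  rw [hf u hu, matFn_e_rotate hη k m hu ha, matFn_e_rotate hη k n hu ha, zpow_sub₀ hu0,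
    zpow_add₀ hu0]
  simp only [map_mul, map_pow, hc, map_inv₀, inv_inv, zpow_natCast, inv_pow]
  field_simp

/-- The constant `(k+η)/(η(η-1))` by which the quantization with the weight `|e_k⟩⟨e_k|` multiplies
the generators, times the normalization `π/(2η-1)` of the invariant measure. -/
def coreConst (η : ℝ) (k : ℕ) : ℝ := Real.pi / (2 * η - 1) * ((k + η) / (η * (η - 1)))

theorem integral_k0_matFn (hη : 1 < η) (k m n : ℕ) :
    ∫ a in disc, k0 a / (1 - ‖a‖ ^ 2) ^ 2 *
      (conj (matFn k (e m : FB η) a) * matFn k (e n : FB η) a) =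
      if m = n then ((coreConst η k * (n + η) : ℝ) : ℂ) else 0 := by
  have h0 : 0 < η := by linarith
  split_ifs with h
  · subst h
    have h1 := (integral_radial_matFn hη k m m (p := fun r => 1 + r ^ 2) (by fun_prop)).2
    have h2 : (radInt η fun r => r * (1 + r ^ 2) * (matCoeff η k m r * matCoeff η k m r)) =
      matNormK η k m := rfl
    rw [h2, sqrt_nuSq_mul_self h0, matNormK_eq hη, matNorm_eq hη] at h1
    have hm := nuSq_pos h0 m
    have hk := nuSq_pos h0 k
    have h3 : coreConst η k * (m + η) = 2 * Real.pi * (nuSq η m / nuSq η k) *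
        ((m + η) * (k + η) / (η * (η - 1)) * (nuSq η k / (2 * (2 * η - 1) * nuSq η m))) := by
      have : 2 * η - 1 ≠ 0 := by linarith
      have : η - 1 ≠ 0 := by linarith
      rw [coreConst]; field_simp
    rw [h3, ← h1, ← integral_complex_ofReal]
    refine setIntegral_congr_fun measurableSet_disc fun a ha => ?_
    have h4 : conj (phase a) ^ m * phase a ^ m = 1 := by
      rw [← mul_pow, conj_phase_mul_phase, one_pow]
    rw [conj_matFn_mul_matFn hη k m m ha, h4, k0]
    push_cast
    rw [div_div, ← pow_succ', mul_one]
  · refine integral_matFn_eq_zero hη k m n (fun a => k0 a / (1 - ‖a‖ ^ 2) ^ 2) (s := 0)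
      (fun u hu a => ?_) (by omega)
    simp [k0, hu]

theorem kPlus_eq (z : ℂ) : kPlus z = 2 * conj z / (1 - ‖z‖ ^ 2) := by
  rw [kPlus, k1, k2, ← mul_assoc, mul_one_div_cancel Complex.I_ne_zero]
  ring

theorem kMinus_eq (z : ℂ) : kMinus z = 2 * z / (1 - ‖z‖ ^ 2) := by
  rw [kMinus, k1, k2, ← mul_assoc, mul_one_div_cancel Complex.I_ne_zero]
  ring

theorem integral_kPlus_matFn (hη : 1 < η) (k m n : ℕ) :
    ∫ a in disc, kPlus a / (1 - ‖a‖ ^ 2) ^ 2 *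
      (conj (matFn k (e m : FB η) a) * matFn k (e n : FB η) a) =
      if n = m + 1 then
        ((coreConst η k * ((m + 1) * √(nuSq η (m + 1)) / √(nuSq η m)) : ℝ) : ℂ) else 0 := by
  have h0 : 0 < η := by linarith
  split_ifs with h
  · subst h
    have h1 := (integral_radial_matFn hη k m (m + 1) (p := fun r => 2 * r) (by fun_prop)).2
    have h2 : (radInt η fun r => r * (2 * r) * (matCoeff η k m r * matCoeff η k (m + 1) r)) =
        matCross η k m := by
      rw [matCross]; congr 1; ext r; ring
    rw [h2, matCross_eq hη, matNorm_eq hη] at h1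
    have hm := Real.sqrt_pos.2 (nuSq_pos h0 m)
    have hk := nuSq_pos h0 k
    have h3 : coreConst η k * ((m + 1) * √(nuSq η (m + 1)) / √(nuSq η m)) =
        2 * Real.pi * (√(nuSq η m) * √(nuSq η (m + 1)) / nuSq η k) *
        ((m + 1) * (k + η) / (η * (η - 1)) * (nuSq η k / (2 * (2 * η - 1) * nuSq η m))) := by
      have : 2 * η - 1 ≠ 0 := by linarith
      have : η - 1 ≠ 0 := by linarith
      conv_rhs => rw [← sqrt_nuSq_mul_self h0 m, Real.sqrt_mul_self hm.le]
      rw [coreConst]; field_simp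
    rw [h3, ← h1, ← integral_complex_ofReal]
    refine setIntegral_congr_fun measurableSet_disc fun a ha => ?_
    have h4 : conj (phase a) ^ m * phase a ^ m = 1 := by
      rw [← mul_pow, conj_phase_mul_phase, one_pow]
    have h5 : conj a = conj (phase a) * ‖a‖ := by
      conv_lhs => rw [← phase_mul_norm a]
      simp
    have h6 := conj_phase_mul_phase a
    rw [conj_matFn_mul_matFn hη k m (m + 1) ha, kPlus_eq, h5, div_div, ← pow_succ',
      pow_succ (phase a) m]
    push_cast
    generalize ((1 : ℂ) - (‖a‖ : ℂ) ^ 2) ^ 3 = D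
    generalize ((√(nuSq η m) : ℂ) / √(nuSq η k) * ((1 - ‖a‖ ^ 2) ^ η : ℝ) *
      (matCoeff η k m ‖a‖ : ℂ)) = A
    generalize ((√(nuSq η (m + 1)) : ℂ) / √(nuSq η k) * ((1 - ‖a‖ ^ 2) ^ η : ℝ) *
      (matCoeff η k (m + 1) ‖a‖ : ℂ)) = B
    linear_combination (2 * ‖a‖ / D * (A * B) * (conj (phase a) * phase a)) * h4 +
      (2 * ‖a‖ / D * (A * B)) * h6
  · refine integral_matFn_eq_zero hη k m n (fun a => kPlus a / (1 - ‖a‖ ^ 2) ^ 2) (s := -1)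
      (fun u hu a => ?_) (by omega)
    simp only [kPlus_eq, norm_mul, hu, one_mul, map_mul, zpow_neg_one, Complex.inv_eq_conj hu]
    ring

theorem integral_kMinus_matFn (hη : 1 < η) (k m n : ℕ) :
    ∫ a in disc, kMinus a / (1 - ‖a‖ ^ 2) ^ 2 *
      (conj (matFn k (e m : FB η) a) * matFn k (e n : FB η) a) =
      if m = n + 1 then
        ((coreConst η k * ((n + 1) * √(nuSq η (n + 1)) / √(nuSq η n)) : ℝ) : ℂ) else 0 := by
  have h := congrArg conj (integral_kPlus_matFn hη k n m)
  rw [← integral_conj] at h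
  rw [apply_ite conj, Complex.conj_ofReal, map_zero] at h
  rw [← h]
  refine integral_congr_ae (ae_of_all _ fun a => ?_)
  simp only [kPlus_eq, kMinus_eq, map_mul, map_div₀, Complex.conj_conj, map_pow, map_sub,
    map_one, Complex.conj_ofReal, Complex.conj_ofNat]
  ring

end

/-! ### Square integrability against the weight `k₀` -/

/-- The density of `k₀(z) d²z/(1-|z|²)²`. -/
def kDensity (z : ℂ) : ℝ := (1 + ‖z‖ ^ 2) / (1 - ‖z‖ ^ 2) ^ 3

/-- The measure `k₀(z) d²z/(1-|z|²)²` on the disk. -/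
def kMeasure : Measure ℂ :=
  (volume.restrict disc).withDensity fun z => ENNReal.ofReal (kDensity z)

theorem measurable_kDensity : Measurable kDensity := by
  unfold kDensity; fun_prop

theorem kDensity_pos {z : ℂ} (hz : z ∈ disc) : 0 < kDensity z := by
  have := one_sub_sq_pos hz
  unfold kDensity
  positivity

theorem integrable_kMeasure {E : Type*} [NormedAddCommGroup E] [NormedSpace ℝ E] {g : ℂ → E} :
    Integrable g kMeasure ↔ IntegrableOn (fun z => kDensity z • g z) disc := by
  rw [kMeasure, integrable_withDensity_iff_integrable_smul'
    measurable_kDensity.ennreal_ofReal (ae_of_all _ fun _ => ENNReal.ofReal_lt_top)]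
  refine integrable_congr ?_
  filter_upwards [ae_restrict_mem measurableSet_disc] with z hz
  rw [ENNReal.toReal_ofReal (kDensity_pos hz).le]

theorem integral_kMeasure {E : Type*} [NormedAddCommGroup E] [NormedSpace ℝ E] (g : ℂ → E) :
    ∫ z, g z ∂kMeasure = ∫ z in disc, kDensity z • g z := by
  rw [kMeasure, integral_withDensity_eq_integral_toReal_smul
    measurable_kDensity.ennreal_ofReal (ae_of_all _ fun _ => ENNReal.ofReal_lt_top)]
  refine integral_congr_ae ?_
  filter_upwards [ae_restrict_mem measurableSet_disc] with z hz
  rw [ENNReal.toReal_ofReal (kDensity_pos hz).le]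

theorem kMeasure_ac : kMeasure ≪ volume.restrict disc := withDensity_absolutelyContinuous _ _

theorem inner_toLp {μ : Measure ℂ} {f g : ℂ → ℂ} (hf : MemLp f 2 μ) (hg : MemLp g 2 μ) :
    ⟪hf.toLp f, hg.toLp g⟫_ℂ = ∫ z, conj (f z) * g z ∂μ := by
  rw [L2.inner_def]
  refine integral_congr_ae ?_
  filter_upwards [hf.coeFn_toLp, hg.coeFn_toLp] with z h1 h2
  rw [h1, h2, RCLike.inner_apply, mul_comm]

theorem coreConst_pos (hη : 1 < η) (k : ℕ) : 0 < coreConst η k := by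
  have h1 : 0 < 2 * η - 1 := by linarith
  have h2 : 0 < η - 1 := by linarith
  have h3 : 0 < η := by linarith
  have := Real.pi_pos
  unfold coreConst; positivity

section

variable [Fact (1 / 2 < η)]

theorem memLp_matFn_e (hη : 1 < η) (k n : ℕ) : MemLp (matFn k (e n : FB η)) 2 kMeasure := by
  rw [memLp_two_iff_integrable_sq_norm ((aestronglyMeasurable_matFn hη k _).mono_ac kMeasure_ac),
    integrable_kMeasure]
  refine (integral_radial_matFn hη k n n (p := fun r => 1 + r ^ 2)
    (by fun_prop)).1.congr_fun (fun a ha => ?_) measurableSet_disc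
  have h := conj_matFn_mul_matFn hη k n n ha
  rw [← mul_pow, conj_phase_mul_phase, one_pow, mul_one, Complex.conj_mul',
    ← Complex.ofReal_pow, Complex.ofReal_inj] at h
  simp only
  rw [h]
  rfl

theorem integral_kMeasure_matFn_e (hη : 1 < η) (k m n : ℕ) :
    ⟪(memLp_matFn_e hη k m).toLp _, (memLp_matFn_e hη k n).toLp _⟫_ℂ =
      if m = n then ((coreConst η k * (n + η) : ℝ) : ℂ) else 0 := by
  rw [inner_toLp, integral_kMeasure, ← integral_k0_matFn hη k m n]
  refine setIntegral_congr_fun measurableSet_disc fun a ha => ?_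
  rw [Complex.real_smul, kDensity, k0, div_div, ← pow_succ']
  push_cast
  rfl

/-- On the form domain of `K₀`, the matrix coefficients are square integrable for `kMeasure`, and
their expansion in the basis converges in that sense. -/
theorem hasSum_toLp_matFn (hη : 1 < η) (k : ℕ) {ψ : FB η}
    (hψ : Summable fun n : ℕ => (n + η) * ‖⟪(e n : FB η), ψ⟫_ℂ‖ ^ 2) :
    ∃ h : MemLp (matFn k ψ) 2 kMeasure,
      HasSum (fun n => ⟪(e n : FB η), ψ⟫_ℂ • (memLp_matFn_e hη k n).toLp (matFn k (e n : FB η)))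
        (h.toLp _) := by
  have hη0 : 0 < η := by linarith
  have hC := coreConst_pos hη k
  set v : ℕ → Lp ℂ 2 kMeasure := fun n => (memLp_matFn_e hη k n).toLp (matFn k (e n : FB η))
    with hv
  have hin : ∀ m n, ⟪v m, v n⟫_ℂ = if m = n then ((coreConst η k * (n + η) : ℝ) : ℂ) else 0 :=
    integral_kMeasure_matFn_e hη k
  have hsq : ∀ n : ℕ, 0 < coreConst η k * (n + η) := fun n => by positivity
  -- normalize the orthogonal functions
  have ho : Orthonormal ℂ fun n : ℕ => (((√(coreConst η k * (n + η)))⁻¹ : ℝ) : ℂ) • v n := by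
    rw [orthonormal_iff_ite]
    intro m n
    rw [inner_smul_left, inner_smul_right, hin, Complex.conj_ofReal]
    split_ifs with hmn
    · subst hmn
      rw [← Complex.ofReal_mul, ← Complex.ofReal_mul]
      conv_lhs => rw [← Real.mul_self_sqrt (hsq m).le]
      have := (Real.sqrt_pos.2 (hsq m)).ne'
      rw [← Complex.ofReal_one, Complex.ofReal_inj, Real.sqrt_mul_self (Real.sqrt_nonneg _)]
      field_simp
    · simp
  have hterm : ∀ n : ℕ, ((√(coreConst η k * (n + η)) : ℝ) * ⟪(e n : FB η), ψ⟫_ℂ) •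
      ((((√(coreConst η k * (n + η)))⁻¹ : ℝ) : ℂ) • v n) = ⟪(e n : FB η), ψ⟫_ℂ • v n := fun n => by
    rw [smul_smul]
    congr 1
    have : ((√(coreConst η k * (n + η)) : ℝ) : ℂ) ≠ 0 := by
      exact_mod_cast (Real.sqrt_pos.2 (hsq n)).ne'
    rw [Complex.ofReal_inv]
    field_simp
  have hsum : Summable fun n => ⟪(e n : FB η), ψ⟫_ℂ • v n := by
    have h1 := (ho.orthogonalFamily.summable_iff_norm_sq_summable (fun n : ℕ =>
      (√(coreConst η k * (n + η)) : ℝ) * ⟪(e n : FB η), ψ⟫_ℂ)).2 ?_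
    · simpa only [LinearIsometry.toSpanSingleton_apply, hterm] using h1
    · refine (hψ.mul_left (coreConst η k)).congr fun n => ?_
      rw [norm_mul, Complex.norm_real, mul_pow, Real.norm_eq_abs, sq_abs, Real.sq_sqrt (hsq n).le]
      ring
  obtain ⟨V, hV⟩ := hsum
  -- the partial sums converge in `L²`, hence almost everywhere along a subsequence
  have hae : V =ᵐ[kMeasure] matFn k ψ := by
    obtain ⟨ns, hns, hlim⟩ :=
      (tendstoInMeasure_of_tendsto_Lp hV.tendsto_sum_nat).exists_seq_tendsto_ae
    have hpart : ∀ᵐ a ∂kMeasure, ∀ N, (∑ n ∈ Finset.range N, ⟪(e n : FB η), ψ⟫_ℂ • v n :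
        Lp ℂ 2 kMeasure) a = ∑ n ∈ Finset.range N, ⟪(e n : FB η), ψ⟫_ℂ * matFn k (e n : FB η) a := by
      rw [ae_all_iff]
      intro N
      induction N with
      | zero =>
        filter_upwards [Lp.coeFn_zero ℂ 2 kMeasure] with a ha
        simpa using ha
      | succ N ih =>
        simp only [Finset.sum_range_succ]
        filter_upwards [ih, Lp.coeFn_add (∑ n ∈ Finset.range N, ⟪(e n : FB η), ψ⟫_ℂ • v n)
          (⟪(e N : FB η), ψ⟫_ℂ • v N), Lp.coeFn_smul (⟪(e N : FB η), ψ⟫_ℂ) (v N),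
          (memLp_matFn_e hη k N).coeFn_toLp] with a h1 h2 h3 h4
        rw [h2, Pi.add_apply, h1, h3, Pi.smul_apply, smul_eq_mul, h4]
    filter_upwards [hlim, hpart] with a h1 h2
    refine tendsto_nhds_unique h1 ?_
    simp only [h2]
    exact (hasSum_matFn hη k ψ a).tendsto_sum_nat.comp hns.tendsto_atTop
  have hmem : MemLp (matFn k ψ) 2 kMeasure := (Lp.memLp V).ae_eq hae
  refine ⟨hmem, ?_⟩
  have hVeq : hmem.toLp _ = V := by
    refine Lp.ext ?_
    exact hmem.coeFn_toLp.trans hae.symm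
  rwa [hVeq]

theorem integral_norm_sq_matFn (hη : 1 < η) (k : ℕ) {ψ : FB η}
    (hψ : Summable fun n : ℕ => (n + η) * ‖⟪(e n : FB η), ψ⟫_ℂ‖ ^ 2) :
    ∫ a, ‖matFn k ψ a‖ ^ 2 ∂kMeasure =
      coreConst η k * ∑' n : ℕ, (n + η) * ‖⟪(e n : FB η), ψ⟫_ℂ‖ ^ 2 := by
  obtain ⟨hmem, hV⟩ := hasSum_toLp_matFn hη k hψ
  set V := hmem.toLp _
  have h1 : ∀ m, ⟪(memLp_matFn_e hη k m).toLp _, V⟫_ℂ =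
      ((coreConst η k * (m + η) : ℝ) : ℂ) * ⟪(e m : FB η), ψ⟫_ℂ := fun m => by
    have h2 := hV.mapL (innerSL ℂ ((memLp_matFn_e hη k m).toLp (matFn k (e m : FB η))))
    simp only [innerSL_apply_apply, inner_smul_right, integral_kMeasure_matFn_e hη] at h2
    refine h2.unique ?_
    have h3 := hasSum_single (f := fun n : ℕ => ⟪(e n : FB η), ψ⟫_ℂ *
      if m = n then ((coreConst η k * (n + η) : ℝ) : ℂ) else 0) m fun n hn => by simp [hn.symm]
    rwa [if_pos rfl, mul_comm] at h3
  have h3 := hV.mapL (innerSL ℂ V)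
  simp only [innerSL_apply_apply, inner_smul_right] at h3
  have h4 : HasSum (fun n : ℕ => coreConst η k * ((n + η) * ‖⟪(e n : FB η), ψ⟫_ℂ‖ ^ 2))
      (∫ a, ‖matFn k ψ a‖ ^ 2 ∂kMeasure) := by
    have h5 : ⟪V, V⟫_ℂ = ((∫ a, ‖matFn k ψ a‖ ^ 2 ∂kMeasure : ℝ) : ℂ) := by
      rw [inner_toLp, ← integral_complex_ofReal]
      refine integral_congr_ae (ae_of_all _ fun a => ?_)
      simp only
      rw [Complex.conj_mul']
      push_cast
      rfl
    rw [h5] at h3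
    rw [← Complex.hasSum_ofReal]
    refine h3.congr_fun fun n => ?_
    rw [← inner_conj_symm V, h1, map_mul, Complex.conj_ofReal, mul_left_comm (⟪(e n : FB η), ψ⟫_ℂ),
      Complex.mul_conj']
    push_cast
    ring
  rw [← h4.tsum_eq, tsum_mul_left]

/-! ### Quantization with the weight `|e_k⟩⟨e_k|` -/

/-- For every `k`, the quantization with the weight `|e_k⟩⟨e_k|` sends `f` to a multiple of `A`,
the multiple and the absolute convergence being controlled by `k + η`. -/
def IsCore (f : ℂ → ℂ) (A : domK η →ₗ[ℂ] FB η) : Prop :=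
  ∀ φ ψ : domK η,
    (∃ B, ∀ k : ℕ, ∫ a in disc, ‖f a / (1 - ‖a‖ ^ 2) ^ 2 *
      (conj (matFn k (φ : FB η) a) * matFn k (ψ : FB η) a)‖ ≤ B * (k + η)) ∧
    ∀ k : ℕ, IntegrableOn (fun a => f a / (1 - ‖a‖ ^ 2) ^ 2 *
        (conj (matFn k (φ : FB η) a) * matFn k (ψ : FB η) a)) disc ∧
      ∫ a in disc, f a / (1 - ‖a‖ ^ 2) ^ 2 *
        (conj (matFn k (φ : FB η) a) * matFn k (ψ : FB η) a) =
          coreConst η k * ⟪(φ : FB η), A ψ⟫_ℂ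

theorem k0_ne_zero {z : ℂ} (hz : z ∈ disc) : k0 z ≠ 0 := by
  have h1 := one_sub_sq_pos hz
  have h2 : k0 z = (((1 + ‖z‖ ^ 2) / (1 - ‖z‖ ^ 2) : ℝ) : ℂ) := by rw [k0]; push_cast; rfl
  rw [h2]
  exact_mod_cast (by positivity : (0 : ℝ) < (1 + ‖z‖ ^ 2) / (1 - ‖z‖ ^ 2)).ne'

theorem measurable_k0 : Measurable k0 := by unfold k0; fun_prop

/-- The weak identity between a quantized observable dominated by `k₀` and an operator follows from
the identity of their matrix elements in the basis. -/
theorem isCore_of_hasSum (hη : 1 < η)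
    (hdom : ∀ ψ : domK η, Summable fun n : ℕ => (n + η) * ‖⟪(e n : FB η), (ψ : FB η)⟫_ℂ‖ ^ 2)
    {f : ℂ → ℂ} (hf : Measurable f) (hfk : ∀ z ∈ disc, ‖f z‖ ≤ ‖k0 z‖) {A : domK η →ₗ[ℂ] FB η}
    (hA : ∀ (k m : ℕ) (ψ : domK η), HasSum (fun n => ⟪(e n : FB η), (ψ : FB η)⟫_ℂ *
      ∫ a in disc, f a / (1 - ‖a‖ ^ 2) ^ 2 *
        (conj (matFn k (e m : FB η) a) * matFn k (e n : FB η) a))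
      (coreConst η k * ⟪(e m : FB η), A ψ⟫_ℂ)) :
    IsCore f A := by
  intro φ ψ
  set h : ℂ → ℂ := fun z => f z / k0 z with hh
  have hhm : Measurable h := hf.div measurable_k0
  have hae : ∀ᵐ z ∂kMeasure, z ∈ disc := kMeasure_ac.ae_le (ae_restrict_mem measurableSet_disc)
  have hle : ∀ z ∈ disc, ‖h z‖ ≤ 1 := fun z hz => by
    rw [hh, norm_div]
    exact div_le_one_of_le₀ (hfk z hz) (norm_nonneg _)
  have hfac : ∀ z ∈ disc, ∀ w : ℂ, kDensity z • (h z * w) = f z / (1 - ‖z‖ ^ 2) ^ 2 * w := by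
    intro z hz w
    have h1 := k0_ne_zero hz
    have h2 : (kDensity z : ℂ) = k0 z / (1 - ‖z‖ ^ 2) ^ 2 := by
      rw [kDensity, k0, div_div, ← pow_succ']; push_cast; rfl
    rw [Complex.real_smul, h2, hh]
    field_simp
  have hfac' : ∀ z ∈ disc, ∀ v w : ℂ, kDensity z • (v * (h z * w)) =
      f z / (1 - ‖z‖ ^ 2) ^ 2 * (v * w) := fun z hz v w => by
    rw [mul_left_comm v, hfac z hz]
  have hmul : ∀ {g : ℂ → ℂ}, MemLp g 2 kMeasure → MemLp (fun z => h z * g z) 2 kMeasure := by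
    intro g hg
    refine hg.of_le (hhm.aestronglyMeasurable.mul hg.1) ?_
    filter_upwards [hae] with z hz
    rw [norm_mul]
    exact mul_le_of_le_one_left (norm_nonneg _) (hle z hz)
  have hmul' : ∀ {g : ℂ → ℂ}, MemLp g 2 kMeasure → MemLp (fun z => conj (h z) * g z) 2 kMeasure := by
    intro g hg
    refine hg.of_le (((RCLike.continuous_conj.measurable.comp hhm).aestronglyMeasurable).mul
      hg.1) ?_
    filter_upwards [hae] with z hz
    rw [norm_mul, RCLike.norm_conj]
    exact mul_le_of_le_one_left (norm_nonneg _) (hle z hz)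
  have hform : ∀ g₁ g₂ : ℂ → ℂ, ∫ a in disc, f a / (1 - ‖a‖ ^ 2) ^ 2 * (conj (g₁ a) * g₂ a) =
      ∫ z, conj (g₁ z) * (h z * g₂ z) ∂kMeasure := by
    intro g₁ g₂
    rw [integral_kMeasure]
    refine setIntegral_congr_fun measurableSet_disc fun z hz => ?_
    rw [hfac' z hz]
  have hint : ∀ k, Integrable (fun z => conj (matFn k (φ : FB η) z) *
      (h z * matFn k (ψ : FB η) z)) kMeasure := fun k =>
    MemLp.integrable_mul (p := 2) (q := 2) (hasSum_toLp_matFn hη k (hdom φ)).1.star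
      (hmul (hasSum_toLp_matFn hη k (hdom ψ)).1)
  refine ⟨⟨Real.pi / (2 * η - 1) * (1 / (η * (η - 1))) *
    ((∑' n : ℕ, (n + η) * ‖⟪(e n : FB η), (φ : FB η)⟫_ℂ‖ ^ 2 +
      ∑' n : ℕ, (n + η) * ‖⟪(e n : FB η), (ψ : FB η)⟫_ℂ‖ ^ 2) / 2), fun k => ?_⟩,
    fun k => ⟨?_, ?_⟩⟩
  · obtain ⟨hφ, -⟩ := hasSum_toLp_matFn hη k (hdom φ)
    obtain ⟨hψ, -⟩ := hasSum_toLp_matFn hη k (hdom ψ)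
    have h1 : ∫ a in disc, ‖f a / (1 - ‖a‖ ^ 2) ^ 2 *
        (conj (matFn k (φ : FB η) a) * matFn k (ψ : FB η) a)‖ =
        ∫ z, ‖conj (matFn k (φ : FB η) z) * (h z * matFn k (ψ : FB η) z)‖ ∂kMeasure := by
      rw [integral_kMeasure]
      refine setIntegral_congr_fun measurableSet_disc fun z hz => ?_
      rw [← hfac' z hz, norm_smul, Real.norm_of_nonneg (kDensity_pos hz).le,
        smul_eq_mul]
    have hsqφ := hφ.integrable_norm_pow two_ne_zero
    have hsqψ := hψ.integrable_norm_pow two_ne_zero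
    rw [h1]
    calc _ ≤ ∫ z, (‖matFn k (φ : FB η) z‖ ^ 2 + ‖matFn k (ψ : FB η) z‖ ^ 2) / 2 ∂kMeasure := by
          refine integral_mono_ae (hint k).norm ((hsqφ.add hsqψ).div_const 2) ?_
          filter_upwards [hae] with z hz
          rw [norm_mul, norm_mul, RCLike.norm_conj]
          have h2 : ‖h z‖ * ‖matFn k (ψ : FB η) z‖ ≤ ‖matFn k (ψ : FB η) z‖ :=
            mul_le_of_le_one_left (norm_nonneg _) (hle z hz)
          have h3 := mul_le_mul_of_nonneg_left h2 (norm_nonneg (matFn k (φ : FB η) z))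
          have h4 := two_mul_le_add_sq ‖matFn k (φ : FB η) z‖ ‖matFn k (ψ : FB η) z‖
          linarith
      _ = _ := by
          rw [integral_div, integral_add hsqφ hsqψ, integral_norm_sq_matFn hη k (hdom φ),
            integral_norm_sq_matFn hη k (hdom ψ), coreConst]
          ring
  · have h1 := integrable_kMeasure.1 (hint k)
    refine h1.congr_fun (fun z hz => ?_) measurableSet_disc
    exact hfac' z hz _ _
  · obtain ⟨hφ, hφs⟩ := hasSum_toLp_matFn hη k (hdom φ)
    obtain ⟨hψ, hψs⟩ := hasSum_toLp_matFn hη k (hdom ψ)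
    -- expand first in `ψ` and then in `φ`
    have h1 : ∀ m, ⟪(memLp_matFn_e hη k m).toLp _, (hmul hψ).toLp _⟫_ℂ =
        coreConst η k * ⟪(e m : FB η), A ψ⟫_ℂ := fun m => by
      have h2 : ⟪(memLp_matFn_e hη k m).toLp _, (hmul hψ).toLp _⟫_ℂ =
          ⟪(hmul' (memLp_matFn_e hη k m)).toLp _, hψ.toLp _⟫_ℂ := by
        rw [inner_toLp, inner_toLp]
        refine integral_congr_ae (ae_of_all _ fun z => ?_)
        simp only [map_mul, Complex.conj_conj]
        ring
      have h3 := hψs.mapL (innerSL ℂ ((hmul' (memLp_matFn_e hη k m)).toLp _))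
      rw [h2]
      refine h3.unique ?_
      refine (hA k m ψ).congr_fun fun n => ?_
      rw [innerSL_apply_apply, inner_smul_right, inner_toLp, hform]
      congr 1
      refine integral_congr_ae (ae_of_all _ fun z => ?_)
      simp only [map_mul, Complex.conj_conj]
      ring
    have h4 := (hφs.mapL (innerSL ℂ ((hmul hψ).toLp _)))
    simp only [innerSL_apply_apply, inner_smul_right] at h4
    have h5 := (hasSum_e hη (φ : FB η)).mapL (innerSL ℂ (A ψ))
    simp only [innerSL_apply_apply, inner_smul_right] at h5
    have h6 : ⟪(hmul hψ).toLp _, hφ.toLp _⟫_ℂ = coreConst η k * ⟪A ψ, (φ : FB η)⟫_ℂ := by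
      refine h4.unique ((h5.mul_left ((coreConst η k : ℝ) : ℂ)).congr_fun fun m => ?_)
      rw [← inner_conj_symm ((hmul hψ).toLp _), h1, map_mul, Complex.conj_ofReal, inner_conj_symm]
      ring
    rw [hform, ← inner_toLp hφ (hmul hψ), ← inner_conj_symm, h6, map_mul, Complex.conj_ofReal,
      inner_conj_symm]

theorem IsCore.add {f g : ℂ → ℂ} {A B : domK η →ₗ[ℂ] FB η} (hf : IsCore f A) (hg : IsCore g B) :
    IsCore (fun z => f z + g z) (A + B) := by
  intro φ ψ
  obtain ⟨⟨b₁, hb₁⟩, h₁⟩ := hf φ ψ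
  obtain ⟨⟨b₂, hb₂⟩, h₂⟩ := hg φ ψ
  have hsplit : ∀ (k : ℕ) (a : ℂ), (f a + g a) / (1 - ‖a‖ ^ 2) ^ 2 *
      (conj (matFn k (φ : FB η) a) * matFn k (ψ : FB η) a) =
      f a / (1 - ‖a‖ ^ 2) ^ 2 * (conj (matFn k (φ : FB η) a) * matFn k (ψ : FB η) a) +
      g a / (1 - ‖a‖ ^ 2) ^ 2 * (conj (matFn k (φ : FB η) a) * matFn k (ψ : FB η) a) :=
    fun k a => by ring
  refine ⟨⟨b₁ + b₂, fun k => ?_⟩, fun k => ⟨?_, ?_⟩⟩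
  · simp only [hsplit]
    calc _ ≤ ∫ a in disc, (‖f a / (1 - ‖a‖ ^ 2) ^ 2 *
            (conj (matFn k (φ : FB η) a) * matFn k (ψ : FB η) a)‖ +
          ‖g a / (1 - ‖a‖ ^ 2) ^ 2 * (conj (matFn k (φ : FB η) a) * matFn k (ψ : FB η) a)‖) :=
          integral_mono ((h₁ k).1.add (h₂ k).1).norm ((h₁ k).1.norm.add (h₂ k).1.norm)
            fun a => norm_add_le _ _
      _ ≤ _ := by
        rw [integral_add (h₁ k).1.norm (h₂ k).1.norm, add_mul]
        exact add_le_add (hb₁ k) (hb₂ k)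
  · simp only [hsplit]
    exact (h₁ k).1.add (h₂ k).1
  · simp only [hsplit]
    rw [integral_add (h₁ k).1 (h₂ k).1, (h₁ k).2, (h₂ k).2, LinearMap.add_apply, inner_add_right,
      mul_add]

theorem IsCore.smul {f : ℂ → ℂ} {A : domK η →ₗ[ℂ] FB η} (c : ℂ) (hf : IsCore f A) :
    IsCore (fun z => c * f z) (c • A) := by
  intro φ ψ
  obtain ⟨⟨b, hb⟩, h⟩ := hf φ ψ
  have hsplit : ∀ (k : ℕ) (a : ℂ), c * f a / (1 - ‖a‖ ^ 2) ^ 2 *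
      (conj (matFn k (φ : FB η) a) * matFn k (ψ : FB η) a) =
      c * (f a / (1 - ‖a‖ ^ 2) ^ 2 * (conj (matFn k (φ : FB η) a) * matFn k (ψ : FB η) a)) :=
    fun k a => by ring
  refine ⟨⟨‖c‖ * b, fun k => ?_⟩, fun k => ⟨?_, ?_⟩⟩
  · simp only [hsplit, norm_mul c]
    rw [integral_const_mul, mul_assoc]
    exact mul_le_mul_of_nonneg_left (hb k) (norm_nonneg c)
  · simp only [hsplit]
    exact (h k).1.const_mul c
  · simp only [hsplit]
    rw [integral_const_mul, (h k).2, LinearMap.smul_apply, inner_smul_right]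
    ring

end

/-! ### The generators on their common domain -/

open Polynomial in
/-- The differential operator `p(z) d/dz + q(z)` as a linear map on the common domain `domK η`. -/
def diffOp (η : ℝ) (p q : ℂ[X]) : domK η →ₗ[ℂ] FB η := (firstOrder p q).toFun

open Polynomial in
theorem diffOp_apply (p q : ℂ[X]) (ψ : domK η) {z : ℂ} (hz : z ∈ disc) :
    diffOp η p q ψ z = p.eval z * deriv (ψ : FB η) z + q.eval z * (ψ : FB η) z :=
  FB.mk_apply
    ((p.differentiable.differentiableOn.mul (differentiableOn_deriv ψ.1)).add
      (q.differentiable.differentiableOn.mul ψ.1.differentiableOn))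
    ((memLp_poly_mul p ψ.2).add (memLp_poly_mul q ψ.1.memLp)) hz

open Polynomial in
/-- The lowering operator `K₋ = d/dz`. -/
def lowering (η : ℝ) : domK η →ₗ[ℂ] FB η := diffOp η 1 0

open Polynomial in
/-- The raising operator `K₊ = z² d/dz + 2ηz`. -/
def raising (η : ℝ) : domK η →ₗ[ℂ] FB η := diffOp η (X ^ 2) (C (2 * η : ℂ) * X)

open Polynomial in
/-- The weight operator `K₀ = z d/dz + η`. -/
def weight (η : ℝ) : domK η →ₗ[ℂ] FB η := diffOp η X (C (η : ℂ))

theorem mul_coreConst (hη : 1 < η) (k : ℕ) :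
    ((2 * η - 1) / Real.pi : ℂ) * coreConst η k = (k + η) / (η * (η - 1)) := by
  have h1 : ((2 * η - 1) / Real.pi) * coreConst η k = (k + η) / (η * (η - 1)) := by
    have : 2 * η - 1 ≠ 0 := by linarith
    have := Real.pi_pos
    rw [coreConst]
    field_simp
  exact_mod_cast congrArg (fun x : ℝ => (x : ℂ)) h1

theorem gammaConst_eq (hη : 1 < η) (S : ℂ) : gammaConst η S = (S + η) / (η * (η - 1)) := by
  have h1 : (η : ℂ) ≠ 0 := by exact_mod_cast (by linarith : η ≠ 0)
  have h2 : (η : ℂ) - 1 ≠ 0 := by exact_mod_cast (by linarith : η - 1 ≠ 0)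
  rw [gammaConst]
  field_simp
  ring

/-- `B` is the restriction of `c • A` to the domain of `B`. -/
def IsScaled (c : ℂ) (A : domK η →ₗ[ℂ] FB η) (B : FB η →ₗ.[ℂ] FB η) : Prop :=
  ∀ ψ : B.domain, ∃ h : (ψ : FB η) ∈ domK η, B ψ = c • A ⟨ψ, h⟩

open Polynomial in
theorem diffOp_K2_eq (ψ : domK η) : diffOp η (C (1 / 2) * (1 + X ^ 2)) (C (η : ℂ) * X) ψ =
    ((1 / 2 : ℂ) • lowering η + (1 / 2 : ℂ) • raising η) ψ := by
  refine FB.ext fun z hz => ?_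
  rw [LinearMap.add_apply, LinearMap.smul_apply, LinearMap.smul_apply, FB.add_apply, FB.smul_apply,
    FB.smul_apply, lowering, raising, diffOp_apply _ _ ψ hz, diffOp_apply _ _ ψ hz,
    diffOp_apply _ _ ψ hz]
  simp
  ring

open Polynomial in
theorem diffOp_K1_eq (ψ : domK η) :
    diffOp η (C (-(Complex.I / 2)) * (1 - X ^ 2)) (C (Complex.I * η) * X) ψ =
      -(((Complex.I / 2) • lowering η + (-(Complex.I / 2)) • raising η) ψ) := by
  refine FB.ext fun z hz => ?_
  rw [LinearMap.add_apply, LinearMap.smul_apply, LinearMap.smul_apply, neg_add, ← neg_smul,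
    ← neg_smul, FB.add_apply, FB.smul_apply, FB.smul_apply, lowering, raising,
    diffOp_apply _ _ ψ hz, diffOp_apply _ _ ψ hz, diffOp_apply _ _ ψ hz]
  simp
  ring

theorem isScaled_smul {c : ℂ} {A : domK η →ₗ[ℂ] FB η} {B : FB η →ₗ.[ℂ] FB η}
    (h : IsScaled c A B) (γ : ℂ) : IsScaled (γ * c) A (γ • B) := fun ψ => by
  obtain ⟨h1, h2⟩ := h ⟨ψ, ψ.2⟩
  refine ⟨h1, ?_⟩
  rw [mul_smul, ← h2]
  exact LinearPMap.smul_apply γ B ψ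

theorem isScaled_K0 : IsScaled 1 (weight η) (K0 η) := fun ψ => ⟨ψ.2, (one_smul ℂ _).symm⟩

open Polynomial in
theorem isScaled_firstOrder {p q : ℂ[X]} {c : ℂ} {A : domK η →ₗ[ℂ] FB η}
    (h : ∀ ψ, diffOp η p q ψ = c • A ψ) : IsScaled c A (firstOrder p q) :=
  fun ψ => ⟨ψ.2, h ⟨ψ.1, ψ.2⟩⟩

theorem isScaled_K2 :
    IsScaled 1 ((1 / 2 : ℂ) • lowering η + (1 / 2 : ℂ) • raising η) (K2 η) :=
  isScaled_firstOrder fun ψ => by rw [diffOp_K2_eq, one_smul]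

theorem isScaled_K1 : IsScaled (-1)
    ((Complex.I / 2) • lowering η + (-(Complex.I / 2)) • raising η) (K1 η) :=
  isScaled_firstOrder fun ψ => by rw [diffOp_K1_eq, neg_one_smul]

theorem isScaled_KMinus : IsScaled 1 (lowering η) (KMinus η) := fun ψ => by
  obtain ⟨hd, h2⟩ := isScaled_K2 (η := η) ⟨ψ, ψ.2.1⟩
  obtain ⟨h0, h1⟩ := isScaled_K1 (η := η) ⟨ψ, ψ.2.2⟩
  refine ⟨hd, ?_⟩
  have h : KMinus η ψ = K2 η ⟨ψ, ψ.2.1⟩ + Complex.I • K1 η ⟨ψ, ψ.2.2⟩ := rfl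
  rw [h, h1, h2]
  simp only [LinearMap.add_apply, LinearMap.smul_apply]
  match_scalars
  · linear_combination (-1 / 2 : ℂ) * Complex.I_sq
  · linear_combination (1 / 2 : ℂ) * Complex.I_sq

theorem isScaled_KPlus : IsScaled 1 (raising η) (KPlus η) := fun ψ => by
  obtain ⟨hd, h2⟩ := isScaled_K2 (η := η) ⟨ψ, ψ.2.1⟩
  obtain ⟨h0, h1⟩ := isScaled_K1 (η := η) ⟨ψ, ψ.2.2⟩
  refine ⟨hd, ?_⟩
  have h : KPlus η ψ = K2 η ⟨ψ, ψ.2.1⟩ - Complex.I • K1 η ⟨ψ, ψ.2.2⟩ := rfl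
  rw [h, h1, h2]
  simp only [LinearMap.add_apply, LinearMap.smul_apply]
  match_scalars
  · linear_combination (1 / 2 : ℂ) * Complex.I_sq
  · linear_combination (-1 / 2 : ℂ) * Complex.I_sq

/-! ### Matrix elements of the generators -/

open PowerSeries in
theorem isTaylor_raising {P : PowerSeries ℂ} (ψ : domK η) (hP : IsTaylor (ψ : FB η) P) :
    IsTaylor (raising η ψ) (X * (X * d⁄dX ℂ P + C (2 * η : ℂ) * P)) := by
  refine ((hP.deriv ψ.1.differentiableOn).X_mul.add
    (hP.C_mul (2 * η : ℂ))).X_mul.congr fun z hz => ?_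
  rw [raising, diffOp_apply _ _ ψ hz]
  simp
  ring

section

variable [Fact (1 / 2 < η)]

open PowerSeries in
theorem exists_isTaylor (hη : 1 < η) (ψ : FB η) : ∃ P, IsTaylor ψ P ∧
    ∀ n, coeff n P = (√(nuSq η n) : ℝ) * ⟪(e n : FB η), ψ⟫_ℂ := by
  obtain ⟨P, hP⟩ := IsTaylor.exists_of_differentiableOn ψ.differentiableOn
  refine ⟨P, hP, fun n => ?_⟩
  have h : ((√(nuSq η n) : ℝ) : ℂ) ≠ 0 := by
    exact_mod_cast (Real.sqrt_pos.2 (nuSq_pos (by linarith : 0 < η) n)).ne'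
  rw [inner_e hη hP, mul_div_cancel₀ _ h]

open PowerSeries in
theorem inner_e_weight (hη : 1 < η) (m : ℕ) (ψ : domK η) :
    ⟪(e m : FB η), weight η ψ⟫_ℂ = (m + η : ℝ) * ⟪(e m : FB η), (ψ : FB η)⟫_ℂ := by
  obtain ⟨P, hP, hc⟩ := exists_isTaylor hη (ψ : FB η)
  have h1 : IsTaylor (weight η ψ) (X * d⁄dX ℂ P + C (η : ℂ) * P) := by
    refine ((hP.deriv ψ.1.differentiableOn).X_mul.add (hP.C_mul (η : ℂ))).congr fun z hz => ?_
    rw [weight, diffOp_apply _ _ ψ hz]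
    simp
  have h : ((√(nuSq η m) : ℝ) : ℂ) ≠ 0 := by
    exact_mod_cast (Real.sqrt_pos.2 (nuSq_pos (by linarith : 0 < η) m)).ne'
  rw [inner_e hη h1, map_add, coeff_C_mul, coeff_X_mul_derivative, hc, div_eq_iff h]
  push_cast
  ring

open PowerSeries in
theorem inner_e_lowering (hη : 1 < η) (m : ℕ) (ψ : domK η) :
    ⟪(e m : FB η), lowering η ψ⟫_ℂ =
      ((m + 1) * √(nuSq η (m + 1)) / √(nuSq η m) : ℝ) * ⟪(e (m + 1) : FB η), (ψ : FB η)⟫_ℂ := by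
  obtain ⟨P, hP, hc⟩ := exists_isTaylor hη (ψ : FB η)
  have h1 : IsTaylor (lowering η ψ) (d⁄dX ℂ P) := by
    refine (hP.deriv ψ.1.differentiableOn).congr fun z hz => ?_
    rw [lowering, diffOp_apply _ _ ψ hz]
    simp
  rw [inner_e hη h1, coeff_derivative, hc]
  push_cast
  ring

open PowerSeries in
theorem inner_e_zero_raising (hη : 1 < η) (ψ : domK η) :
    ⟪(e 0 : FB η), raising η ψ⟫_ℂ = 0 := by
  obtain ⟨P, hP, -⟩ := exists_isTaylor hη (ψ : FB η)
  rw [inner_e hη (isTaylor_raising ψ hP), coeff_zero_X_mul, zero_div]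

open PowerSeries in
theorem inner_e_succ_raising (hη : 1 < η) (n : ℕ) (ψ : domK η) :
    ⟪(e (n + 1) : FB η), raising η ψ⟫_ℂ =
      ((n + 1) * √(nuSq η (n + 1)) / √(nuSq η n) : ℝ) * ⟪(e n : FB η), (ψ : FB η)⟫_ℂ := by
  have h0 : 0 < η := by linarith
  obtain ⟨P, hP, hc⟩ := exists_isTaylor hη (ψ : FB η)
  have hn := Real.sqrt_pos.2 (nuSq_pos h0 n)
  have hn' := Real.sqrt_pos.2 (nuSq_pos h0 (n + 1))
  have h3 : ((n : ℝ) + 1) * √(nuSq η (n + 1)) / √(nuSq η n) =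
      (2 * η + n) * √(nuSq η n) / √(nuSq η (n + 1)) := by
    rw [div_eq_div_iff hn.ne' hn'.ne', mul_assoc, mul_assoc, sqrt_nuSq_mul_self h0,
      sqrt_nuSq_mul_self h0, nuSq_succ h0]
  rw [inner_e hη (isTaylor_raising ψ hP), coeff_succ_X_mul, map_add, coeff_C_mul,
    coeff_X_mul_derivative, hc, h3]
  push_cast
  ring

/-- The coefficients of a vector in the domain of `K₀` lie in its form domain. -/
theorem summable_domK (hη : 1 < η) (ψ : domK η) :
    Summable fun n : ℕ => (n + η) * ‖⟪(e n : FB η), (ψ : FB η)⟫_ℂ‖ ^ 2 := by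
  have ho := orthonormal_e (η := η) hη
  refine Summable.of_nonneg_of_le (fun n => by positivity) (fun n => ?_)
    ((ho.inner_products_summable (ψ : FB η)).add (ho.inner_products_summable (weight η ψ)))
  rw [inner_e_weight hη, norm_mul, Complex.norm_real,
    Real.norm_of_nonneg (by positivity : (0 : ℝ) ≤ n + η), mul_pow]
  have h := sq_nonneg ‖⟪(e n : FB η), (ψ : FB η)⟫_ℂ‖
  nlinarith [sq_nonneg ((n : ℝ) + η - 1)]

/-! ### The three basic identities -/

theorem norm_k0 {z : ℂ} (hz : z ∈ disc) : ‖k0 z‖ = (1 + ‖z‖ ^ 2) / (1 - ‖z‖ ^ 2) := by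
  have h1 := one_sub_sq_pos hz
  have h2 : k0 z = (((1 + ‖z‖ ^ 2) / (1 - ‖z‖ ^ 2) : ℝ) : ℂ) := by rw [k0]; push_cast; rfl
  rw [h2, Complex.norm_real, Real.norm_of_nonneg (by positivity)]

theorem norm_two_mul_div_le {z w : ℂ} (hz : z ∈ disc) (hw : ‖w‖ = ‖z‖) :
    ‖2 * w / (1 - (‖z‖ : ℂ) ^ 2)‖ ≤ ‖k0 z‖ := by
  have h1 := one_sub_sq_pos hz
  have h2 : (1 - (‖z‖ : ℂ) ^ 2) = ((1 - ‖z‖ ^ 2 : ℝ) : ℂ) := by push_cast; rfl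
  rw [norm_k0 hz, h2, norm_div, norm_mul, hw, Complex.norm_real, Real.norm_of_nonneg h1.le,
    Complex.norm_ofNat]
  gcongr
  nlinarith [sq_nonneg (‖z‖ - 1)]

theorem measurable_kPlus : Measurable kPlus := by
  rw [funext kPlus_eq]
  have : Measurable fun z : ℂ => conj z := RCLike.continuous_conj.measurable
  fun_prop

theorem measurable_kMinus : Measurable kMinus := by
  rw [funext kMinus_eq]
  fun_prop

theorem isCore_k0 (hη : 1 < η) : IsCore k0 (weight η) := by
  refine isCore_of_hasSum hη (summable_domK hη) measurable_k0 (fun z _ => le_rfl) fun k m ψ => ?_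
  simp only [integral_k0_matFn hη]
  have h := hasSum_single (f := fun n : ℕ => ⟪(e n : FB η), (ψ : FB η)⟫_ℂ *
    if m = n then ((coreConst η k * (n + η) : ℝ) : ℂ) else 0) m fun n hn => by simp [hn.symm]
  rw [if_pos rfl] at h
  rw [inner_e_weight hη]
  convert h using 1
  push_cast
  ring

theorem isCore_kPlus (hη : 1 < η) : IsCore kPlus (lowering η) := by
  refine isCore_of_hasSum hη (summable_domK hη) measurable_kPlus (fun z hz => ?_) fun k m ψ => ?_
  · rw [kPlus_eq]
    exact norm_two_mul_div_le hz (RCLike.norm_conj z)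
  simp only [integral_kPlus_matFn hη]
  have h := hasSum_single (f := fun n : ℕ => ⟪(e n : FB η), (ψ : FB η)⟫_ℂ *
    if n = m + 1 then ((coreConst η k * ((m + 1) * √(nuSq η (m + 1)) / √(nuSq η m)) : ℝ) : ℂ)
      else 0) (m + 1) fun n hn => by rw [if_neg hn, mul_zero]
  rw [if_pos rfl] at h
  rw [inner_e_lowering hη]
  convert h using 1
  rw [Complex.ofReal_mul (coreConst η k)]
  ring

theorem isCore_kMinus (hη : 1 < η) : IsCore kMinus (raising η) := by
  refine isCore_of_hasSum hη (summable_domK hη) measurable_kMinus (fun z hz => ?_) fun k m ψ => ?_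
  · rw [kMinus_eq]
    exact norm_two_mul_div_le hz rfl
  simp only [integral_kMinus_matFn hη]
  cases m with
  | zero =>
    rw [inner_e_zero_raising hη, mul_zero]
    simp [hasSum_zero]
  | succ m =>
    have h := hasSum_single (f := fun n : ℕ => ⟪(e n : FB η), (ψ : FB η)⟫_ℂ *
      if m + 1 = n + 1 then ((coreConst η k * ((n + 1) * √(nuSq η (n + 1)) / √(nuSq η n)) : ℝ) : ℂ)
        else 0) m fun n hn => by rw [if_neg (by omega), mul_zero]
    rw [if_pos rfl] at h
    rw [inner_e_succ_raising hη]
    convert h using 1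
    rw [Complex.ofReal_mul (coreConst η k)]
    ring

theorem isCore_k2 (hη : 1 < η) :
    IsCore k2 ((1 / 2 : ℂ) • lowering η + (1 / 2 : ℂ) • raising η) := by
  have h := ((isCore_kPlus hη).smul (1 / 2)).add ((isCore_kMinus hη).smul (1 / 2))
  convert h using 1
  ext z
  rw [kPlus, kMinus]
  ring

theorem isCore_k1 (hη : 1 < η) :
    IsCore k1 ((Complex.I / 2) • lowering η + (-(Complex.I / 2)) • raising η) := by
  have h := ((isCore_kPlus hη).smul (Complex.I / 2)).add
    ((isCore_kMinus hη).smul (-(Complex.I / 2)))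
  convert h using 1
  ext z
  rw [kPlus, kMinus]
  linear_combination k1 z * Complex.I_sq

/-! ### The quantizer is diagonal -/

/-- Since `w(|z|²)` is invariant under rotations and `⟨e_m|U(p(z)) P e_n⟩` is multiplied by a character, the
quantizer is diagonal. -/
theorem quantizer_offDiag (hη : 1 < η) {w : ℝ → ℂ} {M : FB η →L[ℂ] FB η} (hM : IsQuantizer w M)
    {m n : ℕ} (h : m ≠ n) : ⟪(e m : FB η), M (e n)⟫_ℂ = 0 := by
  rw [(hM m n).2]
  have h0 : ∫ z in disc, w (‖z‖ ^ 2) / (1 - ‖z‖ ^ 2) ^ 2 *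
      ⟪(e m : FB η), disp z (parity (e n))⟫_ℂ = 0 := by
    refine integral_ball_eq_zero_of_rotate (p := n - m) (by omega) fun u hu z hz => ?_
    have hu0 : u ≠ 0 := fun h => by simp [h] at hu
    have hc : conj u = u⁻¹ := (Complex.inv_eq_conj hu).symm
    have h1 : ∀ a : ℂ, ⟪(e m : FB η), disp a (e n)⟫_ℂ = matFn m (e n : FB η) (-a) := fun a => by
      rw [matFn, neg_neg]
    simp only [parity_e, map_smul, inner_smul_right, norm_mul, hu, one_mul]
    rw [h1, h1, ← mul_neg, matFn_e_rotate hη m n hu (neg_mem_disc hz), hc, zpow_sub₀ hu0]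
    simp only [zpow_natCast, inv_pow]
    ring
  rw [h0, mul_zero]

theorem quantizer_e (hη : 1 < η) {w : ℝ → ℂ} {M : FB η →L[ℂ] FB η} (hM : IsQuantizer w M)
    (n : ℕ) : M (e n) = diagElem M n • (e n : FB η) := by
  refine (hasSum_e hη (M (e n))).unique ?_
  refine hasSum_single n fun m hm => ?_
  rw [quantizer_offDiag hη hM hm, zero_smul]

theorem hasSum_inner_quantizer (hη : 1 < η) {w : ℝ → ℂ} {M : FB η →L[ℂ] FB η}
    (hM : IsQuantizer w M) (x y : FB η) :
    HasSum (fun k => diagElem M k * (conj ⟪(e k : FB η), x⟫_ℂ * ⟪(e k : FB η), y⟫_ℂ))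
      ⟪x, M y⟫_ℂ := by
  have h := (hasSum_e hη y).mapL ((innerSL ℂ x).comp M)
  refine h.congr_fun fun k => ?_
  rw [ContinuousLinearMap.comp_apply, map_smul, quantizer_e hη hM, innerSL_apply_apply,
    inner_smul_right, inner_smul_right, inner_conj_symm]
  ring

/-! ### Summation over the diagonal of the quantizer -/

/-- Termwise integration of a series that converges absolutely in `L¹`. -/
theorem integrable_and_hasSum_integral {μ : Measure ℂ} {F : ℕ → ℂ → ℂ} {g : ℂ → ℂ}
    (hF : ∀ i, Integrable (F i) μ) (hsum : Summable fun i => ∫ a, ‖F i a‖ ∂μ)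
    (hg : ∀ᵐ a ∂μ, HasSum (fun i => F i a) (g a)) :
    Integrable g μ ∧ HasSum (fun i => ∫ a, F i a ∂μ) (∫ a, g a ∂μ) := by
  constructor
  · refine ⟨aestronglyMeasurable_of_tendsto_ae atTop (f := fun N a =>
      ∑ i ∈ Finset.range N, F i a) (fun N =>
        Finset.aestronglyMeasurable_fun_sum _ fun i _ => (hF i).1)
      (hg.mono fun a ha => ha.tendsto_sum_nat), ?_⟩
    have h1 : ∫⁻ a, ‖g a‖ₑ ∂μ ≤ ∫⁻ a, ∑' i, ‖F i a‖ₑ ∂μ := by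
      refine lintegral_mono_ae (hg.mono fun a ha => ?_)
      exact le_of_tendsto ha.enorm (Eventually.of_forall fun s =>
        (enorm_sum_le _ _).trans (ENNReal.sum_le_tsum s))
    refine h1.trans_lt ?_
    rw [lintegral_tsum fun i => (hF i).1.enorm]
    simp only [← ofReal_integral_norm_eq_lintegral_enorm (hF _)]
    rw [← ENNReal.ofReal_tsum_of_nonneg (fun i => integral_nonneg fun _ => norm_nonneg _) hsum]
    exact ENNReal.ofReal_lt_top
  · have h := hasSum_integral_of_summable_integral_norm hF hsum
    rwa [integral_congr_ae (hg.mono fun a ha => ha.tsum_eq)] at h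

/-- For an absolutely convergent series `∑ k M_kk`, the bound in `IsCore` permits termwise integration, so
that the factors `k + η` add up to `∑ (k + η) M_kk = S + η`. -/
theorem isQuantization_of_isCore (hη : 1 < η) {w : ℝ → ℂ} {M : FB η →L[ℂ] FB η}
    (hM : IsQuantizer w M) (htc : IsTraceClass M) (htr : trace M = 1) {S : ℂ}
    (hS : HasSum (fun k : ℕ => (k : ℂ) * diagElem M k) S) {f : ℂ → ℂ} {A : domK η →ₗ[ℂ] FB η}
    (hf : IsCore f A) {B : FB η →ₗ.[ℂ] FB η} (hB : IsScaled (gammaConst η S) A B) :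
    IsQuantization (fun z => transported M z) f B := by
  intro φ ψ
  obtain ⟨hφ, -⟩ := hB φ
  obtain ⟨hψ, hψB⟩ := hB ψ
  obtain ⟨⟨b, hb⟩, hk⟩ := hf ⟨φ, hφ⟩ ⟨ψ, hψ⟩
  have ho := orthonormal_e (η := η) hη
  have hdiag : Summable fun k => ‖diagElem M k‖ := htc _ _ ho ho
  have hdiagS : HasSum (diagElem M) 1 := htr ▸ hdiag.of_norm.hasSum
  have hkdiag : Summable fun k : ℕ => (k : ℝ) * ‖diagElem M k‖ := by
    simpa using hS.summable.norm
  have key := integrable_and_hasSum_integral (μ := volume.restrict disc)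
    (F := fun k a => diagElem M k * (f a / (1 - ‖a‖ ^ 2) ^ 2 *
      (conj (matFn k (φ : FB η) a) * matFn k (ψ : FB η) a)))
    (g := integrand (fun z => transported M z) f φ ψ)
    (fun k => (hk k).1.const_mul _) ?_ ?_
  · refine ⟨key.1, ?_⟩
    have h1 := key.2.mul_left ((2 * η - 1) / Real.pi : ℂ)
    refine HasSum.unique ?_ h1
    have h2 := ((hS.add (hdiagS.mul_left (η : ℂ))).div_const ((η : ℂ) * (η - 1))).mul_right
      ⟪(φ : FB η), A ⟨ψ, hψ⟩⟫_ℂ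
    rw [hψB, inner_smul_right, gammaConst_eq hη, ← mul_one (η : ℂ), mul_one (η : ℂ)]
    rw [mul_one] at h2
    refine h2.congr_fun fun k => ?_
    rw [integral_const_mul, (hk k).2]
    have h3 := mul_coreConst hη k
    linear_combination (diagElem M k * ⟪(φ : FB η), A ⟨ψ, hψ⟩⟫_ℂ) * h3
  · simp only [norm_mul (diagElem M _), integral_const_mul]
    refine Summable.of_nonneg_of_le (fun k => mul_nonneg (norm_nonneg _)
      (integral_nonneg fun _ => norm_nonneg _))
      (fun k => mul_le_mul_of_nonneg_left (hb k) (norm_nonneg _))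
      (((hkdiag.add (hdiag.mul_left η)).mul_left b).congr fun k => by ring)
  · filter_upwards [ae_restrict_mem measurableSet_disc] with a ha
    rw [integrand, inner_transported M ha]
    refine ((hasSum_inner_quantizer hη hM (disp (-a) (φ : FB η)) (disp (-a) (ψ : FB η))).mul_left
      (f a / (1 - ‖a‖ ^ 2) ^ 2)).congr_fun fun k => ?_
    rw [matFn, matFn]
    ring

theorem integrand_proj (k : ℕ) (f : ℂ → ℂ) (φ ψ : FB η) {a : ℂ} (ha : a ∈ disc) :
    integrand (fun z => transported (proj k) z) f φ ψ a =
      f a / (1 - ‖a‖ ^ 2) ^ 2 * (conj (matFn k φ a) * matFn k ψ a) := by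
  rw [integrand, inner_transported _ ha, proj, InnerProductSpace.rankOne_apply, inner_smul_right,
    matFn, matFn, inner_conj_symm]
  ring

theorem SumsTo.add {ι : Type} {l : Filter ι} {c : ι → ℕ → ℝ} {a b : ℕ → ℂ} {s t : ℂ}
    (ha : SumsTo l c a s) (hb : SumsTo l c b t) : SumsTo l c (fun k => a k + b k) (s + t) := by
  simp only [SumsTo, mul_add]
  constructor
  · filter_upwards [ha.1, hb.1] with i h1 h2 using h1.add h2
  · refine (ha.2.add hb.2).congr' ?_
    filter_upwards [ha.1, hb.1] with i h1 h2 using (h1.tsum_add h2).symm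

theorem SumsTo.const_mul {ι : Type} {l : Filter ι} {c : ι → ℕ → ℝ} {a : ℕ → ℂ} {s : ℂ}
    (ha : SumsTo l c a s) (q : ℂ) : SumsTo l c (fun k => q * a k) (q * s) := by
  simp only [SumsTo, mul_left_comm _ q]
  constructor
  · filter_upwards [ha.1] with i h1 using h1.mul_left q
  · simpa only [tsum_mul_left] using ha.2.const_mul q

/-- Summation methods by convergence factors sum absolutely convergent series to their usual sum. -/
theorem IsSummationMethod.sumsTo {ι : Type} {l : Filter ι} {c : ι → ℕ → ℝ}
    (hc : IsSummationMethod l c) {a : ℕ → ℂ} (ha : Summable fun k => ‖a k‖) :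
    SumsTo l c a (∑' k, a k) := by
  obtain ⟨b, hb⟩ := hc.bounded
  have hle : ∀ᶠ i in l, ∀ k, ‖(c i k : ℂ) * a k‖ ≤ b * ‖a k‖ := by
    filter_upwards [hb] with i hi k
    rw [norm_mul, Complex.norm_real]
    exact mul_le_mul_of_nonneg_right (hi k) (norm_nonneg _)
  constructor
  · filter_upwards [hle] with i hi using Summable.of_norm_bounded (ha.mul_left b) hi
  · refine tendsto_tsum_of_dominated_convergence (ha.mul_left b) (fun k => ?_) hle
    have h := ((Complex.continuous_ofReal.tendsto 1).comp (hc.tendsto k)).mul_const (a k)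
    simpa using h

/-- The summed version needs no interchange of sum and integral: the `k`-th term is `(k + η) M_kk` times a
constant, and the trace is summed by any method. -/
theorem isSummedQuantization_of_isCore (hη : 1 < η) {M : FB η →L[ℂ] FB η}
    (htc : IsTraceClass M) (htr : trace M = 1) {S : ℂ} {ι : Type} {l : Filter ι} {c : ι → ℕ → ℝ}
    (hc : IsSummationMethod l c) (hS : SumsTo l c (fun k : ℕ => (k : ℂ) * diagElem M k) S)
    {f : ℂ → ℂ} {A : domK η →ₗ[ℂ] FB η} (hf : IsCore f A) {B : FB η →ₗ.[ℂ] FB η}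
    (hB : IsScaled (gammaConst η S) A B) :
    IsSummedQuantization l c (diagElem M) (fun k z => transported (proj k) z) f B := by
  intro φ ψ
  obtain ⟨hφ, -⟩ := hB φ
  obtain ⟨hψ, hψB⟩ := hB ψ
  obtain ⟨-, hk⟩ := hf ⟨φ, hφ⟩ ⟨ψ, hψ⟩
  have ho := orthonormal_e (η := η) hη
  have htrace : SumsTo l c (diagElem M) 1 := htr ▸ hc.sumsTo (htc _ _ ho ho)
  have hint : ∀ k, IntegrableOn (integrand (fun z => transported (proj k) z) f φ.1 ψ.1) disc :=
    fun k => (integrableOn_congr_fun (fun a ha => integrand_proj k f φ.1 ψ.1 ha)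
      measurableSet_disc).2 (hk k).1
  have heq : ∀ k, ∫ z in disc, integrand (fun z => transported (proj k) z) f φ.1 ψ.1 z =
      coreConst η k * ⟪(φ : FB η), A ⟨ψ, hψ⟩⟫_ℂ := fun k =>
    (setIntegral_congr_fun measurableSet_disc fun a ha =>
      integrand_proj k f φ.1 ψ.1 ha).trans (hk k).2
  refine ⟨hint, ?_⟩
  have h := (hS.add (htrace.const_mul (η : ℂ))).const_mul
    (⟪(φ : FB η), A ⟨ψ, hψ⟩⟫_ℂ / (η * (η - 1)))
  have hval : ⟪(φ : FB η), B ψ⟫_ℂ =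
      ⟪(φ : FB η), A ⟨ψ, hψ⟩⟫_ℂ / (η * (η - 1)) * (S + η * 1) := by
    rw [hψB, inner_smul_right, gammaConst_eq hη]
    ring
  rw [hval]
  refine (congrArg (fun a => SumsTo l c a _) (funext fun k => ?_)).mp h
  rw [heq]
  linear_combination (-diagElem M k * ⟪(φ : FB η), A ⟨ψ, hψ⟩⟫_ℂ) * mul_coreConst hη k

/-! ### The conjugate labelling -/

/-- The disk and the Lebesgue measure are invariant under complex conjugation. -/
theorem conj_setIntegral_disc (g : ℂ → ℂ) :
    (IntegrableOn (fun z => g (conj z)) disc ↔ IntegrableOn g disc) ∧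
      ∫ z in disc, g (conj z) = ∫ z in disc, g z := by
  have hmp := Complex.conjLIE.measurePreserving
  have hme : MeasurableEmbedding Complex.conjLIE :=
    Complex.conjLIE.toHomeomorph.measurableEmbedding
  have hpre : Complex.conjLIE ⁻¹' disc = disc := by
    ext z; simp [mem_disc]
  have h1 := hmp.integrableOn_comp_preimage hme (f := g) (s := disc)
  have h2 := hmp.setIntegral_preimage_emb hme g disc
  rw [hpre] at h1 h2
  exact ⟨h1, h2⟩

theorem integrand_conj (N : ℂ → FB η →L[ℂ] FB η) (f : ℂ → ℂ) (φ ψ : FB η) :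
    integrand (fun z => N (conj z)) f φ ψ =
      fun z => integrand N (fun z => f (conj z)) φ ψ (conj z) := by
  ext z
  simp [integrand]

theorem IsQuantization.conj {N : ℂ → FB η →L[ℂ] FB η} {f : ℂ → ℂ} {B : FB η →ₗ.[ℂ] FB η}
    (h : IsQuantization N (fun z => f (conj z)) B) :
    IsQuantization (fun z => N (conj z)) f B := by
  intro φ ψ
  obtain ⟨h1, h2⟩ := h φ ψ
  rw [integrand_conj, (conj_setIntegral_disc _).1, (conj_setIntegral_disc _).2]
  exact ⟨h1, h2⟩

theorem IsSummedQuantization.conj {ι : Type} {l : Filter ι} {c : ι → ℕ → ℝ} {m : ℕ → ℂ}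
    {N : ℕ → ℂ → FB η →L[ℂ] FB η} {f : ℂ → ℂ} {B : FB η →ₗ.[ℂ] FB η}
    (h : IsSummedQuantization l c m N (fun z => f (conj z)) B) :
    IsSummedQuantization l c m (fun k z => N k (conj z)) f B := by
  intro φ ψ
  obtain ⟨h1, h2⟩ := h φ ψ
  simp only [integrand_conj, (conj_setIntegral_disc _).1, (conj_setIntegral_disc _).2]
  exact ⟨h1, h2⟩

/-! ### The ten identities -/

/-- The five identities for the direct labelling follow for any property `P` that holds whenever
`B = γ A` and the observable has core `A`. -/
theorem five_identities (hη : 1 < η) {γ : ℂ} {P : (ℂ → ℂ) → (FB η →ₗ.[ℂ] FB η) → Prop}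
    (H : ∀ f A B, IsCore f A → IsScaled γ A B → P f B) :
    P k0 (γ • K0 η) ∧ P k1 ((-γ) • K1 η) ∧ P k2 (γ • K2 η) ∧ P kPlus (γ • KMinus η) ∧
      P kMinus (γ • KPlus η) := by
  have h1 : IsScaled γ ((Complex.I / 2) • lowering η + (-(Complex.I / 2)) • raising η)
      ((-γ) • K1 η) := by simpa using isScaled_smul isScaled_K1 (-γ)
  have H' : ∀ f A B, IsCore f A → IsScaled 1 A B → P f (γ • B) := fun f A B hf hB =>
    H f A _ hf (by simpa using isScaled_smul hB γ)
  exact ⟨H' _ _ _ (isCore_k0 hη) isScaled_K0, H _ _ _ (isCore_k1 hη) h1,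
    H' _ _ _ (isCore_k2 hη) isScaled_K2, H' _ _ _ (isCore_kPlus hη) isScaled_KMinus,
    H' _ _ _ (isCore_kMinus hη) isScaled_KPlus⟩

/-- The five identities for the conjugate labelling: complex conjugation fixes `k₀` and `k₂`, changes
the sign of `k₁` and exchanges `k₊` and `k₋`. -/
theorem five_identities_conj (hη : 1 < η) {γ : ℂ} {P : (ℂ → ℂ) → (FB η →ₗ.[ℂ] FB η) → Prop}
    (H : ∀ f A B, IsCore (fun z => f (conj z)) A → IsScaled γ A B → P f B) :
    P k0 (γ • K0 η) ∧ P k1 (γ • K1 η) ∧ P k2 (γ • K2 η) ∧ P kPlus (γ • KPlus η) ∧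
      P kMinus (γ • KMinus η) := by
  have h0 : (fun z => k0 (conj z)) = k0 := by ext z; simp [k0]
  have h1 : (fun z => k1 (conj z)) = fun z => -1 * k1 z := by
    ext z; simp only [k1, Complex.conj_conj, RCLike.norm_conj]; ring
  have h2 : (fun z => k2 (conj z)) = k2 := by
    ext z; simp only [k2, Complex.conj_conj, RCLike.norm_conj]; ring
  have hp : (fun z => kPlus (conj z)) = kMinus := by
    ext z; simp only [kPlus_eq, kMinus_eq, Complex.conj_conj, RCLike.norm_conj]
  have hm : (fun z => kMinus (conj z)) = kPlus := by
    ext z; simp only [kPlus_eq, kMinus_eq, RCLike.norm_conj]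
  have H' : ∀ f A B, IsCore (fun z => f (conj z)) A → IsScaled 1 A B → P f (γ • B) :=
    fun f A B hf hB => H f A _ hf (by simpa using isScaled_smul hB γ)
  have hK1 : IsScaled 1
      ((-1 : ℂ) • ((Complex.I / 2) • lowering η + (-(Complex.I / 2)) • raising η)) (K1 η) :=
    fun ψ => by
      obtain ⟨hd, h⟩ := isScaled_K1 (η := η) ψ
      exact ⟨hd, by rw [h, LinearMap.smul_apply (-1 : ℂ), one_smul]⟩
  refine ⟨H' k0 _ _ ?_ isScaled_K0, H' k1 _ _ ?_ hK1, H' k2 _ _ ?_ isScaled_K2,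
    H' kPlus _ _ ?_ isScaled_KPlus, H' kMinus _ _ ?_ isScaled_KMinus⟩
  · rw [h0]; exact isCore_k0 hη
  · rw [h1]; exact (isCore_k1 hη).smul (-1)
  · rw [h2]; exact isCore_k2 hη
  · rw [hp]; exact isCore_kMinus hη
  · rw [hm]; exact isCore_kPlus hη

end

end SU11

end

theorem mainTheorem1 (η : ℝ) [Fact (1 / 2 < η)] (hη : 1 < η) (w : ℝ → ℂ)
    (M : SU11.FB η →L[ℂ] SU11.FB η) (hM : SU11.IsQuantizer w M) (hM_tc : SU11.IsTraceClass M)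
    (hM_tr : SU11.trace M = 1) (S : ℂ) :
    (HasSum (fun k : ℕ => (k : ℂ) * SU11.diagElem M k) S →
      let γ := SU11.gammaConst η S
      (SU11.IsQuantization (fun z => SU11.transported M z) SU11.k0 (γ • SU11.K0 η) ∧
        SU11.IsQuantization (fun z => SU11.transported M z) SU11.k1 ((-γ) • SU11.K1 η) ∧
        SU11.IsQuantization (fun z => SU11.transported M z) SU11.k2 (γ • SU11.K2 η) ∧
        SU11.IsQuantization (fun z => SU11.transported M z) SU11.kPlus (γ • SU11.KMinus η) ∧
        SU11.IsQuantization (fun z => SU11.transported M z) SU11.kMinus (γ • SU11.KPlus η)) ∧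
      (SU11.IsQuantization (fun z => SU11.transported M (conj z)) SU11.k0 (γ • SU11.K0 η) ∧
        SU11.IsQuantization (fun z => SU11.transported M (conj z)) SU11.k1 (γ • SU11.K1 η) ∧
        SU11.IsQuantization (fun z => SU11.transported M (conj z)) SU11.k2 (γ • SU11.K2 η) ∧
        SU11.IsQuantization (fun z => SU11.transported M (conj z)) SU11.kPlus
          (γ • SU11.KPlus η) ∧
        SU11.IsQuantization (fun z => SU11.transported M (conj z)) SU11.kMinus
          (γ • SU11.KMinus η))) ∧
    (∀ (ι : Type) (l : Filter ι) (c : ι → ℕ → ℝ), SU11.IsSummationMethod l c →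
      SU11.SumsTo l c (fun k : ℕ => (k : ℂ) * SU11.diagElem M k) S →
      let γ := SU11.gammaConst η S
      let Q := SU11.IsSummedQuantization l c (SU11.diagElem M)
        (fun k z => SU11.transported (SU11.proj k) z)
      let Q' := SU11.IsSummedQuantization l c (SU11.diagElem M)
        (fun k z => SU11.transported (SU11.proj k) (conj z))
      (Q SU11.k0 (γ • SU11.K0 η) ∧ Q SU11.k1 ((-γ) • SU11.K1 η) ∧ Q SU11.k2 (γ • SU11.K2 η) ∧
        Q SU11.kPlus (γ • SU11.KMinus η) ∧ Q SU11.kMinus (γ • SU11.KPlus η)) ∧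
      (Q' SU11.k0 (γ • SU11.K0 η) ∧ Q' SU11.k1 (γ • SU11.K1 η) ∧ Q' SU11.k2 (γ • SU11.K2 η) ∧
        Q' SU11.kPlus (γ • SU11.KPlus η) ∧ Q' SU11.kMinus (γ • SU11.KMinus η))) := by
  refine ⟨fun hS => ?_, fun ι l c hc hS => ?_⟩
  · have h : ∀ f A B, SU11.IsCore f A → SU11.IsScaled (SU11.gammaConst η S) A B →
        SU11.IsQuantization (fun z => SU11.transported M z) f B := fun f A B hf hB =>
      SU11.isQuantization_of_isCore hη hM hM_tc hM_tr hS hf hB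
    exact ⟨SU11.five_identities hη h,
      SU11.five_identities_conj hη fun f A B hf hB => (h _ A B hf hB).conj⟩
  · have h : ∀ f A B, SU11.IsCore f A → SU11.IsScaled (SU11.gammaConst η S) A B →
        SU11.IsSummedQuantization l c (SU11.diagElem M)
          (fun k z => SU11.transported (SU11.proj k) z) f B := fun f A B hf hB =>
      SU11.isSummedQuantization_of_isCore hη hM_tc hM_tr hc hS hf hB
    exact ⟨SU11.five_identities hη h,
      SU11.five_identities_conj hη fun f A B hf hB => (h _ A B hf hB).conj⟩
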